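/- **Setting.** Let $Q$ be a smooth manifold. Let $(R,Y)$ be a hermitian bundle gerbe over $Q$ with connection and curving: a surjective submersion $\pi\colon Y\to Q$, a hermitian line bundle $R\to Y^{[2]}$ with an associative isometric product $R_{(y_1,y_2)}\otimes R_{(y_2,y_3)}\to R_{(y_1,y_3)}$, a unitary connection $\nabla$ on $R$ compatible with the product, and an (imaginary) two-form $f$ on $Y$ with $F_\nabla(y_1,y_2)=f(y_1)-f(y_2)$. Let $\zeta$ be its Deligne two-class. Let $E\to Y$ be a bundle gerbe module of finite rank (a hermitian vector bundle with an associative isometric isomorphism $R_{(y_1,y_2)}\otimes E_{y_2}\cong E_{y_1}$), with a bundle gerbe module connection $A$, i.e. one compatible with this isomorphism and with $\nabla$. (The existence of $E$ forces the Dixmier–Douady class of $(R,Y)$ to be torsion.) Let $D$ be the closed unit disk, $D(Q)$ the set of smooth maps $D\to Q$, $L(Q)$ the set of smooth loops, $\partial\colon D(Q)\to L(Q)$ the restriction to the boundary, and $L_0(Q)=\partial(D(Q))$, so that $L_0(Q)=L(Q)$ if $Q$ is simply connected. A trivialisation of the gerbe over $\sigma\in D(Q)$ is a hermitian line bundle $J\to\sigma^*Y$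 with a unitary connection $\nabla_J$ and an associative isometric isomorphism $R_{(y_1,y_2)}\otimes J_{y_2}\cong J_{y_1}$ preserving the connections. Then $f-F_{\nabla_J}$ is the pull-back of a two-form $\mu_J$ on $D$, and $(E\otimes J^*,A-\nabla_J)$ descends to a vector bundle with connection $(E_J,D_J)$ on $D$. Put $$ s_A(\sigma)=\operatorname{tr}\operatorname{hol}_{\partial D}(D_J)\,\exp\Bigl(\int_D\mu_J\Bigr). $$ If $\partial\sigma_1=\partial\sigma_2$, let $\sigma_1\#\sigma_2$ be the resulting map of the two-sphere, oriented by the first disk. A trivialisation over it consists of trivialisations $J_i$ over $\sigma_i$ and an isomorphism, preserving connections, of $J_1$ and $J_2$ over the common boundary; the gerbe holonomy over it is $$h(\sigma_1\#\sigma_2)=\exp\Bigl(\int_{D}\mu_{J_1}-\int_D\mu_{J_2}\Bigr).$$ Let $L_\zeta$ be the set of classes of pairs $(\sigma,z)\in D(Q)\times\mathbb C$ under $(\sigma,z)\sim(\sigma',z')$ if $\partial\sigma=\partial\sigma'$ and $z=h(\sigma\#\sigma')z'$, projected to $L(Q)$ by $[\sigma,z]\mapsto\partial\sigma$. **Lemma.**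 1. Every $\sigma\in D(Q)$ has a trivialisation, and $s_A(\sigma)$ does not depend on its choice. If $\partial\sigma_1=\partial\sigma_2$, then $\sigma_1\#\sigma_2$ has a trivialisation, and $h(\sigma_1\#\sigma_2)$ does not depend on its choice. 2. If $\partial\sigma_1=\partial\sigma_2$, then $s_A(\sigma_1)=h(\sigma_1\#\sigma_2)\,s_A(\sigma_2)$. 3. For every $\sigma\in D(Q)$ the map $z\mapsto[\sigma,z]$ is a bijection of $\mathbb C$ with the fibre of $L_\zeta$ over $\partial\sigma$, and there is a unique section $\operatorname{tr}\operatorname{hol}(A)$ of $L_\zeta$ over $L_0(Q)$ with $\operatorname{tr}\operatorname{hol}(A)(\partial\sigma)=[\sigma,s_A(\sigma)]$ for all $\sigma\in D(Q)$. 4. Let $Q$ be a submanifold of a manifold $M$, let $\Sigma$ be a compact connected oriented surface with one boundary component, identified with $S^1$, and let $\Sigma_Q(M)$ be the set of smooth maps $\nu\colon\Sigma\to M$ with $\partial\nu=\nu|_{\partial\Sigma}$ in $Q$. Let $\xi$ and $\alpha$ be Deligne two-classes on $M$ and $Q$, given as differential characters with holonomies $h_\xi$, $h_\alpha$ on smooth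 singular two-cycles. Let $\mathrm{Pf}$ be any section of $\partial^{-1}L_\alpha$ over $\Sigma_Q(M)$ (for example the Pfaffian, when $\alpha=\alpha(w_2)$ is the Deligne class of the second Stiefel–Whitney class of the normal bundle), i.e. a complex function of $(\sigma,\nu)\in D(Q)\times\Sigma_Q(M)$, $\partial\sigma=\partial\nu$, with $\mathrm{Pf}(\sigma_1,\nu)=h_\alpha(\sigma_1\#\sigma_2)\mathrm{Pf}(\sigma_2,\nu)$; let $\phi_{-\xi}(\sigma,\nu)=h_\xi(\sigma\#\nu)^{-1}$; and let $\chi$ be any section of $L_\alpha^*\otimes L_\zeta^*\otimes L_{\xi|_Q}$, i.e. a function $\chi\colon D(Q)\to\mathbb C$ with $$\chi(\sigma_1)=h_\alpha(\sigma_1\#\sigma_2)^{-1}h(\sigma_1\#\sigma_2)^{-1}h_\xi(\sigma_1\#\sigma_2)\,\chi(\sigma_2)$$ whenever $\partial\sigma_1=\partial\sigma_2$. Then the world-sheet action $\mathrm{Pf}\otimes\partial^{-1}(\operatorname{tr}\operatorname{hol}(A))\otimes\phi_{-\xi}\otimes\partial^{-1}(\chi)$ is a well-defined function: there is a unique function $W$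 on $\{\nu\in\Sigma_Q(M):\partial\nu\in L_0(Q)\}$ with $$W(\nu)=\mathrm{Pf}(\sigma,\nu)\,s_A(\sigma)\,\phi_{-\xi}(\sigma,\nu)\,\chi(\sigma)$$ for every $\sigma\in D(Q)$ with $\partial\sigma=\partial\nu$. -/

import Mathlib

open scoped Manifold ContDiff Topology
open Set

noncomputable section

/-! ### Smooth maps from the closed unit disk, loops -/

/-- Extension of a map defined on a set `S` to the ambient space, constant outside `S`. -/
def extendConst {E X : Type*} (S : Set E) (x₀ : S) (f : S → X) : E → X :=
  open Classical in fun x => if h : x ∈ S then f ⟨x, h⟩ else f x₀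

theorem extendConst_of_mem {E X : Type*} {S : Set E} {x₀ : S} {f : S → X} {x : E} (h : x ∈ S) :
    extendConst S x₀ f x = f ⟨x, h⟩ := by
  simp [extendConst, h]

/-- The closed unit disk `D` in the complex plane, oriented by the complex structure. -/
abbrev unitDisk : Set ℂ := Metric.closedBall 0 1

/-- The centre of the disk. -/
def diskCentre : unitDisk := ⟨0, by simp⟩

theorem circle_mem_unitDisk (z : Circle) : (z : ℂ) ∈ unitDisk := by
  simp [Circle.norm_coe]

/-- `D(X)`: the smooth maps from the closed unit disk to `X`. -/
structure Disk {E : Type*} [NormedAddCommGroup E] [NormedSpace ℝ E]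
    (X : Type*) [TopologicalSpace X] [ChartedSpace E X] where
  toFun : unitDisk → X
  smooth : ContMDiffOn 𝓘(ℝ, ℂ) 𝓘(ℝ, E) ∞ (extendConst unitDisk diskCentre toFun) unitDisk

/-- `L(X)`: the smooth loops in `X`. -/
abbrev Loop {E : Type*} [NormedAddCommGroup E] [NormedSpace ℝ E]
    (X : Type*) [TopologicalSpace X] [ChartedSpace E X] :=
  ContMDiffMap (𝓡 1) 𝓘(ℝ, E) Circle X ∞

section DiskBasics

variable {E : Type*} [NormedAddCommGroup E] [NormedSpace ℝ E]
  {X : Type*} [TopologicalSpace X] [ChartedSpace E X]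
  {E' : Type*} [NormedAddCommGroup E'] [NormedSpace ℝ E']
  {X' : Type*} [TopologicalSpace X'] [ChartedSpace E' X']

/-- A disk in `X` as a map on the plane; only its values on the closed unit disk matter. -/
def Disk.ext (σ : Disk (E := E) X) : ℂ → X := extendConst unitDisk diskCentre σ.toFun

theorem contMDiff_circle_coe : ContMDiff (𝓡 1) 𝓘(ℝ, ℂ) ∞ (fun z : Circle => (z : ℂ)) :=
  haveI : Fact (Module.finrank ℝ ℂ = 1 + 1) := finrank_real_complex_fact'
  contMDiff_coe_sphere

/-- The boundary map `∂ : D(X) → L(X)`. -/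
def Disk.boundary (σ : Disk (E := E) X) : Loop (E := E) X :=
  ⟨fun z => σ.ext z, σ.smooth.comp_contMDiff contMDiff_circle_coe circle_mem_unitDisk⟩

/-- The composition of a disk with a smooth map. -/
def Disk.map (f : X → X') (hf : ContMDiff 𝓘(ℝ, E) 𝓘(ℝ, E') ∞ f) (σ : Disk (E := E) X) :
    Disk (E := E') X' where
  toFun x := f (σ.toFun x)
  smooth := (hf.comp_contMDiffOn σ.smooth).congr fun x hx => by
    simp [extendConst_of_mem hx]

end DiskBasics

/-- The standard parametrisation `t ↦ exp (2π i t)` of the boundary circle. -/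
def circ (t : ℝ) : ℂ := Circle.exp (2 * Real.pi * t)

/-- Its velocity. -/
def circVel (t : ℝ) : ℂ := 2 * Real.pi * Complex.I * circ t

/-! ### Forms -/

/-- The coefficient `(dα)(∂₁, ∂₂)` of the exterior derivative of a one-form `α` on a subset `S`
of the plane. -/
def curl (S : Set ℂ) (α : ℂ → ℂ →L[ℝ] ℝ) (x : ℂ) : ℝ :=
  (fderivWithin ℝ α S x 1) Complex.I - (fderivWithin ℝ α S x Complex.I) 1

section Forms

variable {E : Type*} [NormedAddCommGroup E] [NormedSpace ℝ E]
  {X : Type*} [TopologicalSpace X] [ChartedSpace E X]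

/-- The velocity of a curve. -/
def vel (c : ℝ → X) (t : ℝ) : TangentSpace 𝓘(ℝ, E) (c t) :=
  mfderiv 𝓘(ℝ, ℝ) 𝓘(ℝ, E) c t (1 : ℝ)

/-- The pull-back of a one-form by a map from a subset `S` of the plane. -/
def pullOne (θ : (x : X) → TangentSpace 𝓘(ℝ, E) x →L[ℝ] ℝ) (S : Set ℂ) (u : ℂ → X) (x : ℂ) :
    ℂ →L[ℝ] ℝ :=
  (θ (u x)).comp (mfderivWithin 𝓘(ℝ, ℂ) 𝓘(ℝ, E) u S x)

/-- The coefficient `(u^* f)(∂₁, ∂₂)` of the pull-back of a two-form by a map from a subset `S`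
of the plane. -/
def pullTwo (f : (x : X) → TangentSpace 𝓘(ℝ, E) x →L[ℝ] TangentSpace 𝓘(ℝ, E) x →L[ℝ] ℝ)
    (S : Set ℂ) (u : ℂ → X) (x : ℂ) : ℝ :=
  f (u x) (mfderivWithin 𝓘(ℝ, ℂ) 𝓘(ℝ, E) u S x (1 : ℂ))
    (mfderivWithin 𝓘(ℝ, ℂ) 𝓘(ℝ, E) u S x Complex.I)

end Forms

/-! ### Bundle gerbes with connection and curving -/

/-- A hermitian bundle gerbe over `Q` with connection and curving.  The hermitian line bundle
`R → Y^[2]` is given through its principal `U(1)`-bundle `P` of unit vectors: a point `p : P` is a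
unit vector of `R_(y₁, y₂)` with `y₁ = tgt p`, `y₂ = src p`, and the bundle gerbe product is
`mul : R_(y₁, y₂) ⊗ R_(y₂, y₃) → R_(y₁, y₃)`.  A map on the submanifold `Y^[2]` of `Y × Y` (or on
the fibre product of `P` with itself) is smooth if it is `ContMDiffOn` on that subset.
The connection on `R` is `i` times the real one-form `conn` on `P`, and the curving is `i` times
the real two-form `curving`. Compatibility conditions on fibre products are tested on
smooth curves and smooth maps from the plane. -/
structure BundleGerbe {EQ EY EP : Type*}
    [NormedAddCommGroup EQ] [NormedSpace ℝ EQ] [NormedAddCommGroup EY] [NormedSpace ℝ EY]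
    [NormedAddCommGroup EP] [NormedSpace ℝ EP]
    (Q Y P : Type*) [TopologicalSpace Q] [ChartedSpace EQ Q]
    [TopologicalSpace Y] [ChartedSpace EY Y] [IsManifold 𝓘(ℝ, EY) ∞ Y]
    [TopologicalSpace P] [ChartedSpace EP P] [IsManifold 𝓘(ℝ, EP) ∞ P] [MulAction Circle P] where
  /-- the surjective submersion -/
  proj : Y → Q
  submersion : Manifold.IsSubmersion 𝓘(ℝ, EY) 𝓘(ℝ, EQ) ∞ proj
  surjective : Function.Surjective proj
  -- the principal circle bundle `P → Y^[2]`
  tgt : P → Y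
  src : P → Y
  smooth_tgt : ContMDiff 𝓘(ℝ, EP) 𝓘(ℝ, EY) ∞ tgt
  smooth_src : ContMDiff 𝓘(ℝ, EP) 𝓘(ℝ, EY) ∞ src
  proj_tgt : ∀ p, proj (tgt p) = proj (src p)
  smooth_smul : ContMDiff ((𝓡 1).prod 𝓘(ℝ, EP)) 𝓘(ℝ, EP) ∞ (fun x : Circle × P => x.1 • x.2)
  tgt_smul : ∀ (z : Circle) p, tgt (z • p) = tgt p
  src_smul : ∀ (z : Circle) p, src (z • p) = src p
  free : ∀ (z : Circle) (p : P), z • p = p → z = 1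
  locallyTrivial : ∀ y₁ y₂, proj y₁ = proj y₂ → ∃ W ∈ 𝓝 (y₁, y₂), ∃ (s : Y × Y → P) (c : P → Circle),
    ContMDiffOn (𝓘(ℝ, EY).prod 𝓘(ℝ, EY)) 𝓘(ℝ, EP) ∞ s (W ∩ {w | proj w.1 = proj w.2}) ∧
    ContMDiffOn 𝓘(ℝ, EP) (𝓡 1) ∞ c {p | (tgt p, src p) ∈ W} ∧
    (∀ w ∈ W, proj w.1 = proj w.2 → tgt (s w) = w.1 ∧ src (s w) = w.2) ∧
    ∀ p, (tgt p, src p) ∈ W → c p • s (tgt p, src p) = p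
  -- the bundle gerbe product
  mul : P → P → P
  tgt_mul : ∀ p q, src p = tgt q → tgt (mul p q) = tgt p
  src_mul : ∀ p q, src p = tgt q → src (mul p q) = src q
  smooth_mul : ContMDiffOn (𝓘(ℝ, EP).prod 𝓘(ℝ, EP)) 𝓘(ℝ, EP) ∞ (fun x : P × P => mul x.1 x.2)
    {x | src x.1 = tgt x.2}
  smul_mul : ∀ (z : Circle) p q, src p = tgt q → mul (z • p) q = z • mul p q
  mul_smul : ∀ (z : Circle) p q, src p = tgt q → mul p (z • q) = z • mul p q
  mul_assoc : ∀ p q r, src p = tgt q → src q = tgt r → mul (mul p q) r = mul p (mul q r)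
  -- the connection: a principal connection compatible with the product
  conn : (p : P) → TangentSpace 𝓘(ℝ, EP) p →L[ℝ] ℝ
  smooth_conn : ContMDiff 𝓘(ℝ, EP) (𝓘(ℝ, EP).prod 𝓘(ℝ, EP →L[ℝ] ℝ)) ∞
    (fun p => Bundle.TotalSpace.mk' (EP →L[ℝ] ℝ) p (conn p))
  conn_smul : ∀ (c : ℝ → P) (φ : ℝ → ℝ) (t : ℝ), ContMDiffAt 𝓘(ℝ, ℝ) 𝓘(ℝ, EP) ∞ c t →
    ContDiffAt ℝ ∞ φ t →
    conn _ (vel (fun s => Circle.exp (φ s) • c s) t) = conn _ (vel c t) + deriv φ t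
  conn_mul : ∀ (c₁ c₂ : ℝ → P) (t : ℝ), ContMDiffAt 𝓘(ℝ, ℝ) 𝓘(ℝ, EP) ∞ c₁ t →
    ContMDiffAt 𝓘(ℝ, ℝ) 𝓘(ℝ, EP) ∞ c₂ t → (∀ᶠ s in 𝓝 t, src (c₁ s) = tgt (c₂ s)) →
    conn _ (vel (fun s => mul (c₁ s) (c₂ s)) t) = conn _ (vel c₁ t) + conn _ (vel c₂ t)
  -- the curving: a two-form `f` on `Y` with `π₂^* f - π₁^* f` the curvature of the connection
  curving : (y : Y) → TangentSpace 𝓘(ℝ, EY) y →L[ℝ] TangentSpace 𝓘(ℝ, EY) y →L[ℝ] ℝ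
  smooth_curving : ContMDiff 𝓘(ℝ, EY) (𝓘(ℝ, EY).prod 𝓘(ℝ, EY →L[ℝ] EY →L[ℝ] ℝ)) ∞
    (fun y => Bundle.TotalSpace.mk' (EY →L[ℝ] EY →L[ℝ] ℝ) y (curving y))
  curving_alt : ∀ y v, curving y v v = 0
  curving_eq : ∀ (u : ℂ → P) (x : ℂ), ContMDiffAt 𝓘(ℝ, ℂ) 𝓘(ℝ, EP) ∞ u x →
    curl univ (pullOne conn univ u) x =
      pullTwo curving univ (tgt ∘ u) x - pullTwo curving univ (src ∘ u) x

/-! ### Bundle gerbe modules -/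

/-- Endomorphisms of `ℂⁿ`. -/
abbrev EndC (n : ℕ) := EuclideanSpace ℂ (Fin n) →L[ℂ] EuclideanSpace ℂ (Fin n)

/-- The scalar matrix `z · 1` for `z ∈ U(1)`. -/
def scalarGL (n : ℕ) (z : Circle) : (EndC n)ˣ :=
  Units.map (algebraMap ℂ (EndC n)).toMonoidHom (Circle.toUnits z)

section Gerbe

universe u

variable {EQ EY EF EP : Type*}
  [NormedAddCommGroup EQ] [NormedSpace ℝ EQ] [NormedAddCommGroup EY] [NormedSpace ℝ EY]
  [NormedAddCommGroup EP] [NormedSpace ℝ EP] [NormedAddCommGroup EF] [NormedSpace ℝ EF]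
  {Q Y : Type*} {P : Type u} [TopologicalSpace Q] [ChartedSpace EQ Q]
  [TopologicalSpace Y] [ChartedSpace EY Y] [IsManifold 𝓘(ℝ, EY) ∞ Y]
  [TopologicalSpace P] [ChartedSpace EP P] [IsManifold 𝓘(ℝ, EP) ∞ P] [MulAction Circle P]

/-- A rank `n` bundle gerbe module `E → Y` with a bundle gerbe module connection.  The vector
bundle `E` is given through its principal bundle `F → Y` of linear frames: `f : F` is a linear
isomorphism `ℂⁿ → E_y`, `y = base f`, and `rmul f g = f ∘ g`.  The hermitian structure is
`metric f = f^* f`. A unit vector `p` of `R_(y₁, y₂)` acts as `E_(y₂) → E_(y₁)`, hence on frames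
as `lmul p`.  The connection is the principal connection one-form `conn` with values in the
`n × n` matrices. -/
structure GerbeModule (G : BundleGerbe (EQ := EQ) (EY := EY) (EP := EP) Q Y P) (n : ℕ)
    (F : Type*) [TopologicalSpace F] [ChartedSpace EF F] [IsManifold 𝓘(ℝ, EF) ∞ F] where
  -- the principal frame bundle
  base : F → Y
  smooth_base : ContMDiff 𝓘(ℝ, EF) 𝓘(ℝ, EY) ∞ base
  rmul : F → (EndC n)ˣ → F
  smooth_rmul : ContMDiff (𝓘(ℝ, EF).prod 𝓘(ℝ, EndC n)) 𝓘(ℝ, EF) ∞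
    (fun x : F × (EndC n)ˣ => rmul x.1 x.2)
  base_rmul : ∀ f g, base (rmul f g) = base f
  rmul_one : ∀ f, rmul f 1 = f
  rmul_rmul : ∀ f g h, rmul (rmul f g) h = rmul f (g * h)
  free : ∀ f g, rmul f g = f → g = 1
  locallyTrivial : ∀ y, ∃ U ∈ 𝓝 y, ∃ (e : Y → F) (c : F → (EndC n)ˣ),
    ContMDiffOn 𝓘(ℝ, EY) 𝓘(ℝ, EF) ∞ e U ∧
    ContMDiffOn 𝓘(ℝ, EF) 𝓘(ℝ, EndC n) ∞ c (base ⁻¹' U) ∧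
    (∀ y' ∈ U, base (e y') = y') ∧
    ∀ f, base f ∈ U → rmul (e (base f)) (c f) = f
  -- the hermitian structure
  metric : F → EndC n
  smooth_metric : ContMDiff 𝓘(ℝ, EF) 𝓘(ℝ, EndC n) ∞ metric
  metric_pos : ∀ f, (metric f).IsPositive ∧ Function.Injective (metric f)
  metric_rmul : ∀ f g, metric (rmul f g) =
    (ContinuousLinearMap.adjoint (g : EndC n)) * metric f * (g : EndC n)
  -- the action of the bundle gerbe
  lmul : P → F → F
  base_lmul : ∀ p f, G.src p = base f → base (lmul p f) = G.tgt p
  smooth_lmul : ContMDiffOn (𝓘(ℝ, EP).prod 𝓘(ℝ, EF)) 𝓘(ℝ, EF) ∞ (fun x : P × F => lmul x.1 x.2)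
    {x | G.src x.1 = base x.2}
  lmul_rmul : ∀ p f g, G.src p = base f → lmul p (rmul f g) = rmul (lmul p f) g
  smul_lmul : ∀ (z : Circle) p f, G.src p = base f →
    lmul (z • p) f = rmul (lmul p f) (scalarGL n z)
  mul_lmul : ∀ p q f, G.src p = G.tgt q → G.src q = base f →
    lmul (G.mul p q) f = lmul p (lmul q f)
  metric_lmul : ∀ p f, G.src p = base f → metric (lmul p f) = metric f
  -- the connection: a principal connection compatible with the action
  conn : (f : F) → TangentSpace 𝓘(ℝ, EF) f →L[ℝ] EndC n
  smooth_conn : ∀ l : EndC n →L[ℝ] ℝ,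
    ContMDiff 𝓘(ℝ, EF) (𝓘(ℝ, EF).prod 𝓘(ℝ, EF →L[ℝ] ℝ)) ∞
      (fun f => Bundle.TotalSpace.mk' (EF →L[ℝ] ℝ) f (l.comp (conn f)))
  conn_rmul : ∀ (c : ℝ → F) (g : ℝ → (EndC n)ˣ) (t : ℝ), ContMDiffAt 𝓘(ℝ, ℝ) 𝓘(ℝ, EF) ∞ c t →
    ContMDiffAt 𝓘(ℝ, ℝ) 𝓘(ℝ, EndC n) ∞ g t →
    conn _ (vel (fun s => rmul (c s) (g s)) t) =
      ((g t)⁻¹ : (EndC n)ˣ) * conn _ (vel c t) * (g t : EndC n) +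
        ((g t)⁻¹ : (EndC n)ˣ) * deriv (fun s => (g s : EndC n)) t
  conn_lmul : ∀ (c : ℝ → P) (b : ℝ → F) (t : ℝ), ContMDiffAt 𝓘(ℝ, ℝ) 𝓘(ℝ, EP) ∞ c t →
    ContMDiffAt 𝓘(ℝ, ℝ) 𝓘(ℝ, EF) ∞ b t → (∀ᶠ s in 𝓝 t, G.src (c s) = base (b s)) →
    conn _ (vel (fun s => lmul (c s) (b s)) t) =
      (Complex.I * (G.conn _ (vel c t) : ℝ)) • (1 : EndC n) + conn _ (vel b t)

/-! ### Trivialisations over a disk -/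

/-- A trivialisation `J`, with compatible connection, of the pull-back of the bundle gerbe by a
disk `σ : D → Q`.  The hermitian line bundle `J` over `σ^* Y = {(x, y) | σ x = proj y}` is given by
its circle bundle `J` of unit vectors, with projections `base` and `pt` to `D` and `Y`; a unit vector
of `R_(y₁, y₂)` acts as `J_(x, y₂) → J_(x, y₁)`, i.e. `R_(y₁, y₂) = J_(x, y₁) ⊗ J_(x, y₂)^*`.
The smooth structure of `J` (which the action of `R` determines from its restrictions along local
lifts of `σ` to `Y`) and its connection are given by local smooth unit sections `sec k` of `J` over
smooth lifts `pt ∘ sec k` of `σ`, with connection forms `i · form k`. -/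
structure Trivialisation (G : BundleGerbe (EQ := EQ) (EY := EY) (EP := EP) Q Y P)
    (σ : Disk (E := EQ) Q) where
  J : Type u
  rot : Circle → J → J
  rot_one : ∀ j, rot 1 j = j
  rot_rot : ∀ z w j, rot z (rot w j) = rot (z * w) j
  base : J → ℂ
  pt : J → Y
  base_mem : ∀ j, base j ∈ unitDisk
  proj_pt : ∀ j, G.proj (pt j) = σ.ext (base j)
  nonempty_fibre : ∀ x ∈ unitDisk, ∀ y, G.proj y = σ.ext x → ∃ j, base j = x ∧ pt j = y
  base_rot : ∀ z j, base (rot z j) = base j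
  pt_rot : ∀ z j, pt (rot z j) = pt j
  free : ∀ z j, rot z j = j → z = 1
  transitive : ∀ j j', base j = base j' → pt j = pt j' → ∃ z, rot z j = j'
  -- the action of the bundle gerbe
  lmul : P → J → J
  base_lmul : ∀ p j, G.src p = pt j → base (lmul p j) = base j
  pt_lmul : ∀ p j, G.src p = pt j → pt (lmul p j) = G.tgt p
  lmul_rot : ∀ p z j, G.src p = pt j → lmul p (rot z j) = rot z (lmul p j)
  smul_lmul : ∀ (z : Circle) p j, G.src p = pt j → lmul (z • p) j = rot z (lmul p j)
  mul_lmul : ∀ p q j, G.src p = G.tgt q → G.src q = pt j → lmul (G.mul p q) j = lmul p (lmul q j)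
  -- local sections of `J` along local lifts of `σ`
  ι : Type
  U : ι → Set ℂ
  isOpen_U : ∀ k, IsOpen (U k)
  cover : ∀ x ∈ unitDisk, ∃ k, x ∈ U k
  sec : ι → ℂ → J
  base_sec : ∀ k, ∀ x ∈ unitDisk ∩ U k, base (sec k x) = x
  smooth_sec : ∀ k, ContMDiffOn 𝓘(ℝ, ℂ) 𝓘(ℝ, EY) ∞ (fun x => pt (sec k x)) (unitDisk ∩ U k)
  trans : ι → ι → ℂ → P
  smooth_trans : ∀ k l, ContMDiffOn 𝓘(ℝ, ℂ) 𝓘(ℝ, EP) ∞ (trans k l) (unitDisk ∩ (U k ∩ U l))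
  src_trans : ∀ k l, ∀ x ∈ unitDisk ∩ (U k ∩ U l), G.src (trans k l x) = pt (sec l x)
  lmul_trans : ∀ k l, ∀ x ∈ unitDisk ∩ (U k ∩ U l), lmul (trans k l x) (sec l x) = sec k x
  -- the connection of `J`, compatible with the connection of `R`
  form : ι → ℂ → ℂ →L[ℝ] ℝ
  smooth_form : ∀ k, ContDiffOn ℝ ∞ (form k) (unitDisk ∩ U k)
  form_eq : ∀ k l, ∀ x ∈ unitDisk ∩ (U k ∩ U l),
    pullOne G.conn (unitDisk ∩ (U k ∩ U l)) (trans k l) x = form k x - form l x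

variable {G : BundleGerbe (EQ := EQ) (EY := EY) (EP := EP) Q Y P}

/-- The two-form `μ_J` on the disk, i.e. the coefficient of `dx ∧ dy`: the descent of
`f - F_J` divided by `i`. -/
def Trivialisation.mu {σ : Disk (E := EQ) Q} (T : Trivialisation G σ) (x : ℂ) : ℝ :=
  open Classical in
  if h : x ∈ unitDisk then
    let k := (T.cover x h).choose
    pullTwo G.curving (unitDisk ∩ T.U k) (fun y => T.pt (T.sec k y)) x
      - curl (unitDisk ∩ T.U k) (T.form k) x
  else 0

/-- `∫_D μ_J`, divided by `i`. -/
def Trivialisation.integral {σ : Disk (E := EQ) Q} (T : Trivialisation G σ) : ℝ :=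
  ∫ x in unitDisk, T.mu x

section Holonomy

variable {n : ℕ} {F : Type*} [TopologicalSpace F] [ChartedSpace EF F] [IsManifold 𝓘(ℝ, EF) ∞ F]
  {σ : Disk (E := EQ) Q}

/-- The frames at `x ∈ D` of the bundle `E_J` on `D` to which `E ⊗ J^*` descends: maps from the unit
vectors of `J` over `x` to the frames of `E`, over the identity of `Y` and equivariant
for the actions of `U(1)` and of `R`. -/
def IsDescendedFrame (T : Trivialisation G σ) (A : GerbeModule (EF := EF) G n F) (x : ℂ)
    (φ : T.J → F) : Prop :=
  ∀ j, T.base j = x → A.base (φ j) = T.pt j ∧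
    (∀ z, φ (T.rot z j) = A.rmul (φ j) (scalarGL n z)) ∧
    ∀ p, G.src p = T.pt j → φ (T.lmul p j) = A.lmul p (φ j)

/-- A family of frames of `E_J` along the boundary circle, parametrised by `[0, 1]`,
that is parallel for the connection `D_J` to which `A - ∇_J` descends. -/
def IsParallelFrame (T : Trivialisation G σ) (A : GerbeModule (EF := EF) G n F)
    (φ : ℝ → T.J → F) : Prop :=
  (∀ t ∈ Icc (0 : ℝ) 1, IsDescendedFrame T A (circ t) (φ t)) ∧
  ∀ k, ContMDiffOn 𝓘(ℝ, ℝ) 𝓘(ℝ, EF) ∞ (fun t => φ t (T.sec k (circ t)))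
      (Icc 0 1 ∩ circ ⁻¹' T.U k) ∧
    ∀ t ∈ Icc (0 : ℝ) 1 ∩ circ ⁻¹' T.U k,
      A.conn _ (mfderivWithin 𝓘(ℝ, ℝ) 𝓘(ℝ, EF) (fun t => φ t (T.sec k (circ t)))
        (Icc 0 1 ∩ circ ⁻¹' T.U k) t (1 : ℝ)) =
      (Complex.I * (T.form k (circ t) (circVel t) : ℝ)) • (1 : EndC n)

/-- `τ` is the trace of the holonomy of `D_J` around the boundary circle: parallel transport
takes a frame `φ 0` to `φ 1 = φ 0 ∘ g`, and `τ = tr g`. -/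
def IsTrHol (T : Trivialisation G σ) (A : GerbeModule (EF := EF) G n F) (τ : ℂ) : Prop :=
  ∃ (φ : ℝ → T.J → F) (g : (EndC n)ˣ), IsParallelFrame T A φ ∧
    (∀ j, T.base j = 1 → φ 1 j = A.rmul (φ 0 j) g) ∧
    τ = LinearMap.trace ℂ (EuclideanSpace ℂ (Fin n)) ((g : EndC n) : _ →ₗ[ℂ] _)

/-- The function `s_A : D(Q) → ℂ`, `s_A(σ) = tr hol(D_J) exp(∫_D μ_J)` for a choice of `J`. -/
def sA (A : GerbeModule (EF := EF) G n F) (σ : Disk (E := EQ) Q) : ℂ :=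
  Classical.epsilon fun v => ∃ (T : Trivialisation G σ) (τ : ℂ), IsTrHol T A τ ∧
    v = τ * Complex.exp (Complex.I * T.integral)

end Holonomy

/-! ### Holonomy over the two-sphere `σ₁ # σ₂` -/

/-- An isomorphism, preserving connections, over the boundary circle between trivialisations over
two disks with the same boundary.  Together they form a trivialisation with compatible connection
over the two-sphere `σ₁ # σ₂`. -/
structure BoundaryIso {σ₁ σ₂ : Disk (E := EQ) Q} (T₁ : Trivialisation G σ₁)
    (T₂ : Trivialisation G σ₂) where
  toFun : T₁.J → T₂.J
  base_eq : ∀ j, ‖T₁.base j‖ = 1 → T₂.base (toFun j) = T₁.base j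
  pt_eq : ∀ j, ‖T₁.base j‖ = 1 → T₂.pt (toFun j) = T₁.pt j
  rot_eq : ∀ z j, ‖T₁.base j‖ = 1 → toFun (T₁.rot z j) = T₂.rot z (toFun j)
  lmul_eq : ∀ p j, ‖T₁.base j‖ = 1 → G.src p = T₁.pt j →
    toFun (T₁.lmul p j) = T₂.lmul p (toFun j)
  -- in terms of the local sections of `J₁` and `J₂`
  trans : T₁.ι → T₂.ι → ℝ → P
  smooth_trans : ∀ k l, ContMDiffOn 𝓘(ℝ, ℝ) 𝓘(ℝ, EP) ∞ (trans k l) (circ ⁻¹' (T₁.U k ∩ T₂.U l))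
  src_trans : ∀ k l, ∀ t ∈ circ ⁻¹' (T₁.U k ∩ T₂.U l), G.src (trans k l t) = T₂.pt (T₂.sec l (circ t))
  lmul_trans : ∀ k l, ∀ t ∈ circ ⁻¹' (T₁.U k ∩ T₂.U l),
    T₂.lmul (trans k l t) (T₂.sec l (circ t)) = toFun (T₁.sec k (circ t))
  form_eq : ∀ k l, ∀ t ∈ circ ⁻¹' (T₁.U k ∩ T₂.U l),
    G.conn _ (vel (trans k l) t) =
      T₁.form k (circ t) (circVel t) - T₂.form l (circ t) (circVel t)

/-- The holonomy `h(σ₁ # σ₂) = exp(∫_{S²} μ_J)` of the bundle gerbe over the two-sphere formed by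
two disks with the same boundary, oriented by the first, for a choice of a trivialisation `J`
over the sphere. -/
def BundleGerbe.sphereHol (G : BundleGerbe (EQ := EQ) (EY := EY) (EP := EP) Q Y P)
    (σ₁ σ₂ : Disk (E := EQ) Q) : ℂ :=
  Classical.epsilon fun v => ∃ (T₁ : Trivialisation G σ₁) (T₂ : Trivialisation G σ₂),
    Nonempty (BoundaryIso T₁ T₂) ∧ v = Complex.exp (Complex.I * (T₁.integral - T₂.integral))

end Gerbe

/-! ### The line bundle on loop space -/

section LineBundle

variable {E : Type*} [NormedAddCommGroup E] [NormedSpace ℝ E]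
  {X : Type*} [TopologicalSpace X] [ChartedSpace E X]

/-- The relation `(σ, z) ∼ (σ', z')` if `∂σ = ∂σ'` and `z = h(σ # σ') z'`. -/
def TransgressionRel (h : Disk (E := E) X → Disk (E := E) X → ℂ)
    (a b : Disk (E := E) X × ℂ) : Prop :=
  a.1.boundary = b.1.boundary ∧ a.2 = h a.1 b.1 * b.2

/-- The total space of the line bundle over loop space defined by `h`. -/
def TransgressionBundle (h : Disk (E := E) X → Disk (E := E) X → ℂ) :=
  Quot (TransgressionRel h)

/-- The projection of the line bundle to the loop space. -/
def TransgressionBundle.proj {h : Disk (E := E) X → Disk (E := E) X → ℂ} :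
    TransgressionBundle h → Loop (E := E) X :=
  Quot.lift (fun a => a.1.boundary) fun _ _ hab => hab.1

/-- The class of `(σ, z)`. -/
def TransgressionBundle.mk (h : Disk (E := E) X → Disk (E := E) X → ℂ) (σ : Disk (E := E) X)
    (z : ℂ) : TransgressionBundle h :=
  Quot.mk _ (σ, z)

/-- The loops that bound a disk (all loops if `X` is simply connected). -/
abbrev BoundingLoop {E : Type*} [NormedAddCommGroup E] [NormedSpace ℝ E]
    (X : Type*) [TopologicalSpace X] [ChartedSpace E X] :=
  {γ : Loop (E := E) X // ∃ σ : Disk (E := E) X, σ.boundary = γ}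

/-- `s : D(X) → ℂ` transforms as a section of the line bundle defined by `h`. -/
def TransformsAsSection (h : Disk (E := E) X → Disk (E := E) X → ℂ)
    (s : Disk (E := E) X → ℂ) : Prop :=
  ∀ σ₁ σ₂ : Disk (E := E) X, σ₁.boundary = σ₂.boundary → s σ₁ = h σ₁ σ₂ * s σ₂

end LineBundle

/-! ### Smooth singular chains and differential characters -/

/-- The standard `k`-simplex, with vertices `0, e₁, …, e_k`. -/
def stdSimp (k : ℕ) : Set (Fin k → ℝ) := {t | (∀ i, 0 ≤ t i) ∧ ∑ i, t i ≤ 1}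

/-- The vertex `0`. -/
def simpOrigin (k : ℕ) : stdSimp k := ⟨0, by simp [stdSimp]⟩

/-- The barycentric coordinates `(1 - ∑ tᵢ, t₁, …, t_k)`. -/
def bary {k : ℕ} (t : Fin k → ℝ) : Fin (k + 1) → ℝ := Fin.cons (1 - ∑ i, t i) t

/-- The `i`-th face map of the standard simplices, inserting `0` as `i`-th barycentric
coordinate. -/
def faceMap {k : ℕ} (i : Fin (k + 2)) (t : Fin k → ℝ) : Fin (k + 1) → ℝ :=
  fun j => (Fin.insertNth i (0 : ℝ) (bary t) : Fin (k + 2) → ℝ) j.succ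

theorem sum_bary {k : ℕ} (t : Fin k → ℝ) : ∑ i, bary t i = 1 := by
  simp [bary, Fin.sum_univ_succ]

theorem bary_nonneg {k : ℕ} {t : Fin k → ℝ} (ht : t ∈ stdSimp k) (i : Fin (k + 1)) :
    0 ≤ bary t i := by
  refine Fin.cases ?_ (fun j => ?_) i
  · simpa [bary] using ht.2
  · simpa [bary] using ht.1 j

theorem faceMap_mem {k : ℕ} (i : Fin (k + 2)) {t : Fin k → ℝ} (ht : t ∈ stdSimp k) :
    faceMap i t ∈ stdSimp (k + 1) := by
  have hnn : ∀ j, 0 ≤ (Fin.insertNth i (0 : ℝ) (bary t) : Fin (k + 2) → ℝ) j := by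
    intro j
    refine Fin.succAboveCases i ?_ (fun l => ?_) j
    · simp
    · simpa using bary_nonneg ht l
  have hs : ∑ j, (Fin.insertNth i (0 : ℝ) (bary t) : Fin (k + 2) → ℝ) j = 1 := by
    rw [Fin.sum_univ_succAbove _ i]
    simp [sum_bary]
  refine ⟨fun j => hnn _, ?_⟩
  rw [Fin.sum_univ_succ] at hs
  have := hnn 0
  simp only [faceMap]
  linarith

theorem contDiff_faceMap {k : ℕ} (i : Fin (k + 2)) :
    ContDiff ℝ ∞ (faceMap i : (Fin k → ℝ) → _) := by
  have hb : ∀ l : Fin (k + 1), ContDiff ℝ ∞ (fun t : Fin k → ℝ => bary t l) := by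
    intro l
    refine Fin.cases ?_ (fun j => ?_) l
    · simp only [bary, Fin.cons_zero]; fun_prop
    · simp only [bary, Fin.cons_succ]; fun_prop
  have hi : ∀ l : Fin (k + 2), ContDiff ℝ ∞
      (fun t : Fin k → ℝ => (Fin.insertNth i (0 : ℝ) (bary t) : Fin (k + 2) → ℝ) l) := by
    intro l
    refine Fin.succAboveCases i ?_ (fun m => ?_) l
    · simp only [Fin.insertNth_apply_same]; fun_prop
    · simpa only [Fin.insertNth_apply_succAbove] using hb m
  rw [contDiff_pi]
  exact fun j => hi j.succ

/-- A smooth singular `k`-simplex in a manifold `X` (possibly with boundary). -/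
structure SmoothSimplex {E H : Type*} [NormedAddCommGroup E] [NormedSpace ℝ E]
    [TopologicalSpace H] (I : ModelWithCorners ℝ E H) (X : Type*) [TopologicalSpace X]
    [ChartedSpace H X] (k : ℕ) where
  toFun : stdSimp k → X
  smooth : ContMDiffOn 𝓘(ℝ, Fin k → ℝ) I ∞ (extendConst (stdSimp k) (simpOrigin k) toFun) (stdSimp k)

section Chains

variable {E H : Type*} [NormedAddCommGroup E] [NormedSpace ℝ E]
  [TopologicalSpace H] {I : ModelWithCorners ℝ E H} {X : Type*} [TopologicalSpace X]
  [ChartedSpace H X]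
  {E' H' : Type*} [NormedAddCommGroup E'] [NormedSpace ℝ E']
  [TopologicalSpace H'] {I' : ModelWithCorners ℝ E' H'} {X' : Type*} [TopologicalSpace X']
  [ChartedSpace H' X']

/-- The `i`-th face of a simplex. -/
def SmoothSimplex.face {k : ℕ} (s : SmoothSimplex I X (k + 1)) (i : Fin (k + 2)) :
    SmoothSimplex I X k where
  toFun t := s.toFun ⟨faceMap i t, faceMap_mem i t.2⟩
  smooth := (s.smooth.comp (contDiff_faceMap i).contMDiff.contMDiffOn
    fun _ ht => faceMap_mem i ht).congr fun t ht => by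
      simp [extendConst_of_mem ht, extendConst_of_mem (faceMap_mem i ht)]

/-- The composition of a simplex with a smooth map. -/
def SmoothSimplex.map (f : X → X') (hf : ContMDiff I I' ∞ f) {k : ℕ} (s : SmoothSimplex I X k) :
    SmoothSimplex I' X' k where
  toFun t := f (s.toFun t)
  smooth := (hf.comp_contMDiffOn s.smooth).congr fun x hx => by
    simp [extendConst_of_mem hx]

variable (I X) in
/-- Smooth singular `k`-chains with integer coefficients. -/
abbrev SmoothChain (k : ℕ) := SmoothSimplex I X k →₀ ℤ

/-- The boundary of a chain. -/
def chainBoundary {k : ℕ} : SmoothChain I X (k + 1) →ₗ[ℤ] SmoothChain I X k :=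
  Finsupp.linearCombination ℤ fun s => ∑ i : Fin (k + 2), (-1 : ℤ) ^ (i : ℕ) •
    Finsupp.single (s.face i) 1

/-- The push-forward of chains. -/
def chainMap (f : X → X') (hf : ContMDiff I I' ∞ f) {k : ℕ} (c : SmoothChain I X k) :
    SmoothChain I' X' k :=
  c.mapDomain (SmoothSimplex.map f hf)

end Chains

section Characters

variable {E : Type*} [NormedAddCommGroup E] [NormedSpace ℝ E]
  {X : Type*} [TopologicalSpace X] [ChartedSpace E X]

/-- The integral of a three-form over a smooth singular three-chain. -/
def chainIntegral (w : (x : X) → TangentSpace 𝓘(ℝ, E) x →L[ℝ] TangentSpace 𝓘(ℝ, E) x →L[ℝ]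
    TangentSpace 𝓘(ℝ, E) x →L[ℝ] ℝ) : SmoothChain 𝓘(ℝ, E) X 3 →ₗ[ℤ] ℝ :=
  Finsupp.linearCombination ℤ fun s =>
    let s' := extendConst (stdSimp 3) (simpOrigin 3) s.toFun
    ∫ t in stdSimp 3,
      let d : (Fin 3 → ℝ) → TangentSpace 𝓘(ℝ, E) (s' t) :=
        fun v => mfderivWithin 𝓘(ℝ, Fin 3 → ℝ) 𝓘(ℝ, E) s' (stdSimp 3) t v
      w (s' t) (d (Pi.single 0 1)) (d (Pi.single 1 1)) (d (Pi.single 2 1))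

end Characters

set_option synthInstance.maxHeartbeats 400000 in
set_option maxSynthPendingDepth 6 in
/-- A (Cheeger–Simons) differential character of degree two on `X`, i.e. a Deligne two-class: a
homomorphism `hol` from smooth singular two-cycles to `U(1)` and a three-form `curv`, such that
`hol (∂c) = exp (i ∫_c curv)`. -/
structure DiffCharacter {E : Type*} [NormedAddCommGroup E] [NormedSpace ℝ E]
    (X : Type*) [TopologicalSpace X] [ChartedSpace E X] [IsManifold 𝓘(ℝ, E) ∞ X] where
  hol : LinearMap.ker (chainBoundary (I := 𝓘(ℝ, E)) (X := X) (k := 1)) →+ Additive Circle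
  curv : (x : X) → TangentSpace 𝓘(ℝ, E) x →L[ℝ] TangentSpace 𝓘(ℝ, E) x →L[ℝ]
    TangentSpace 𝓘(ℝ, E) x →L[ℝ] ℝ
  smooth_curv : ContMDiff 𝓘(ℝ, E) (𝓘(ℝ, E).prod 𝓘(ℝ, E →L[ℝ] E →L[ℝ] E →L[ℝ] ℝ)) ∞
    (fun x => Bundle.TotalSpace.mk' (E →L[ℝ] E →L[ℝ] E →L[ℝ] ℝ) x (curv x))
  curv_alt_left : ∀ x v w, curv x v v w = 0
  curv_alt_right : ∀ x v w, curv x v w w = 0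
  hol_boundary : ∀ (c : SmoothChain 𝓘(ℝ, E) X 3)
    (z : LinearMap.ker (chainBoundary (I := 𝓘(ℝ, E)) (X := X) (k := 1))),
    (z : SmoothChain 𝓘(ℝ, E) X 2) = chainBoundary c →
      (hol z).toMul = Circle.exp (chainIntegral curv c)

/-- The value `h(z)` of a differential character on a cycle (and `1` if `z` is not a cycle). -/
def DiffCharacter.eval {E : Type*} [NormedAddCommGroup E] [NormedSpace ℝ E]
    {X : Type*} [TopologicalSpace X] [ChartedSpace E X] [IsManifold 𝓘(ℝ, E) ∞ X]
    (ξ : DiffCharacter (E := E) X) (z : SmoothChain 𝓘(ℝ, E) X 2) : ℂ :=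
  open Classical in
  if hz : chainBoundary z = 0 then ((ξ.hol ⟨z, hz⟩).toMul : ℂ) else 1

/-! ### Fundamental chains -/

/-- The fundamental cycle of the circle: the one-simplex `t ↦ exp(2π i t)`. -/
def circleSimplex : SmoothSimplex (𝓡 1) Circle 1 where
  toFun t := Circle.exp (2 * Real.pi * (t : Fin 1 → ℝ) 0)
  smooth := by
    have h : ContMDiff 𝓘(ℝ, Fin 1 → ℝ) 𝓘(ℝ, ℝ) ∞ (fun t : Fin 1 → ℝ => 2 * Real.pi * t 0) :=
      ContDiff.contMDiff (by fun_prop)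
    exact (contMDiff_circleExp.comp h).contMDiffOn.congr fun t ht => by
      simp [extendConst_of_mem ht]

/-- A smooth map `Δ² → D` that is `1` on the edges from the vertex `0` and is
`exp(2π i t₂)` on the opposite edge `t₁ + t₂ = 1`; it is
`(1 - t₁/(1 - t₂)) + t₁/(1 - t₂) · exp(2π i t₂)`. -/
def diskChart (t : Fin 2 → ℝ) : ℂ :=
  1 - (t 0 : ℂ) * dslope (fun z => Complex.exp (2 * Real.pi * Complex.I * z)) 1 (t 1 : ℂ)

theorem contDiff_diskChart : ContDiff ℝ ∞ diskChart := by
  have h1 : Differentiable ℂ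
      (dslope (fun z : ℂ => Complex.exp (2 * Real.pi * Complex.I * z)) 1) := by
    rw [← differentiableOn_univ, Complex.differentiableOn_dslope Filter.univ_mem]
    fun_prop
  have h2 : ContDiff ℝ ∞ (dslope (fun z : ℂ => Complex.exp (2 * Real.pi * Complex.I * z)) 1) :=
    (h1.contDiff (n := ∞)).restrict_scalars ℝ
  have h3 : ∀ i : Fin 2, ContDiff ℝ ∞ (fun t : Fin 2 → ℝ => ((t i : ℝ) : ℂ)) := fun i =>
    Complex.ofRealCLM.contDiff.comp (contDiff_apply ℝ ℝ i)
  unfold diskChart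
  exact contDiff_const.sub ((h3 0).mul (h2.comp (h3 1)))

theorem diskChart_mem {t : Fin 2 → ℝ} (ht : t ∈ stdSimp 2) : diskChart t ∈ unitDisk := by
  obtain ⟨h0, h1⟩ := ht
  rw [Fin.sum_univ_two] at h1
  have hx := h0 0
  have hy := h0 1
  by_cases h : t 1 = 1
  · have : t 0 = 0 := by linarith
    simp [diskChart, this]
  · have hlt : 0 < 1 - t 1 := by
      have : t 1 ≤ 1 := by linarith
      rcases this.lt_or_eq with h' | h'
      · linarith
      · exact absurd h' h
    have hne : ((t 1 : ℝ) : ℂ) ≠ 1 := by exact_mod_cast h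
    set l : ℝ := t 0 / (1 - t 1) with hl
    have hl0 : 0 ≤ l := div_nonneg hx hlt.le
    have hl1 : l ≤ 1 := by rw [hl, div_le_one hlt]; linarith
    have he : diskChart t =
        (1 - l) • (1 : ℂ) + l • Complex.exp (2 * Real.pi * Complex.I * (t 1 : ℂ)) := by
      have hc : (1 - (t 1 : ℂ)) ≠ 0 := sub_ne_zero.mpr hne.symm
      have hc' : ((t 1 : ℂ) - 1) ≠ 0 := sub_ne_zero.mpr hne
      rw [diskChart, dslope_of_ne _ hne, slope_def_field, hl]
      have h2 : Complex.exp (2 * Real.pi * Complex.I * 1) = 1 := by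
        rw [mul_one]; exact Complex.exp_two_pi_mul_I
      rw [h2]
      simp only [Complex.real_smul]
      push_cast
      have : (t 1 : ℂ) - 1 = -(1 - (t 1 : ℂ)) := by ring
      rw [this]
      field_simp
      ring
    rw [he]
    refine (convex_closedBall (0 : ℂ) 1) ?_ ?_ (by linarith) hl0 (by ring)
    · simp
    · have : (2 * Real.pi * Complex.I * (t 1 : ℂ)) = ((2 * Real.pi * t 1 : ℝ) : ℂ) * Complex.I := by
        push_cast; ring
      rw [mem_closedBall_zero_iff, this, Complex.norm_exp_ofReal_mul_I]

section Fundamental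

variable {E : Type*} [NormedAddCommGroup E] [NormedSpace ℝ E]
  {X : Type*} [TopologicalSpace X] [ChartedSpace E X]

/-- The push-forward `σ_* [D]` of the fundamental chain of the disk, given by `diskChart`; its
boundary is the loop `t ↦ σ (exp(2π i t))`. -/
def Disk.simplex (σ : Disk (E := E) X) : SmoothSimplex 𝓘(ℝ, E) X 2 where
  toFun t := σ.toFun ⟨diskChart t, diskChart_mem t.2⟩
  smooth := (σ.smooth.comp contDiff_diskChart.contMDiff.contMDiffOn
    fun _ ht => diskChart_mem ht).congr fun t ht => by
      simp [extendConst_of_mem ht, extendConst_of_mem (diskChart_mem ht)]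

/-- The chain `σ_* [D]`. -/
def Disk.chain (σ : Disk (E := E) X) : SmoothChain 𝓘(ℝ, E) X 2 := Finsupp.single σ.simplex 1

end Fundamental

/-- A compact connected oriented surface `S` with one boundary component, identified with the circle
by `bdry`.  The orientation is given by a fundamental chain: a smooth two-chain whose boundary is
the fundamental cycle of the boundary circle. -/
structure WorldSheet (S : Type*) [TopologicalSpace S] [ChartedSpace (EuclideanHalfSpace 2) S] where
  bdry : Circle → S
  embedding : Manifold.IsSmoothEmbedding (𝓡 1) (𝓡∂ 2) ∞ bdry
  smooth_bdry : ContMDiff (𝓡 1) (𝓡∂ 2) ∞ bdry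
  range_bdry : range bdry = (𝓡∂ 2).boundary S
  fund : SmoothChain (𝓡∂ 2) S 2
  boundary_fund : chainBoundary fund = Finsupp.single (circleSimplex.map bdry smooth_bdry) 1

section Action

variable {E : Type*} [NormedAddCommGroup E] [NormedSpace ℝ E]
  {X : Type*} [TopologicalSpace X] [ChartedSpace E X] [IsManifold 𝓘(ℝ, E) ∞ X]
  {S : Type*} [TopologicalSpace S] [ChartedSpace (EuclideanHalfSpace 2) S]

/-- `h(σ₁ # σ₂)` for disks with the same boundary. -/
def DiffCharacter.sphereHol (ξ : DiffCharacter (E := E) X) (σ₁ σ₂ : Disk (E := E) X) : ℂ :=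
  ξ.eval (σ₁.chain - σ₂.chain)

/-- `h(σ # ν)` for a disk `σ` and a map `ν` of the world-sheet with the same boundary. -/
def DiffCharacter.gluedHol (ξ : DiffCharacter (E := E) X) (Λ : WorldSheet S)
    (σ : Disk (E := E) X) (ν : ContMDiffMap (𝓡∂ 2) 𝓘(ℝ, E) S X ∞) : ℂ :=
  ξ.eval (σ.chain - chainMap ν ν.contMDiff Λ.fund)

end Action

/-- `Σ_Q(M)`: the smooth maps of the world-sheet to `M` whose boundary lies in `Q ⊆ M`, where the
inclusion of the submanifold is `incl`. -/
def BoundaryIn {EM : Type*} [NormedAddCommGroup EM] [NormedSpace ℝ EM]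
    {Q M S : Type*} [TopologicalSpace M] [ChartedSpace EM M]
    [TopologicalSpace S] [ChartedSpace (EuclideanHalfSpace 2) S] (Λ : WorldSheet S)
    (incl : Q → M) :=
  {ν : ContMDiffMap (𝓡∂ 2) 𝓘(ℝ, EM) S M ∞ // ∀ z, ν (Λ.bdry z) ∈ range incl}

/-- `∂σ = ∂ν` for a disk `σ` in `Q` and `ν ∈ Σ_Q(M)`. -/
def SameBoundary {EQ EM : Type*} [NormedAddCommGroup EQ] [NormedSpace ℝ EQ]
    [NormedAddCommGroup EM] [NormedSpace ℝ EM]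
    {Q M S : Type*} [TopologicalSpace Q] [ChartedSpace EQ Q] [TopologicalSpace M]
    [ChartedSpace EM M] [TopologicalSpace S] [ChartedSpace (EuclideanHalfSpace 2) S]
    {Λ : WorldSheet S} {incl : Q → M} (σ : Disk (E := EQ) Q)
    (ν : BoundaryIn (EM := EM) Λ incl) : Prop :=
  ∀ z, incl (σ.boundary z) = ν.1 (Λ.bdry z)

end

/-! The unit vectors of `R` form a groupoid over `Y` in which the arrows between two points of one
fibre are a torsor under the circle. In these terms a trivialisation over a disk consists of local
lifts of the disk to `Y`, a cocycle of unit vectors between the lifts (`LiftCocycle`), and one-forms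
on the charts whose differences are the pulled-back connection (`LiftCocycle.IsForm`). A
circle-valued function on a convex set has a smooth logarithm (`exists_log`), and a real function on
a slab is a difference of functions on the two half-spaces (`exists_sub_eq_of_slab`). Hence
isomorphisms of cocycles glue across a slab, and then cocycles glue too. Induction over rectangles
(`rect_induction`) shows that any two cocycles on the disk are isomorphic
(`LiftCocycle.exists_isIso_of_isCompact`) and that one exists (`LiftCocycle.exists_unitDisk`).
Connection forms exist because they form an affine space (`LiftCocycle.exists_isForm`).

Two trivialisations `T`, `T'` over the same disk are therefore isomorphic, and the isomorphism
preserves the connections up to a global one-form `η`. Its exterior derivative is the difference of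
the two-forms `μ` of `T'` and `T`, so Stokes' theorem identifies the integral of `η` over the
boundary circle with the difference of the integrals of `μ` (`Comparison.integral_eq`). After this
only the boundary circle matters. There, isomorphisms that preserve the connections up to a function
`d` (`LoopIso`) compose, their defects add, and two facts hold. The integrals of the defects of two
isomorphisms between the same objects differ by a multiple of `2π` (`LoopIso.exp_integral_eq`). The
traces of the holonomies differ by the factor `exp (i ∫ d)` (`LoopIso.trHol_eq`).

The first fact, applied to the two ways around a square of trivialisations, shows that `h` does not
depend on choices. The second fact with Stokes' theorem shows that the change of the holonomy is
compensated by the change of `exp (i ∫ μ)`, so `sA` does not depend on choices. The second fact with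
`d = 0` is the transformation rule: the holonomies agree and the remaining exponentials have
quotient `h`.

A trivialisation over a sphere exists because a parallel isomorphism can be found on the line
covering the circle. Its monodromy is a constant phase, which is spread evenly along the circle and
then absorbed into the connection of one of the two trivialisations (`exists_loopIso_const`,
`Trivialisation.exists_boundaryIso`). Composing such isomorphisms gives the cocycle identity for
`h`, so the relation defining the line bundle is already an equivalence relation and its fibres are
lines. For the world-sheet action, the chains of two disks and of a world-sheet with a common
boundary differ by cycles, on which differential characters are additive
(`DiffCharacter.gluedHol_eq`). All transition factors then cancel. -/

noncomputable section

/-! ### Pull-backs of forms, and their identities up to the boundary of the disk -/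

section PullBack

variable {V : Type*} [NormedAddCommGroup V] [NormedSpace ℝ V]
  {E : Type*} [NormedAddCommGroup E] [NormedSpace ℝ E]
  {X : Type*} [TopologicalSpace X] [ChartedSpace E X] [IsManifold 𝓘(ℝ, E) ∞ X]

/-- A tangent vector of a vector space, pushed forward by a smooth map, varies smoothly. -/
theorem contMDiffOn_mfderivWithin_apply {S : Set V} (hS : UniqueDiffOn ℝ S) {u : V → X}
    (hu : ContMDiffOn 𝓘(ℝ, V) 𝓘(ℝ, E) ∞ u S) (w : V) :
    ContMDiffOn 𝓘(ℝ, V) (𝓘(ℝ, E).prod 𝓘(ℝ, E)) ∞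
      (fun x => Bundle.TotalSpace.mk' E (E := TangentSpace 𝓘(ℝ, E)) (u x)
        (mfderivWithin 𝓘(ℝ, V) 𝓘(ℝ, E) u S x w)) S := by
  have : IsManifold 𝓘(ℝ, E) 1 X := IsManifold.of_le (n := ∞) (by simp)
  have h1 := hu.contMDiffOn_tangentMapWithin (m := ∞) (by simp) hS.uniqueMDiffOn
  have h2 : ContMDiff 𝓘(ℝ, V) (𝓘(ℝ, V).prod 𝓘(ℝ, V)) ∞
      (fun x : V => (⟨x, w⟩ : TangentBundle 𝓘(ℝ, V) V)) := by
    intro x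
    rw [Bundle.contMDiffAt_totalSpace]
    refine ⟨contMDiffAt_id, ?_⟩
    simpa using contMDiffAt_const
  exact h1.comp h2.contMDiffOn fun x hx => hx

/-- The form along `u` and the pushed-forward vector are smooth sections over `u`, and their pairing
is a section of a trivial bundle, hence an ordinary smooth function. The source is a general `V` so
that surfaces and curves are covered together. -/
theorem contDiffOn_oneForm_comp {θ : (x : X) → TangentSpace 𝓘(ℝ, E) x →L[ℝ] ℝ}
    (hθ : ContMDiff 𝓘(ℝ, E) (𝓘(ℝ, E).prod 𝓘(ℝ, E →L[ℝ] ℝ)) ∞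
      (fun p => Bundle.TotalSpace.mk' (E →L[ℝ] ℝ) p (θ p)))
    {S : Set V} (hS : UniqueDiffOn ℝ S) {u : V → X}
    (hu : ContMDiffOn 𝓘(ℝ, V) 𝓘(ℝ, E) ∞ u S) (w : V) :
    ContDiffOn ℝ ∞ (fun x => θ (u x) (mfderivWithin 𝓘(ℝ, V) 𝓘(ℝ, E) u S x w)) S := by
  have h1 : ContMDiffOn 𝓘(ℝ, V) (𝓘(ℝ, E).prod 𝓘(ℝ, E →L[ℝ] ℝ)) ∞
    (fun x => Bundle.TotalSpace.mk' (E →L[ℝ] ℝ)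
      (E := fun x : X => TangentSpace 𝓘(ℝ, E) x →L[ℝ] Bundle.Trivial X ℝ x) (u x) (θ (u x))) S :=
    hθ.comp_contMDiffOn hu
  have h2 := ContMDiffOn.clm_bundle_apply (E₂ := Bundle.Trivial X ℝ) (F₂ := ℝ) h1
    (contMDiffOn_mfderivWithin_apply hS hu w)
  rw [← contMDiffOn_iff_contDiffOn]
  intro x hx
  have := h2 x hx
  rw [Bundle.contMDiffWithinAt_totalSpace] at this
  simpa using this.2

theorem contDiffOn_pullOne {θ : (x : X) → TangentSpace 𝓘(ℝ, E) x →L[ℝ] ℝ}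
    (hθ : ContMDiff 𝓘(ℝ, E) (𝓘(ℝ, E).prod 𝓘(ℝ, E →L[ℝ] ℝ)) ∞
      (fun p => Bundle.TotalSpace.mk' (E →L[ℝ] ℝ) p (θ p)))
    {S : Set ℂ} (hS : UniqueDiffOn ℝ S) {u : ℂ → X}
    (hu : ContMDiffOn 𝓘(ℝ, ℂ) 𝓘(ℝ, E) ∞ u S) : ContDiffOn ℝ ∞ (pullOne θ S u) S :=
  contDiffOn_clm_apply.2 fun w => contDiffOn_oneForm_comp hθ hS hu w

theorem contDiffOn_pullTwo
    {f : (x : X) → TangentSpace 𝓘(ℝ, E) x →L[ℝ] TangentSpace 𝓘(ℝ, E) x →L[ℝ] ℝ}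
    (hf : ContMDiff 𝓘(ℝ, E) (𝓘(ℝ, E).prod 𝓘(ℝ, E →L[ℝ] E →L[ℝ] ℝ)) ∞
      (fun y => Bundle.TotalSpace.mk' (E →L[ℝ] E →L[ℝ] ℝ) y (f y)))
    {S : Set ℂ} (hS : UniqueDiffOn ℝ S) {u : ℂ → X}
    (hu : ContMDiffOn 𝓘(ℝ, ℂ) 𝓘(ℝ, E) ∞ u S) : ContDiffOn ℝ ∞ (pullTwo f S u) S := by
  have h1 : ContMDiffOn 𝓘(ℝ, ℂ) (𝓘(ℝ, E).prod 𝓘(ℝ, E →L[ℝ] E →L[ℝ] ℝ)) ∞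
    (fun x => Bundle.TotalSpace.mk' (E →L[ℝ] E →L[ℝ] ℝ)
      (E := fun x : X => TangentSpace 𝓘(ℝ, E) x →L[ℝ] TangentSpace 𝓘(ℝ, E) x →L[ℝ]
        Bundle.Trivial X ℝ x) (u x) (f (u x))) S := hf.comp_contMDiffOn hu
  have h2 := ContMDiffOn.clm_bundle_apply₂ (E₃ := Bundle.Trivial X ℝ) (F₃ := ℝ) h1
    (contMDiffOn_mfderivWithin_apply hS hu 1) (contMDiffOn_mfderivWithin_apply hS hu Complex.I)
  rw [← contMDiffOn_iff_contDiffOn]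
  intro x hx
  have := h2 x hx
  rw [Bundle.contMDiffWithinAt_totalSpace] at this
  simpa [pullTwo, Function.comp_def] using! this.2

end PullBack

/-- Since the curve stays in `S`, differentiability within `S` is enough for the chain rule. This
allows curves along the boundary circle, where maps are only given on the side of the closed disk.
-/
theorem vel_comp {V : Type*} [NormedAddCommGroup V] [NormedSpace ℝ V]
    {E : Type*} [NormedAddCommGroup E] [NormedSpace ℝ E]
    {X : Type*} [TopologicalSpace X] [ChartedSpace E X] {c : ℝ → V} {c' : V} {t : ℝ} (hc : HasDerivAt c c' t) {S : Set V} {u : V → X}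
    (hu : MDifferentiableWithinAt 𝓘(ℝ, V) 𝓘(ℝ, E) u S (c t)) (hS : ∀ᶠ s in 𝓝 t, c s ∈ S) :
    vel (E := E) (fun s => u (c s)) t = mfderivWithin 𝓘(ℝ, V) 𝓘(ℝ, E) u S (c t) c' := by
  have hS : c ⁻¹' S ∈ 𝓝 t := hS
  have h1 : UniqueMDiffWithinAt 𝓘(ℝ, ℝ) (c ⁻¹' S) t :=
    uniqueMDiffWithinAt_iff_uniqueDiffWithinAt.2 (uniqueDiffWithinAt_of_mem_nhds hS)
  have h2 : MDifferentiableWithinAt 𝓘(ℝ, ℝ) 𝓘(ℝ, V) c (c ⁻¹' S) t :=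
    hc.differentiableAt.mdifferentiableAt.mdifferentiableWithinAt
  have h3 := mfderivWithin_comp t hu h2 (fun s hs => hs) h1
  rw [mfderivWithin_of_mem_nhds hS, mfderivWithin_of_mem_nhds hS] at h3
  have h4 : mfderiv 𝓘(ℝ, ℝ) 𝓘(ℝ, V) c t (1 : ℝ) = c' := by
    rw [mfderiv_eq_fderiv]
    exact show fderiv ℝ c t (1 : ℝ) = c' from fderiv_apply_one_eq_deriv.trans hc.deriv
  have h5 := congrArg (fun L : ℝ →L[ℝ] E => L 1) h3
  refine h5.trans ?_
  exact congrArg (mfderivWithin 𝓘(ℝ, V) 𝓘(ℝ, E) u S (c t)) h4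

theorem uniqueDiffOn_unitDisk_inter {U : Set ℂ} (hU : IsOpen U) :
    UniqueDiffOn ℝ (unitDisk ∩ U) :=
  (uniqueDiffOn_convex (convex_closedBall _ _)
    (by rw [interior_closedBall _ one_ne_zero]; exact ⟨0, by simp⟩)).inter hU

theorem unitDisk_inter_subset_closure_interior {U : Set ℂ} (hU : IsOpen U) :
    unitDisk ∩ U ⊆ closure (interior (unitDisk ∩ U)) := by
  rw [interior_inter, interior_closedBall _ one_ne_zero, hU.interior_eq]
  rintro x ⟨hx, hxU⟩
  rw [unitDisk, ← closure_ball _ one_ne_zero] at hx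
  rw [inter_comm]
  exact hU.inter_closure ⟨hxU, hx⟩

/-- The axioms of the gerbe are tested on maps smooth near a point, which gives identities at
interior points only. Every relatively open part of the disk lies in the closure of its interior, so
continuity carries them to the boundary. -/
theorem eqOn_unitDisk_inter {β : Type*} [TopologicalSpace β] [T2Space β] {U : Set ℂ}
    (hU : IsOpen U) {f g : ℂ → β} (hf : ContinuousOn f (unitDisk ∩ U))
    (hg : ContinuousOn g (unitDisk ∩ U)) (h : EqOn f g (interior (unitDisk ∩ U))) :
    EqOn f g (unitDisk ∩ U) :=
  h.of_subset_closure hf hg interior_subset (unitDisk_inter_subset_closure_interior hU)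

section PullOne

variable {E : Type*} [NormedAddCommGroup E] [NormedSpace ℝ E]
  {X : Type*} [TopologicalSpace X] [ChartedSpace E X]

theorem pullOne_congr_nhds (θ : (x : X) → TangentSpace 𝓘(ℝ, E) x →L[ℝ] ℝ) {S N : Set ℂ}
    {u : ℂ → X} {x : ℂ} (hN : N ∈ 𝓝 x) : pullOne θ (S ∩ N) u x = pullOne θ S u x := by
  rw [pullOne, pullOne, mfderivWithin_inter hN]

theorem pullOne_apply_eq_vel (θ : (x : X) → TangentSpace 𝓘(ℝ, E) x →L[ℝ] ℝ) {S : Set ℂ}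
    {u : ℂ → X} {x : ℂ} (hu : MDifferentiableWithinAt 𝓘(ℝ, ℂ) 𝓘(ℝ, E) u S x) (hS : S ∈ 𝓝 x)
    (w : ℂ) : pullOne θ S u x w = θ _ (vel (fun t : ℝ => u (x + t * w)) 0) := by
  have hc : HasDerivAt (fun t : ℝ => x + t * w) w 0 := by
    simpa using ((Complex.ofRealCLM.hasDerivAt (x := (0 : ℝ))).mul_const w).const_add x
  have hx : x + ((0 : ℝ) : ℂ) * w = x := by simp
  have h := vel_comp (c := fun t : ℝ => x + t * w) hc (S := S) (u := u) (by rwa [hx])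
    (hc.continuousAt.eventually (by simpa only [hx, Filter.eventually_mem_set] using hS))
  rw [h]
  have : pullOne θ S u x w = pullOne θ S u (x + ((0 : ℝ) : ℂ) * w) w := by rw [hx]
  exact this

end PullOne

section PullOneGerbe

variable {EQ EY EP : Type*}
  [NormedAddCommGroup EQ] [NormedSpace ℝ EQ] [NormedAddCommGroup EY] [NormedSpace ℝ EY]
  [NormedAddCommGroup EP] [NormedSpace ℝ EP]
  {Q Y P : Type*} [TopologicalSpace Q] [ChartedSpace EQ Q]
  [TopologicalSpace Y] [ChartedSpace EY Y] [IsManifold 𝓘(ℝ, EY) ∞ Y]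
  [TopologicalSpace P] [ChartedSpace EP P] [IsManifold 𝓘(ℝ, EP) ∞ P] [MulAction Circle P]
  (G : BundleGerbe (EQ := EQ) (EY := EY) (EP := EP) Q Y P)

theorem BundleGerbe.contMDiffOn_mul {V : Type*} [NormedAddCommGroup V] [NormedSpace ℝ V]
    {S : Set V} {u v : V → P}
    (hu : ContMDiffOn 𝓘(ℝ, V) 𝓘(ℝ, EP) ∞ u S) (hv : ContMDiffOn 𝓘(ℝ, V) 𝓘(ℝ, EP) ∞ v S)
    (h : ∀ x ∈ S, G.src (u x) = G.tgt (v x)) :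
    ContMDiffOn 𝓘(ℝ, V) 𝓘(ℝ, EP) ∞ (fun x => G.mul (u x) (v x)) S :=
  G.smooth_mul.comp (hu.prodMk hv) h

/-- At an interior point both sides are evaluated on the velocity of a straight line, where
`conn_mul` applies. The boundary follows by continuity. -/
theorem BundleGerbe.pullOne_mul {U : Set ℂ} (hU : IsOpen U) {u v : ℂ → P}
    (hu : ContMDiffOn 𝓘(ℝ, ℂ) 𝓘(ℝ, EP) ∞ u (unitDisk ∩ U))
    (hv : ContMDiffOn 𝓘(ℝ, ℂ) 𝓘(ℝ, EP) ∞ v (unitDisk ∩ U))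
    (h : ∀ x ∈ unitDisk ∩ U, G.src (u x) = G.tgt (v x)) :
    EqOn (pullOne G.conn (unitDisk ∩ U) (fun x => G.mul (u x) (v x)))
      (fun x => pullOne G.conn (unitDisk ∩ U) u x + pullOne G.conn (unitDisk ∩ U) v x)
      (unitDisk ∩ U) := by
  have hd := uniqueDiffOn_unitDisk_inter hU
  have hm := G.contMDiffOn_mul hu hv h
  refine eqOn_unitDisk_inter hU (contDiffOn_pullOne G.smooth_conn hd hm).continuousOn
    ((contDiffOn_pullOne G.smooth_conn hd hu).continuousOn.add
      (contDiffOn_pullOne G.smooth_conn hd hv).continuousOn) fun x hx => ?_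
  have hn := mem_interior_iff_mem_nhds.1 hx
  have hl : ∀ w : ℂ, ContMDiffAt 𝓘(ℝ, ℝ) 𝓘(ℝ, ℂ) ∞ (fun t : ℝ => x + t * w) 0 := fun w =>
    (contDiff_const.add (Complex.ofRealCLM.contDiff.mul contDiff_const)).contMDiff.contMDiffAt
  have hxw : ∀ w : ℂ, x + ((0 : ℝ) : ℂ) * w = x := by simp
  ext w : 1
  rw [add_apply,
    pullOne_apply_eq_vel _ ((hm.contMDiffAt hn).mdifferentiableAt (by simp)).mdifferentiableWithinAt hn,
    pullOne_apply_eq_vel _ ((hu.contMDiffAt hn).mdifferentiableAt (by simp)).mdifferentiableWithinAt hn,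
    pullOne_apply_eq_vel _ ((hv.contMDiffAt hn).mdifferentiableAt (by simp)).mdifferentiableWithinAt hn]
  refine G.conn_mul _ _ 0 (ContMDiffAt.comp 0 (by rw [hxw]; exact hu.contMDiffAt hn) (hl w))
    (ContMDiffAt.comp 0 (by rw [hxw]; exact hv.contMDiffAt hn) (hl w)) ?_
  exact ((hl w).continuousAt.eventually (by simpa only [hxw, Filter.eventually_mem_set] using hn)).mono fun t ht => h _ ht

end PullOneGerbe

end

noncomputable section

namespace BundleGerbe

variable {EQ EY EP : Type*}
  [NormedAddCommGroup EQ] [NormedSpace ℝ EQ] [NormedAddCommGroup EY] [NormedSpace ℝ EY]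
  [NormedAddCommGroup EP] [NormedSpace ℝ EP]
  {Q Y P : Type*} [TopologicalSpace Q] [ChartedSpace EQ Q]
  [TopologicalSpace Y] [ChartedSpace EY Y] [IsManifold 𝓘(ℝ, EY) ∞ Y]
  [TopologicalSpace P] [ChartedSpace EP P] [IsManifold 𝓘(ℝ, EP) ∞ P] [MulAction Circle P]
  (G : BundleGerbe (EQ := EQ) (EY := EY) (EP := EP) Q Y P)
  {V : Type*} [NormedAddCommGroup V] [NormedSpace ℝ V]

/-! ### The groupoid of unit vectors -/

theorem exists_over {y₁ y₂ : Y} (h : G.proj y₁ = G.proj y₂) :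
    ∃ p, G.tgt p = y₁ ∧ G.src p = y₂ := by
  obtain ⟨W, hW, s, c, -, -, hs, -⟩ := G.locallyTrivial y₁ y₂ h
  exact ⟨s (y₁, y₂), hs _ (mem_of_mem_nhds hW) h⟩

/-- Both vectors are multiples of the value of the same local section. -/
theorem exists_smul_eq {p q : P} (ht : G.tgt p = G.tgt q) (hs : G.src p = G.src q) :
    ∃ z : Circle, z • p = q := by
  obtain ⟨W, hW, s, c, -, -, -, hc⟩ := G.locallyTrivial _ _ (G.proj_tgt p)
  have h1 := hc p (mem_of_mem_nhds hW)
  have h2 := hc q (by rw [← ht, ← hs]; exact mem_of_mem_nhds hW)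
  refine ⟨c q * (c p)⁻¹, ?_⟩
  rw [SemigroupAction.mul_smul, inv_smul_eq_iff.2 h1.symm, ht, hs]
  exact h2

theorem smul_left_inj (G : BundleGerbe (EQ := EQ) (EY := EY) (EP := EP) Q Y P)
    {z w : Circle} {p : P} (h : z • p = w • p) : z = w := by
  have := G.free (w⁻¹ * z) p (by rw [SemigroupAction.mul_smul, h, inv_smul_smul])
  exact (inv_mul_eq_one.1 this).symm

/-- Cancellation is not among the axioms. The two candidates differ by a scalar, the scalar passes
through the product, and freeness makes it `1`. -/
theorem mul_left_cancel {p q q' : P} (h : G.src p = G.tgt q) (h' : G.src p = G.tgt q')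
    (hs : G.src q = G.src q') (hm : G.mul p q = G.mul p q') : q = q' := by
  obtain ⟨z, rfl⟩ := G.exists_smul_eq (h.symm.trans h') hs
  rw [G.mul_smul z p q h] at hm
  rw [G.free z (G.mul p q) hm.symm, one_smul]

theorem mul_right_cancel {p p' q : P} (h : G.src p = G.tgt q) (h' : G.src p' = G.tgt q)
    (ht : G.tgt p = G.tgt p') (hm : G.mul p q = G.mul p' q) : p = p' := by
  obtain ⟨z, rfl⟩ := G.exists_smul_eq ht (h.trans h'.symm)
  rw [G.smul_mul z p q h] at hm
  rw [G.free z (G.mul p q) hm.symm, one_smul]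

/-- For any arrow `p` from `y` to itself, `p * p = z • p` for some scalar `z`, so `z⁻¹ • p` is
idempotent. -/
theorem exists_unit (y : Y) : ∃ e, G.tgt e = y ∧ G.src e = y ∧ G.mul e e = e := by
  obtain ⟨p, ht, hs⟩ := G.exists_over (rfl : G.proj y = G.proj y)
  have h : G.src p = G.tgt p := hs.trans ht.symm
  obtain ⟨z, hz⟩ := G.exists_smul_eq (p := p) (q := G.mul p p) (G.tgt_mul p p h).symm
    (G.src_mul p p h).symm
  refine ⟨z⁻¹ • p, by rw [G.tgt_smul, ht], by rw [G.src_smul, hs], ?_⟩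
  rw [G.smul_mul _ _ _ (by rw [G.tgt_smul, h]), G.mul_smul _ _ _ h, ← hz, inv_smul_smul]

/-- The unit of the groupoid of unit vectors of `R` at a point of `Y`. -/
def unit (y : Y) : P := (G.exists_unit y).choose

@[simp] theorem tgt_unit (y : Y) : G.tgt (G.unit y) = y := (G.exists_unit y).choose_spec.1
@[simp] theorem src_unit (y : Y) : G.src (G.unit y) = y := (G.exists_unit y).choose_spec.2.1
theorem unit_mul_unit (y : Y) : G.mul (G.unit y) (G.unit y) = G.unit y :=
  (G.exists_unit y).choose_spec.2.2

theorem unit_mul {y : Y} {p : P} (h : G.tgt p = y) : G.mul (G.unit y) p = p := by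
  have h' : G.src (G.unit y) = G.tgt p := by rw [G.src_unit, h]
  refine G.mul_left_cancel (p := G.unit y) (by simp [G.tgt_mul _ _ h']) h' (G.src_mul _ _ h') ?_
  rw [← G.mul_assoc _ _ _ (by simp) h', unit_mul_unit]

theorem mul_unit {y : Y} {p : P} (h : G.src p = y) : G.mul p (G.unit y) = p := by
  have h' : G.src p = G.tgt (G.unit y) := by rw [G.tgt_unit, h]
  refine G.mul_right_cancel (q := G.unit y) (by simp [G.src_mul _ _ h']) h' (G.tgt_mul _ _ h') ?_
  rw [G.mul_assoc _ _ _ h' (by simp), unit_mul_unit]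

theorem exists_inv (p : P) : ∃ q, G.tgt q = G.src p ∧ G.src q = G.tgt p ∧
    G.mul p q = G.unit (G.tgt p) := by
  obtain ⟨q, ht, hs⟩ := G.exists_over (G.proj_tgt p).symm
  obtain ⟨z, hz⟩ := G.exists_smul_eq (p := G.mul p q) (q := G.unit (G.tgt p))
    (by simp [G.tgt_mul _ _ ht.symm]) (by simp [G.src_mul _ _ ht.symm, hs])
  exact ⟨z • q, by rw [G.tgt_smul, ht], by rw [G.src_smul, hs], by rw [G.mul_smul _ _ _ ht.symm, hz]⟩

/-- The inverse in the groupoid of unit vectors of `R`. -/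
def inv (p : P) : P := (G.exists_inv p).choose

@[simp] theorem tgt_inv (p : P) : G.tgt (G.inv p) = G.src p := (G.exists_inv p).choose_spec.1
@[simp] theorem src_inv (p : P) : G.src (G.inv p) = G.tgt p := (G.exists_inv p).choose_spec.2.1
theorem mul_inv (p : P) : G.mul p (G.inv p) = G.unit (G.tgt p) :=
  (G.exists_inv p).choose_spec.2.2

theorem inv_mul (p : P) : G.mul (G.inv p) p = G.unit (G.src p) := by
  have h1 : G.src p = G.tgt (G.inv p) := by simp
  have h2 : G.src (G.inv p) = G.tgt p := by simp
  refine G.mul_left_cancel (p := p) (by simp [G.tgt_mul _ _ h2]) (by simp)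
    (by simp [G.src_mul _ _ h2]) ?_
  rw [← G.mul_assoc _ _ _ h1 h2, mul_inv, unit_mul _ rfl, mul_unit _ rfl]

theorem inv_mul_cancel_left {p q : P} (h : G.src p = G.tgt q) :
    G.mul (G.inv p) (G.mul p q) = q := by
  rw [← G.mul_assoc _ _ _ (by simp) h, inv_mul, unit_mul _ h.symm]

theorem mul_inv_cancel_right {p q : P} (h : G.src p = G.tgt q) :
    G.mul (G.mul p q) (G.inv q) = p := by
  rw [G.mul_assoc _ _ _ h (by simp), mul_inv, mul_unit _ h]

/-! ### Smooth families of unit vectors -/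

theorem contMDiffOn_smul (G : BundleGerbe (EQ := EQ) (EY := EY) (EP := EP) Q Y P)
    {S : Set V} {z : V → Circle} {u : V → P}
    (hz : ContMDiffOn 𝓘(ℝ, V) (𝓡 1) ∞ z S) (hu : ContMDiffOn 𝓘(ℝ, V) 𝓘(ℝ, EP) ∞ u S) :
    ContMDiffOn 𝓘(ℝ, V) 𝓘(ℝ, EP) ∞ (fun x => z x • u x) S :=
  G.smooth_smul.comp_contMDiffOn (hz.prodMk hu)

/-- Pointwise the scalar exists by transitivity. It is smooth because near each point it is the
quotient of the fibre coordinates of `v` and `u` in one local trivialisation. -/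
theorem exists_ratio {S : Set V} {u v : V → P}
    (hu : ContMDiffOn 𝓘(ℝ, V) 𝓘(ℝ, EP) ∞ u S) (hv : ContMDiffOn 𝓘(ℝ, V) 𝓘(ℝ, EP) ∞ v S)
    (ht : ∀ x ∈ S, G.tgt (u x) = G.tgt (v x)) (hs : ∀ x ∈ S, G.src (u x) = G.src (v x)) :
    ∃ z : V → Circle, ContMDiffOn 𝓘(ℝ, V) (𝓡 1) ∞ z S ∧ ∀ x ∈ S, z x • u x = v x := by
  classical
  have h : ∀ x, ∃ z : Circle, x ∈ S → z • u x = v x := fun x => by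
    by_cases hx : x ∈ S
    · obtain ⟨z, hz⟩ := G.exists_smul_eq (ht x hx) (hs x hx)
      exact ⟨z, fun _ => hz⟩
    · exact ⟨1, fun h => absurd h hx⟩
  choose z hz using h
  refine ⟨z, fun x hx => ?_, hz⟩
  obtain ⟨W, hW, s, c, -, hcs, -, hc⟩ := G.locallyTrivial _ _ (G.proj_tgt (u x))
  have key : ∀ w : V → P, ContMDiffOn 𝓘(ℝ, V) 𝓘(ℝ, EP) ∞ w S → G.tgt (w x) = G.tgt (u x) →
      G.src (w x) = G.src (u x) → ContMDiffWithinAt 𝓘(ℝ, V) (𝓡 1) ∞ (fun y => c (w y)) S x ∧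
      ∀ᶠ y in 𝓝[S] x, (G.tgt (w y), G.src (w y)) ∈ W := by
    intro w hw h1 h2
    have hcont : Continuous fun p => (G.tgt p, G.src p) :=
      G.smooth_tgt.continuous.prodMk G.smooth_src.continuous
    have hn : {p | (G.tgt p, G.src p) ∈ W} ∈ 𝓝 (w x) :=
      hcont.continuousAt.preimage_mem_nhds (by rw [h1, h2]; exact hW)
    exact ⟨(hcs.contMDiffAt hn).comp_contMDiffWithinAt x (hw x hx), (hw x hx).continuousWithinAt hn⟩
  obtain ⟨hu1, hu2⟩ := key u hu rfl rfl
  obtain ⟨hv1, hv2⟩ := key v hv (ht x hx).symm (hs x hx).symm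
  have hf : ∀ y, y ∈ S → (G.tgt (u y), G.src (u y)) ∈ W → (G.tgt (v y), G.src (v y)) ∈ W →
      z y = c (v y) * (c (u y))⁻¹ := by
    intro y hy h1 h2
    refine G.smul_left_inj (p := u y) ?_
    rw [hz y hy, SemigroupAction.mul_smul, inv_smul_eq_iff.2 (hc _ h1).symm, ht y hy, hs y hy, hc _ h2]
  refine ContMDiffWithinAt.congr_of_eventuallyEq (hv1.mul hu1.inv) ?_
    (hf x hx (mem_of_mem_nhds hW) (by rw [← ht x hx, ← hs x hx]; exact mem_of_mem_nhds hW))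
  filter_upwards [hu2, hv2, self_mem_nhdsWithin] with y h1 h2 h3 using hf y h3 h1 h2

theorem exists_local_section {S : Set V} {a b : V → Y}
    (ha : ContMDiffOn 𝓘(ℝ, V) 𝓘(ℝ, EY) ∞ a S) (hb : ContMDiffOn 𝓘(ℝ, V) 𝓘(ℝ, EY) ∞ b S)
    (h : ∀ x ∈ S, G.proj (a x) = G.proj (b x)) {x : V} (hx : x ∈ S) :
    ∃ N : Set V, IsOpen N ∧ x ∈ N ∧ ∃ u : V → P, ContMDiffOn 𝓘(ℝ, V) 𝓘(ℝ, EP) ∞ u (S ∩ N) ∧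
      ∀ y ∈ S ∩ N, G.tgt (u y) = a y ∧ G.src (u y) = b y := by
  obtain ⟨W, hW, s, c, hsm, -, hs, -⟩ := G.locallyTrivial _ _ (h x hx)
  have hn : (fun y => (a y, b y)) ⁻¹' W ∈ 𝓝[S] x :=
    ((ha x hx).continuousWithinAt.prodMk (hb x hx).continuousWithinAt) hW
  obtain ⟨N, hN, hxN, hNW⟩ := mem_nhdsWithin.1 hn
  have hNW' : ∀ y ∈ S ∩ N, (a y, b y) ∈ W := fun y hy => hNW ⟨hy.2, hy.1⟩
  refine ⟨N, hN, hxN, fun y => s (a y, b y), ?_, fun y hy => hs _ (hNW' y hy) (h y hy.1)⟩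
  exact hsm.comp ((ha.prodMk hb).mono inter_subset_left) fun y hy => ⟨hNW' y hy, h y hy.1⟩

/-- Locally there is a smooth `v` with the endpoints of `w`, and the smooth ratio of `u * w` to `u *
v` also carries `v` to `w` by cancellation. This makes units and inverses smooth although they were
chosen point by point. -/
theorem contMDiffOn_of_mul {S : Set V} {u w : V → P}
    (hu : ContMDiffOn 𝓘(ℝ, V) 𝓘(ℝ, EP) ∞ u S)
    (hm : ContMDiffOn 𝓘(ℝ, V) 𝓘(ℝ, EP) ∞ (fun x => G.mul (u x) (w x)) S)
    (h : ∀ x ∈ S, G.src (u x) = G.tgt (w x)) : ContMDiffOn 𝓘(ℝ, V) 𝓘(ℝ, EP) ∞ w S := by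
  refine contMDiffOn_of_locally_contMDiffOn fun x hx => ?_
  have ha := G.smooth_src.comp_contMDiffOn hu
  have hb := G.smooth_src.comp_contMDiffOn hm
  have hb' : ∀ x ∈ S, G.src (G.mul (u x) (w x)) = G.src (w x) := fun x hx => G.src_mul _ _ (h x hx)
  obtain ⟨N, hN, hxN, v, hv, hv'⟩ := G.exists_local_section ha hb
    (fun x hx => by simp [hb' x hx, h x hx, G.proj_tgt]) hx
  have h1 : ∀ y ∈ S ∩ N, G.src (u y) = G.tgt (v y) := fun y hy => (hv' y hy).1.symm
  obtain ⟨z, hz, hzu⟩ := G.exists_ratio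
    (G.contMDiffOn_mul (hu.mono inter_subset_left) hv h1) (hm.mono inter_subset_left)
    (fun y hy => by rw [G.tgt_mul _ _ (h1 y hy), G.tgt_mul _ _ (h y hy.1)])
    (fun y hy => by rw [G.src_mul _ _ (h1 y hy), (hv' y hy).2]; rfl)
  refine ⟨N, hN, hxN, (G.contMDiffOn_smul hz hv).congr fun y hy => ?_⟩
  refine G.mul_left_cancel (p := u y) (h y hy.1) (by rw [G.tgt_smul, h1 y hy])
    (by rw [G.src_smul, (hv' y hy).2]; exact (hb' y hy.1).symm) ?_
  rw [G.mul_smul _ _ _ (h1 y hy), hzu y hy]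

theorem contMDiffOn_unit {S : Set V} {b : V → Y} (hb : ContMDiffOn 𝓘(ℝ, V) 𝓘(ℝ, EY) ∞ b S) :
    ContMDiffOn 𝓘(ℝ, V) 𝓘(ℝ, EP) ∞ (fun x => G.unit (b x)) S := by
  refine contMDiffOn_of_locally_contMDiffOn fun x hx => ?_
  obtain ⟨N, hN, hxN, v, hv, hv'⟩ := G.exists_local_section hb hb (fun _ _ => rfl) hx
  refine ⟨N, hN, hxN, G.contMDiffOn_of_mul hv (hv.congr fun y hy => ?_) fun y hy => ?_⟩
  · exact G.mul_unit (hv' y hy).2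
  · simp [(hv' y hy).2]

theorem contMDiffOn_inv {S : Set V} {u : V → P} (hu : ContMDiffOn 𝓘(ℝ, V) 𝓘(ℝ, EP) ∞ u S) :
    ContMDiffOn 𝓘(ℝ, V) 𝓘(ℝ, EP) ∞ (fun x => G.inv (u x)) S :=
  G.contMDiffOn_of_mul hu ((G.contMDiffOn_unit (G.smooth_tgt.comp_contMDiffOn hu)).congr
    fun x _ => G.mul_inv (u x)) fun x _ => by simp

end BundleGerbe

end

noncomputable section

/-! ### Induction over intervals and rectangles -/

/-- The supremum of the endpoints reached from `a` is passed by the local hypothesis. Gluing may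
shrink the interval at both ends, so the property is carried with a margin beyond the points
reached. -/
theorem interval_induction {p : ℝ → ℝ → Prop}
    (mono : ∀ a b a' b', a ≤ a' → b' ≤ b → p a b → p a' b')
    (glue : ∀ a a' b' b a₀ b₀, a ≤ a' → a' < b' → b' ≤ b → a < a₀ → b₀ < b →
      p a b' → p a' b → p a₀ b₀)
    (loc : ∀ x, ∃ ε > 0, p (x - ε) (x + ε)) (a b : ℝ) : p a b := by
  rcases le_total b a with hab | hab
  · obtain ⟨ε, hε, h⟩ := loc a
    exact mono _ _ _ _ (by linarith) (by linarith) h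
  set S : Set ℝ := {x | x ∈ Icc a b ∧ ∃ ε > 0, p (a - ε) (x + ε)} with hS
  have haS : a ∈ S := ⟨⟨le_rfl, hab⟩, loc a⟩
  have hbdd : BddAbove S := ⟨b, fun x hx => hx.1.2⟩
  set s := sSup S
  have has : a ≤ s := le_csSup hbdd haS
  have hsb : s ≤ b := csSup_le ⟨a, haS⟩ fun x hx => hx.1.2
  obtain ⟨ε, hε, h⟩ := loc s
  obtain ⟨x, ⟨hx, δ, hδ, hxp⟩, hxs⟩ := exists_lt_of_lt_csSup ⟨a, haS⟩ (show s - ε < s by linarith)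
  have hxle : x ≤ s := le_csSup hbdd ⟨hx, δ, hδ, hxp⟩
  set δ' := min δ ε
  have hδ' : 0 < δ' := lt_min hδ hε
  -- The intervals overlap because `x > s - ε`. The maximum keeps the second one from starting to
  -- the left of the first.
  have h1 : p (a - δ' / 2) (s + ε / 2) := by
    refine glue (a - δ') (max (a - δ') (s - ε)) (x + δ') (s + ε) _ _ (le_max_left _ _)
      (max_lt (by linarith [hx.1]) (by linarith)) (by linarith [min_le_right δ ε])
      (by linarith) (by linarith)
      (mono _ _ _ _ (by linarith [min_le_left δ ε]) (by linarith [min_le_left δ ε]) hxp)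
      (mono _ _ _ _ (le_max_right _ _) le_rfl h)
  have h2 : b ≤ s := by
    by_contra! hlt
    have h3 : min b (s + ε / 4) ∈ S := by
      refine ⟨⟨le_min hab (by linarith), min_le_left _ _⟩, min (δ' / 2) (ε / 4),
        lt_min (by linarith) (by linarith), mono _ _ _ _ ?_ ?_ h1⟩
      · linarith [min_le_left (δ' / 2) (ε / 4)]
      · linarith [min_le_right (δ' / 2) (ε / 4), min_le_right b (s + ε / 4)]
    have h4 := le_csSup hbdd h3
    have : s < min b (s + ε / 4) := lt_min hlt (by linarith)
    exact absurd h4 (not_le.2 this)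
  exact mono _ _ _ _ (by linarith) (by linarith) h1

/-- An open rectangle in the complex plane. -/
def rect (a b c d : ℝ) : Set ℂ := {z | (a < z.re ∧ z.re < b) ∧ c < z.im ∧ z.im < d}

theorem isOpen_rect (a b c d : ℝ) : IsOpen (rect a b c d) :=
  ((isOpen_lt continuous_const Complex.continuous_re).inter
    (isOpen_lt Complex.continuous_re continuous_const)).inter
    ((isOpen_lt continuous_const Complex.continuous_im).inter
    (isOpen_lt Complex.continuous_im continuous_const))

theorem convex_rect (a b c d : ℝ) : Convex ℝ (rect a b c d) :=
  ((convex_halfSpace_re_gt a).inter (convex_halfSpace_re_lt b)).inter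
    ((convex_halfSpace_im_gt c).inter (convex_halfSpace_im_lt d))

theorem exists_rect_subset {x : ℂ} {N : Set ℂ} (hN : N ∈ 𝓝 x) :
    ∃ ε > 0, rect (x.re - ε) (x.re + ε) (x.im - ε) (x.im + ε) ⊆ N := by
  obtain ⟨ε, hε, h⟩ := Metric.mem_nhds_iff.1 hN
  refine ⟨ε / 2, by linarith, fun z hz => h ?_⟩
  obtain ⟨⟨h1, h2⟩, h3, h4⟩ := hz
  rw [mem_ball_iff_norm]
  refine (Complex.norm_le_abs_re_add_abs_im _).trans_lt ?_
  have e1 : |(z - x).re| < ε / 2 := by rw [abs_lt, Complex.sub_re]; constructor <;> linarith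
  have e2 : |(z - x).im| < ε / 2 := by rw [abs_lt, Complex.sub_im]; constructor <;> linarith
  linarith

theorem closure_rect_subset {a b c d a₀ b₀ c₀ d₀ : ℝ} (ha : a < a₀) (hb : b₀ < b) (hc : c < c₀)
    (hd : d₀ < d) : IsCompact (closure (rect a₀ b₀ c₀ d₀)) ∧
      closure (rect a₀ b₀ c₀ d₀) ⊆ rect a b c d := by
  have h : closure (rect a₀ b₀ c₀ d₀) ⊆ Icc a₀ b₀ ×ℂ Icc c₀ d₀ :=
    closure_minimal (fun z hz => ⟨⟨hz.1.1.le, hz.1.2.le⟩, hz.2.1.le, hz.2.2.le⟩)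
      (isClosed_Icc.reProdIm isClosed_Icc)
  exact ⟨(isCompact_Icc.reProdIm isCompact_Icc).of_isClosed_subset isClosed_closure h,
    h.trans fun z hz => ⟨⟨ha.trans_le hz.1.1, hz.1.2.trans_lt hb⟩, hc.trans_le hz.2.1,
      hz.2.2.trans_lt hd⟩⟩

/-- An induction over intervals in the real direction, whose local step is an induction in the
imaginary direction over a thin strip. The glued set need only lie compactly inside the union of the
two halves: gluing cocycles requires an isomorphism on a compact piece of the overlap. -/
theorem rect_induction {p : Set ℂ → Prop} (mono : ∀ Z Z', Z' ⊆ Z → p Z → p Z')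
    (glue : ∀ (Z Z₀ : Set ℂ) (l : ℂ →L[ℝ] ℝ) (a b : ℝ), IsOpen Z → Convex ℝ Z → IsOpen Z₀ →
      Convex ℝ Z₀ → IsCompact (closure Z₀) → closure Z₀ ⊆ Z → a < b →
      p (Z ∩ {x | l x < b}) → p (Z ∩ {x | a < l x}) → p Z₀)
    (loc : ∀ x, ∃ N ∈ 𝓝 x, p N) (a b c d : ℝ) : p (rect a b c d) := by
  have hglue_re : ∀ a a' b' b c d a₀ b₀ c₀ d₀, a' < b' → a < a₀ → b₀ < b → c < c₀ → d₀ < d →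
      p (rect a b' c d) → p (rect a' b c d) → p (rect a₀ b₀ c₀ d₀) :=
    fun a a' b' b c d a₀ b₀ c₀ d₀ h ha hb hc hd h1 h2 =>
    glue (rect a b c d) _ Complex.reCLM a' b' (isOpen_rect _ _ _ _) (convex_rect _ _ _ _)
      (isOpen_rect _ _ _ _) (convex_rect _ _ _ _) (closure_rect_subset ha hb hc hd).1
      (closure_rect_subset ha hb hc hd).2 h
      (mono (rect a b' c d) _ (fun z hz => ⟨⟨hz.1.1.1, hz.2⟩, hz.1.2⟩) h1)
      (mono (rect a' b c d) _ (fun z hz => ⟨⟨hz.2, hz.1.1.2⟩, hz.1.2⟩) h2)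
  have hglue_im : ∀ a b c c' d' d a₀ b₀ c₀ d₀, c' < d' → a < a₀ → b₀ < b → c < c₀ → d₀ < d →
      p (rect a b c d') → p (rect a b c' d) → p (rect a₀ b₀ c₀ d₀) :=
    fun a b c c' d' d a₀ b₀ c₀ d₀ h ha hb hc hd h1 h2 =>
    glue (rect a b c d) _ Complex.imCLM c' d' (isOpen_rect _ _ _ _) (convex_rect _ _ _ _)
      (isOpen_rect _ _ _ _) (convex_rect _ _ _ _) (closure_rect_subset ha hb hc hd).1
      (closure_rect_subset ha hb hc hd).2 h
      (mono (rect a b c d') _ (fun z hz => ⟨hz.1.1, ⟨hz.1.2.1, hz.2⟩⟩) h1)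
      (mono (rect a b c' d) _ (fun z hz => ⟨hz.1.1, ⟨hz.2, hz.1.2.2⟩⟩) h2)
  have hmono : ∀ {a b c d a' b' c' d'}, a ≤ a' → b' ≤ b → c ≤ c' → d' ≤ d →
      p (rect a b c d) → p (rect a' b' c' d') := fun h1 h2 h3 h4 =>
    mono _ _ fun z hz => ⟨⟨h1.trans_lt hz.1.1, hz.1.2.trans_le h2⟩,
      h3.trans_lt hz.2.1, hz.2.2.trans_le h4⟩
  -- Gluing in one direction also shrinks the rectangle in the other, so a margin there is part of
  -- the property under induction.
  suffices ∃ η > 0, p (rect a b (c - η) (d + η)) by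
    obtain ⟨η, hη, h⟩ := this
    exact hmono le_rfl le_rfl (by linarith) (by linarith) h
  refine interval_induction (p := fun a b => ∃ η > 0, p (rect a b (c - η) (d + η)))
    (fun _ _ _ _ h1 h2 ⟨η, hη, h⟩ => ⟨η, hη, hmono h1 h2 le_rfl le_rfl h⟩)
    (fun a a' b' b a₀ b₀ _ h _ ha hb ⟨η, hη, h1⟩ ⟨δ, hδ, h2⟩ => ?_) (fun x => ?_) a b
  · have hm : 0 < min η δ := lt_min hη hδ
    exact ⟨min η δ / 2, by linarith, hglue_re a a' b' b (c - min η δ) (d + min η δ) _ _ _ _ h ha hb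
      (by linarith) (by linarith)
      (hmono le_rfl le_rfl (by linarith [min_le_left η δ]) (by linarith [min_le_left η δ]) h1)
      (hmono le_rfl le_rfl (by linarith [min_le_right η δ]) (by linarith [min_le_right η δ]) h2)⟩
  suffices ∃ ε > 0, p (rect (x - ε) (x + ε) (c - 1) (d + 1)) by
    obtain ⟨ε, hε, h⟩ := this
    exact ⟨ε, hε, 1, one_pos, h⟩
  refine interval_induction (p := fun c d => ∃ ε > 0, p (rect (x - ε) (x + ε) c d))
    (fun _ _ _ _ h1 h2 ⟨ε, hε, h⟩ => ⟨ε, hε, hmono le_rfl le_rfl h1 h2 h⟩)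
    (fun c c' d' d c₀ d₀ _ h _ hc hd ⟨ε, hε, h1⟩ ⟨δ, hδ, h2⟩ => ?_)
    (fun y => ?_) _ _
  · have hm : 0 < min ε δ := lt_min hε hδ
    exact ⟨min ε δ / 2, by linarith, hglue_im (x - min ε δ) (x + min ε δ) c c' d' d _ _ _ _ h
      (by linarith) (by linarith) hc hd
      (hmono (by linarith [min_le_left ε δ]) (by linarith [min_le_left ε δ]) le_rfl le_rfl h1)
      (hmono (by linarith [min_le_right ε δ]) (by linarith [min_le_right ε δ]) le_rfl le_rfl h2)⟩
  obtain ⟨N, hN, h⟩ := loc ⟨x, y⟩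
  obtain ⟨ε, hε, hs⟩ := exists_rect_subset hN
  exact ⟨ε, hε, ε, hε, mono _ _ hs h⟩

/-! ### Logarithms of circle-valued functions -/

section Log

variable {V : Type*} [NormedAddCommGroup V] [NormedSpace ℝ V]

/-- Near `x` the continuous logarithm stays within `π` of its value at `x`, so it equals that value
plus the imaginary part of the principal logarithm of `g / g x`. -/
theorem contMDiffWithinAt_log {S : Set V} {g : V → Circle} {θ : V → ℝ} {x : V}
    (hg : ContMDiffWithinAt 𝓘(ℝ, V) (𝓡 1) ∞ g S x) (hθ : ContinuousWithinAt θ S x) (hx : x ∈ S)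
    (h : ∀ y ∈ S, Circle.exp (θ y) = g y) : ContDiffWithinAt ℝ ∞ θ S x := by
  have h1 : ContMDiffWithinAt 𝓘(ℝ, V) (𝓡 1) ∞ (fun y => g y * (g x)⁻¹) S x :=
    hg.mul contMDiffWithinAt_const
  have h2 : ContDiffWithinAt ℝ ∞ (fun y => ((g y * (g x)⁻¹ : Circle) : ℂ)) S x :=
    contMDiffWithinAt_iff_contDiffWithinAt.1
      (contMDiff_circle_coe.contMDiffAt.comp_contMDiffWithinAt x h1)
  have h3 : ContDiffAt ℝ ∞ Complex.log ((g x * (g x)⁻¹ : Circle) : ℂ) :=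
    (Complex.contDiffAt_log (by simp)).restrict_scalars ℝ
  have h4 : ContDiffWithinAt ℝ ∞
      (fun y => θ x + (Complex.log ((g y * (g x)⁻¹ : Circle) : ℂ)).im) S x :=
    contDiffWithinAt_const.add (Complex.imCLM.contDiff.contDiffAt.comp_contDiffWithinAt
      (f := fun y => Complex.log ((g y * (g x)⁻¹ : Circle) : ℂ)) x
      (ContDiffAt.comp_contDiffWithinAt (g := Complex.log) x h3 h2))
  have key : ∀ y ∈ S, |θ y - θ x| < Real.pi →
      θ y = θ x + (Complex.log ((g y * (g x)⁻¹ : Circle) : ℂ)).im := by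
    intro y hy hlt
    rw [← h y hy, ← h x hx, ← Circle.exp_neg, ← Circle.exp_add, ← sub_eq_add_neg, Complex.log_im]
    rw [abs_lt] at hlt
    have := Circle.arg_exp (x := θ y - θ x) hlt.1 hlt.2.le
    rw [this]; ring
  refine h4.congr_of_eventuallyEq ?_ (key x hx (by simp [Real.pi_pos]))
  have h5 : ∀ᶠ y in 𝓝[S] x, |θ y - θ x| < Real.pi := by
    have := (hθ.sub (continuousWithinAt_const (b := θ x))).abs
    exact this.eventually (by simpa using gt_mem_nhds Real.pi_pos)
  filter_upwards [h5, self_mem_nhdsWithin] with y h6 h7 using key y h7 h6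

/-- Contracting `S` along segments to a point gives a homotopy from a constant to `g`. Lifting it
through the covering `Circle.exp` yields a continuous logarithm, which is automatically smooth. -/
theorem exists_log {S : Set V} (hS : Convex ℝ S) {g : V → Circle}
    (hg : ContMDiffOn 𝓘(ℝ, V) (𝓡 1) ∞ g S) :
    ∃ θ : V → ℝ, ContDiffOn ℝ ∞ θ S ∧ ∀ x ∈ S, Circle.exp (θ x) = g x := by
  classical
  rcases S.eq_empty_or_nonempty with rfl | ⟨x₀, hx₀⟩
  · exact ⟨0, by simp, by simp⟩
  have hm : ∀ q : unitInterval × S, x₀ + (q.1 : ℝ) • ((q.2 : V) - x₀) ∈ S := fun q =>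
    hS.add_smul_sub_mem hx₀ q.2.2 q.1.2
  let H : C(unitInterval × S, Circle) := ⟨fun q => g (x₀ + (q.1 : ℝ) • ((q.2 : V) - x₀)),
    hg.continuousOn.comp_continuous (by fun_prop) hm⟩
  let f : C(S, ℝ) := ContinuousMap.const _ (Complex.arg (g x₀))
  have H0 : ∀ a, H (0, a) = Circle.exp (f a) := fun a => by simp [H, f]
  let F := Circle.isCoveringMap_exp.liftHomotopy H f H0
  have hF : ∀ q, Circle.exp (F q) = H q :=
    fun q => congrFun (Circle.isCoveringMap_exp.liftHomotopy_lifts H f H0) q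
  let θ : V → ℝ := fun x => if h : x ∈ S then F (1, ⟨x, h⟩) else 0
  have hθ : ∀ x ∈ S, Circle.exp (θ x) = g x := by
    intro x hx
    simp only [θ, dif_pos hx, hF]
    simp [H]
  have hc : ContinuousOn θ S := by
    rw [continuousOn_iff_continuous_domRestrict]
    have : S.domRestrict θ = fun x => F (1, x) := by
      ext x; simp [θ, Set.domRestrict]
    rw [this]
    fun_prop
  exact ⟨θ, fun x hx => contMDiffWithinAt_log (hg x hx) (hc x hx) hx hθ, hθ⟩

end Log

end

noncomputable section

/-! ### Stokes' theorem on the disk -/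

theorem uniqueDiffOn_unitDisk : UniqueDiffOn ℝ unitDisk := by
  simpa using uniqueDiffOn_unitDisk_inter isOpen_univ

theorem continuousOn_curl {S : Set ℂ} (hS : UniqueDiffOn ℝ S) {η : ℂ → ℂ →L[ℝ] ℝ}
    (h : ContDiffOn ℝ ∞ η S) : ContinuousOn (curl S η) S := by
  have h1 := h.continuousOn_fderivWithin hS (by simp)
  exact ((h1.clm_apply continuousOn_const).clm_apply continuousOn_const).sub
    ((h1.clm_apply continuousOn_const).clm_apply continuousOn_const)

theorem circ_eq (t : ℝ) : circ t = Complex.exp ((2 * Real.pi * t : ℝ) * Complex.I) := by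
  rw [circ, Circle.coe_exp]

theorem circ_add_one (t : ℝ) : circ (t + 1) = circ t := by
  rw [circ, circ, mul_add, mul_one, Circle.exp_add, Circle.exp_two_pi, mul_one]

theorem circVel_add_one (t : ℝ) : circVel (t + 1) = circVel t := by
  rw [circVel, circVel, circ_add_one]

theorem hasDerivAt_circ (t : ℝ) : HasDerivAt circ (circVel t) t := by
  have h1 : HasDerivAt (fun t : ℝ => ((2 * Real.pi * t : ℝ) : ℂ) * Complex.I)
      ((2 * Real.pi : ℝ) * Complex.I) t := by
    have := ((hasDerivAt_id t).const_mul (2 * Real.pi)).ofReal_comp.mul_const Complex.I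
    simpa using this
  have h2 := h1.cexp
  have : circ = fun t : ℝ => Complex.exp (((2 * Real.pi * t : ℝ) : ℂ) * Complex.I) := by
    ext t; exact circ_eq t
  rw [circVel, this]
  convert! h2 using 1
  push_cast; ring

/-- The polar parametrisation of the plane. -/
def polar (p : ℝ × ℝ) : ℂ := p.1 • Complex.exp (p.2 * Complex.I)

theorem polar_mem {p : ℝ × ℝ} (h : p.1 ∈ Icc (0 : ℝ) 1) : polar p ∈ unitDisk := by
  simp [polar, Complex.norm_exp_ofReal_mul_I, abs_of_nonneg h.1, h.2]

theorem hasFDerivAt_expI (p : ℝ × ℝ) :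
    HasFDerivAt (fun p : ℝ × ℝ => Complex.exp (p.2 * Complex.I))
      ((ContinuousLinearMap.snd ℝ ℝ ℝ).smulRight (Complex.I * Complex.exp (p.2 * Complex.I))) p := by
  have h1 : HasDerivAt (fun t : ℝ => Complex.exp (t * Complex.I))
      (Complex.I * Complex.exp (p.2 * Complex.I)) p.2 := by
    have := ((Complex.ofRealCLM.hasDerivAt (x := p.2)).mul_const Complex.I).cexp
    convert! this using 1
    simp [mul_comm]
  have h2 := h1.hasFDerivAt.comp p (hasFDerivAt_snd (𝕜 := ℝ) (p := p))
  convert! h2 using 1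

theorem hasFDerivAt_polar (p : ℝ × ℝ) :
    HasFDerivAt polar ((ContinuousLinearMap.fst ℝ ℝ ℝ).smulRight (Complex.exp (p.2 * Complex.I)) +
      (ContinuousLinearMap.snd ℝ ℝ ℝ).smulRight
        (p.1 • (Complex.I * Complex.exp (p.2 * Complex.I)))) p := by
  have h := (hasFDerivAt_fst (𝕜 := ℝ) (p := p)).smul (hasFDerivAt_expI p)
  convert! h using 1
  ext <;> simp

theorem continuous_polar : Continuous polar := by
  unfold polar; fun_prop

/-- A rotation has determinant one, so the antisymmetric part of `B` has the same value on the
rotated frame. -/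
theorem alternating_exp (B : ℂ →L[ℝ] ℂ →L[ℝ] ℝ) (t : ℝ) :
    B (Complex.exp (t * Complex.I)) (Complex.I * Complex.exp (t * Complex.I)) -
      B (Complex.I * Complex.exp (t * Complex.I)) (Complex.exp (t * Complex.I)) =
    B 1 Complex.I - B Complex.I 1 := by
  have h1 : Complex.exp (t * Complex.I) = (Real.cos t) • (1 : ℂ) + (Real.sin t) • Complex.I := by
    rw [Complex.exp_mul_I]; simp
  have h2 : Complex.I * Complex.exp (t * Complex.I) =
      (-Real.sin t) • (1 : ℂ) + (Real.cos t) • Complex.I := by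
    rw [h1]
    simp only [Complex.real_smul, mul_one, Complex.ofReal_neg]
    linear_combination (Real.sin t : ℂ) * Complex.I_mul_I
  rw [h2, h1]
  simp only [map_add, map_smul, add_apply, smul_apply, smul_eq_mul]
  linear_combination (B 1 Complex.I - B Complex.I 1) * Real.sin_sq_add_cos_sq t

theorem setIntegral_unitDisk_eq {f : ℂ → ℝ} (hf : ContinuousOn f unitDisk) :
    ∫ x in unitDisk, f x =
      ∫ r in (0 : ℝ)..1, ∫ t in (-Real.pi)..Real.pi, r * f (polar (r, t)) := by
  have hc : ContinuousOn (fun p : ℝ × ℝ => p.1 * f (polar p))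
      (Icc 0 1 ×ˢ Icc (-Real.pi) Real.pi) :=
    continuousOn_fst.mul (hf.comp continuous_polar.continuousOn fun p hp => polar_mem hp.1)
  have hi : MeasureTheory.IntegrableOn (fun p : ℝ × ℝ => p.1 * f (polar p))
      (Icc 0 1 ×ˢ Icc (-Real.pi) Real.pi) := hc.integrableOn_compact (isCompact_Icc.prod isCompact_Icc)
  have hpi : -Real.pi ≤ Real.pi := by linarith [Real.pi_pos]
  rw [← MeasureTheory.integral_indicator Metric.isClosed_closedBall.measurableSet,
    ← Complex.integral_comp_polarCoord_symm]
  have h1 : ∀ p ∈ polarCoord.target, p.1 • unitDisk.indicator f (Complex.polarCoord.symm p) =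
      ({p : ℝ × ℝ | p.1 ≤ 1}).indicator (fun p => p.1 * f (polar p)) p := by
    intro p hp
    have h0 : 0 < p.1 := hp.1
    have h2 : Complex.polarCoord.symm p = polar p := by
      rw [Complex.polarCoord_symm_apply, polar, Complex.exp_mul_I]; simp [mul_add]
    have h3 : polar p ∈ unitDisk ↔ p.1 ≤ 1 := by
      simp [polar, Complex.norm_exp_ofReal_mul_I, abs_of_pos h0]
    rw [h2]
    by_cases h : p.1 ≤ 1
    · rw [indicator_of_mem (h3.2 h), indicator_of_mem (show p ∈ {p : ℝ × ℝ | p.1 ≤ 1} from h),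
        smul_eq_mul]
    · rw [indicator_of_notMem (fun h' => h (h3.1 h')),
        indicator_of_notMem (show p ∉ {p : ℝ × ℝ | p.1 ≤ 1} from h), smul_zero]
  rw [MeasureTheory.setIntegral_congr_fun polarCoord.open_target.measurableSet h1,
    MeasureTheory.setIntegral_indicator (measurableSet_le measurable_fst measurable_const)]
  have h4 : polarCoord.target ∩ {p : ℝ × ℝ | p.1 ≤ 1} = Ioc 0 1 ×ˢ Ioo (-Real.pi) Real.pi := by
    ext p
    simp only [polarCoord, mem_inter_iff, mem_prod, mem_Ioi, mem_ofPred_eq, mem_Ioc]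
    tauto
  rw [h4, MeasureTheory.Measure.volume_eq_prod, MeasureTheory.setIntegral_prod,
    intervalIntegral.integral_of_le zero_le_one]
  · simp_rw [intervalIntegral.integral_of_le hpi, MeasureTheory.integral_Ioc_eq_integral_Ioo]
  · exact hi.mono_set (prod_mono Ioc_subset_Icc_self Ioo_subset_Icc_self)

/-- **Stokes' theorem** on the unit disk. -/
theorem integral_curl_unitDisk {η : ℂ → ℂ →L[ℝ] ℝ} (h : ContDiffOn ℝ ∞ η unitDisk) :
    ∫ x in unitDisk, curl unitDisk η x = ∫ t in (0 : ℝ)..1, η (circ t) (circVel t) := by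
  have hpi : -Real.pi ≤ Real.pi := by linarith [Real.pi_pos]
  have hcurl := continuousOn_curl uniqueDiffOn_unitDisk h
  set e : ℝ × ℝ → ℂ := fun p => Complex.exp (p.2 * Complex.I) with he
  have hec : Continuous e := by simp only [he]; fun_prop
  set D := fun p => fderivWithin ℝ η unitDisk (polar p) with hD
  have hpm : ∀ p ∈ uIcc (0 : ℝ) 1 ×ˢ uIcc (-Real.pi) Real.pi, polar p ∈ unitDisk := fun p hp =>
    polar_mem (by simpa using hp.1)
  have hη : ∀ p ∈ Ioo (min (0 : ℝ) 1) (max 0 1) ×ˢ Ioo (min (-Real.pi) Real.pi) (max (-Real.pi) Real.pi),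
      HasFDerivAt (fun p => η (polar p)) ((D p).comp
        ((ContinuousLinearMap.fst ℝ ℝ ℝ).smulRight (e p) +
          (ContinuousLinearMap.snd ℝ ℝ ℝ).smulRight (p.1 • (Complex.I * e p)))) p := by
    intro p hp
    have hp1 : 0 < p.1 ∧ p.1 < 1 := by simpa using hp.1
    have hn : unitDisk ∈ 𝓝 (polar p) := by
      refine Metric.closedBall_mem_nhds_of_mem ?_
      simp [polar, Complex.norm_exp_ofReal_mul_I, abs_of_pos hp1.1, hp1.2]
    have h1 : HasFDerivAt η (D p) (polar p) :=
      ((h.differentiableOn (by simp) _ (polar_mem ⟨hp1.1.le, hp1.2.le⟩)).hasFDerivWithinAt).hasFDerivAt hn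
    exact h1.comp p (hasFDerivAt_polar p)
  have hηc : ContinuousOn (fun p => η (polar p)) (uIcc (0 : ℝ) 1 ×ˢ uIcc (-Real.pi) Real.pi) :=
    h.continuousOn.comp continuous_polar.continuousOn hpm
  -- In polar coordinates `f'` is the derivative of the angular component of `η` and `g'` that of
  -- minus the radial component. The resulting divergence is `r` times the curl, because the terms
  -- without derivatives of `η` cancel.
  set f' : ℝ × ℝ → ℝ × ℝ →L[ℝ] ℝ := fun p =>
    (η (polar p)).comp ((ContinuousLinearMap.fst ℝ ℝ ℝ).smulRight (Complex.I * e p) +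
          (ContinuousLinearMap.snd ℝ ℝ ℝ).smulRight (p.1 • (Complex.I * (Complex.I * e p)))) +
        ((D p).comp ((ContinuousLinearMap.fst ℝ ℝ ℝ).smulRight (e p) +
          (ContinuousLinearMap.snd ℝ ℝ ℝ).smulRight (p.1 • (Complex.I * e p)))).flip
            (p.1 • (Complex.I * e p)) with hf'
  set g' : ℝ × ℝ → ℝ × ℝ →L[ℝ] ℝ := fun p =>
    -((η (polar p)).comp ((ContinuousLinearMap.snd ℝ ℝ ℝ).smulRight (Complex.I * e p)) +
        ((D p).comp ((ContinuousLinearMap.fst ℝ ℝ ℝ).smulRight (e p) +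
          (ContinuousLinearMap.snd ℝ ℝ ℝ).smulRight (p.1 • (Complex.I * e p)))).flip (e p)) with hg'
  have hval : ∀ p : ℝ × ℝ, f' p (1, 0) + g' p (0, 1) = p.1 * curl unitDisk η (polar p) := by
    intro p
    have := alternating_exp (D p) p.2
    rw [curl, ← this]
    simp [hf', hg', -Complex.real_smul]
    ring
  have hu : ∀ p : ℝ × ℝ, HasFDerivAt (fun p : ℝ × ℝ => p.1 • (Complex.I * e p))
      ((ContinuousLinearMap.fst ℝ ℝ ℝ).smulRight (Complex.I * e p) +
          (ContinuousLinearMap.snd ℝ ℝ ℝ).smulRight (p.1 • (Complex.I * (Complex.I * e p)))) p := by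
    intro p
    have := (hasFDerivAt_fst (𝕜 := ℝ) (p := p)).smul ((hasFDerivAt_expI p).const_mul Complex.I)
    convert! this using 1
    ext <;> simp [he]
  have key := MeasureTheory.integral2_divergence_prod_of_hasFDerivAt
    (fun p => η (polar p) (p.1 • (Complex.I * e p))) (fun p => -(η (polar p) (e p)))
    f' g' 0 (-Real.pi) 1 Real.pi
    (hηc.clm_apply (Continuous.continuousOn (by fun_prop)))
    (hηc.clm_apply hec.continuousOn).neg
    (fun p hp => (hη p hp).clm_apply (hu p))
    (fun p hp => ((hη p hp).clm_apply (hasFDerivAt_expI p)).neg) (by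
      simp_rw [hval]
      exact ((continuousOn_fst.mul (hcurl.comp continuous_polar.continuousOn hpm)).integrableOn_compact
        (isCompact_uIcc.prod isCompact_uIcc)))
  rw [setIntegral_unitDisk_eq hcurl]
  simp_rw [hval] at key
  rw [key]
  -- The two sides at angles `π` and `-π` cancel, and the side `r = 0` vanishes because the angular
  -- vector has the factor `r`. Only the boundary circle remains.
  have h1 : ∀ x : ℝ, polar (x, Real.pi) = polar (x, -Real.pi) := by
    intro x
    simp only [polar, Complex.ofReal_neg]
    congr 1
    rw [neg_mul, Complex.exp_neg, Complex.exp_pi_mul_I]; norm_num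
  have h2 : ∀ x : ℝ, e (x, Real.pi) = e (x, -Real.pi) := by
    intro x
    simp only [he, Complex.ofReal_neg]
    rw [neg_mul, Complex.exp_neg, Complex.exp_pi_mul_I]; norm_num
  simp_rw [h1, h2]
  simp only [sub_self, zero_add, zero_smul, map_zero, intervalIntegral.integral_zero, sub_zero,
    one_smul]
  have hper : Function.Periodic (fun t : ℝ => η (circ t) (circVel t)) 1 := fun t => by
    simp only [circ_add_one, circVel_add_one]
  -- Shifting the period to `[-1/2, 1/2]` matches the range `[-π, π]` of the polar angle.
  have h3 : ∫ t in (0 : ℝ)..1, η (circ t) (circVel t) =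
      ∫ t in (-(1 / 2) : ℝ)..(1 / 2), η (circ t) (circVel t) := by
    have := hper.intervalIntegral_add_eq 0 (-(1 / 2))
    norm_num at this ⊢
    exact this
  have h4 : ∀ t : ℝ, η (circ t) (circVel t) =
      (2 * Real.pi) * η (polar (1, 2 * Real.pi * t)) (Complex.I * e (1, 2 * Real.pi * t)) := by
    intro t
    have h5 : circVel t = (2 * Real.pi) • (Complex.I * e (1, 2 * Real.pi * t)) := by
      rw [circVel, circ_eq, he]; simp [mul_assoc]
    have h6 : circ t = polar (1, 2 * Real.pi * t) := by
      rw [circ_eq, polar]; simp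
    rw [h5, map_smul, h6, smul_eq_mul]
  rw [h3]
  simp_rw [h4]
  rw [intervalIntegral.integral_const_mul, ← smul_eq_mul,
    intervalIntegral.smul_integral_comp_mul_left
      (fun t => η (polar (1, t)) (Complex.I * e (1, t))) (2 * Real.pi)]
  congr 1 <;> ring

end

noncomputable section

variable {EQ EY EP : Type*}
  [NormedAddCommGroup EQ] [NormedSpace ℝ EQ] [NormedAddCommGroup EY] [NormedSpace ℝ EY]
  [NormedAddCommGroup EP] [NormedSpace ℝ EP]
  {Q Y P : Type*} [TopologicalSpace Q] [ChartedSpace EQ Q]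
  [TopologicalSpace Y] [ChartedSpace EY Y] [IsManifold 𝓘(ℝ, EY) ∞ Y]
  [TopologicalSpace P] [ChartedSpace EP P] [IsManifold 𝓘(ℝ, EP) ∞ P] [MulAction Circle P]
  {V : Type*} [NormedAddCommGroup V] [NormedSpace ℝ V]

/-! ### Cocycles with values in the groupoid of unit vectors -/

/-- Local lifts to `Y` of a map `u : V → Q` on a set `S`, with a cocycle of unit vectors between
them. -/
structure LiftCocycle (G : BundleGerbe (EQ := EQ) (EY := EY) (EP := EP) Q Y P) (S : Set V)
    (u : V → Q) where
  ι : Type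
  U : ι → Set V
  isOpen_U : ∀ k, IsOpen (U k)
  cover : ∀ x ∈ S, ∃ k, x ∈ U k
  lift : ι → V → Y
  smooth_lift : ∀ k, ContMDiffOn 𝓘(ℝ, V) 𝓘(ℝ, EY) ∞ (lift k) (S ∩ U k)
  proj_lift : ∀ k, ∀ x ∈ S ∩ U k, G.proj (lift k x) = u x
  trans : ι → ι → V → P
  smooth_trans : ∀ k l, ContMDiffOn 𝓘(ℝ, V) 𝓘(ℝ, EP) ∞ (trans k l) (S ∩ (U k ∩ U l))
  tgt_trans : ∀ k l, ∀ x ∈ S ∩ (U k ∩ U l), G.tgt (trans k l x) = lift k x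
  src_trans : ∀ k l, ∀ x ∈ S ∩ (U k ∩ U l), G.src (trans k l x) = lift l x
  mul_trans : ∀ k l m, ∀ x ∈ S, x ∈ U k → x ∈ U l → x ∈ U m →
    G.mul (trans k l x) (trans l m x) = trans k m x

namespace LiftCocycle

variable {G : BundleGerbe (EQ := EQ) (EY := EY) (EP := EP) Q Y P} {S S₁ S₂ S₃ : Set V} {u : V → Q}

/-- An isomorphism between cocycles on a set. -/
structure IsIso (c : LiftCocycle G S₁ u) (c' : LiftCocycle G S₂ u) (S : Set V)
    (q : c.ι → c'.ι → V → P) : Prop where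
  smooth : ∀ k l, ContMDiffOn 𝓘(ℝ, V) 𝓘(ℝ, EP) ∞ (q k l) (S ∩ (c.U k ∩ c'.U l))
  tgt : ∀ k l, ∀ x ∈ S ∩ (c.U k ∩ c'.U l), G.tgt (q k l x) = c.lift k x
  src : ∀ k l, ∀ x ∈ S ∩ (c.U k ∩ c'.U l), G.src (q k l x) = c'.lift l x
  left : ∀ k k' l, ∀ x ∈ S, x ∈ c.U k → x ∈ c.U k' → x ∈ c'.U l →
    G.mul (c.trans k k' x) (q k' l x) = q k l x
  right : ∀ k l l', ∀ x ∈ S, x ∈ c.U k → x ∈ c'.U l → x ∈ c'.U l' →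
    G.mul (q k l x) (c'.trans l l' x) = q k l' x

theorem IsIso.mono {c : LiftCocycle G S₁ u} {c' : LiftCocycle G S₂ u} {q : c.ι → c'.ι → V → P}
    (h : IsIso c c' S q) {S' : Set V} (hS : S' ⊆ S) : IsIso c c' S' q where
  smooth k l := (h.smooth k l).mono (inter_subset_inter_left _ hS)
  tgt k l x hx := h.tgt k l x ⟨hS hx.1, hx.2⟩
  src k l x hx := h.src k l x ⟨hS hx.1, hx.2⟩
  left k k' l x hx := h.left k k' l x (hS hx)
  right k l l' x hx := h.right k l l' x (hS hx)

theorem IsIso.smul {c : LiftCocycle G S₁ u} {c' : LiftCocycle G S₂ u} {q : c.ι → c'.ι → V → P}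
    (h₁ : S ⊆ S₁) (h₂ : S ⊆ S₂)
    (h : IsIso c c' S q) {z : V → Circle} (hz : ContMDiffOn 𝓘(ℝ, V) (𝓡 1) ∞ z S) :
    IsIso c c' S (fun k l x => z x • q k l x) where
  smooth k l := G.contMDiffOn_smul (hz.mono inter_subset_left) (h.smooth k l)
  tgt k l x hx := by rw [G.tgt_smul, h.tgt k l x hx]
  src k l x hx := by rw [G.src_smul, h.src k l x hx]
  left k k' l x hx hk hk' hl := by
    rw [G.mul_smul, h.left k k' l x hx hk hk' hl]
    rw [c.src_trans k k' x ⟨h₁ hx, hk, hk'⟩, h.tgt k' l x ⟨hx, hk', hl⟩]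
  right k l l' x hx hk hl hl' := by
    rw [G.smul_mul, h.right k l l' x hx hk hl hl']
    rw [c'.tgt_trans l l' x ⟨h₂ hx, hl, hl'⟩, h.src k l x ⟨hx, hk, hl⟩]

/-- Fix one chart of each cocycle at the point and a smooth unit vector `v` between the two lifts.
Compatibility then forces the value for every other pair of charts: the transition to the fixed
chart, then `v`, then the transition of the second cocycle. -/
theorem exists_isIso_nhds (c : LiftCocycle G S₁ u) (c' : LiftCocycle G S₂ u)
    (h₁ : S ⊆ S₁) (h₂ : S ⊆ S₂) {x : V} (hx : x ∈ S) :
    ∃ N : Set V, IsOpen N ∧ x ∈ N ∧ ∃ q, IsIso c c' (S ∩ N) q := by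
  obtain ⟨k₀, hk₀⟩ := c.cover x (h₁ hx)
  obtain ⟨l₀, hl₀⟩ := c'.cover x (h₂ hx)
  obtain ⟨N, hN, hxN, v, hv, hv'⟩ := G.exists_local_section
    (S := S ∩ (c.U k₀ ∩ c'.U l₀)) (a := c.lift k₀) (b := c'.lift l₀)
    ((c.smooth_lift k₀).mono fun y hy => ⟨h₁ hy.1, hy.2.1⟩)
    ((c'.smooth_lift l₀).mono fun y hy => ⟨h₂ hy.1, hy.2.2⟩)
    (fun y hy => by rw [c.proj_lift k₀ y ⟨h₁ hy.1, hy.2.1⟩, c'.proj_lift l₀ y ⟨h₂ hy.1, hy.2.2⟩])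
    ⟨hx, hk₀, hl₀⟩
  refine ⟨(c.U k₀ ∩ c'.U l₀) ∩ N, ((c.isOpen_U _).inter (c'.isOpen_U _)).inter hN,
    ⟨⟨hk₀, hl₀⟩, hxN⟩,
    fun k l y => G.mul (G.mul (c.trans k k₀ y) (v y)) (c'.trans l₀ l y), ?_⟩
  have hvt : ∀ y ∈ S ∩ ((c.U k₀ ∩ c'.U l₀) ∩ N), G.tgt (v y) = c.lift k₀ y := fun y hy =>
    (hv' y ⟨⟨hy.1, hy.2.1⟩, hy.2.2⟩).1
  have hvs : ∀ y ∈ S ∩ ((c.U k₀ ∩ c'.U l₀) ∩ N), G.src (v y) = c'.lift l₀ y := fun y hy =>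
    (hv' y ⟨⟨hy.1, hy.2.1⟩, hy.2.2⟩).2
  have e1 : ∀ k, ∀ y ∈ S ∩ ((c.U k₀ ∩ c'.U l₀) ∩ N), y ∈ c.U k →
      G.src (c.trans k k₀ y) = G.tgt (v y) := fun k y hy hk => by
    rw [hvt y hy, c.src_trans k k₀ y ⟨h₁ hy.1, hk, hy.2.1.1⟩]
  have e2 : ∀ l, ∀ y ∈ S ∩ ((c.U k₀ ∩ c'.U l₀) ∩ N), y ∈ c'.U l →
      G.src (v y) = G.tgt (c'.trans l₀ l y) := fun l y hy hl => by
    rw [hvs y hy, c'.tgt_trans l₀ l y ⟨h₂ hy.1, hy.2.1.2, hl⟩]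
  have e3 : ∀ k l, ∀ y ∈ S ∩ ((c.U k₀ ∩ c'.U l₀) ∩ N), y ∈ c.U k → y ∈ c'.U l →
      G.src (G.mul (c.trans k k₀ y) (v y)) = G.tgt (c'.trans l₀ l y) := fun k l y hy hk hl => by
    rw [G.src_mul _ _ (e1 k y hy hk), e2 l y hy hl]
  constructor
  · intro k l
    refine G.contMDiffOn_mul (G.contMDiffOn_mul ?_ ?_ ?_) ?_ ?_
    · exact (c.smooth_trans k k₀).mono fun y hy => ⟨h₁ hy.1.1, hy.2.1, hy.1.2.1.1⟩
    · exact hv.mono fun y hy => ⟨⟨hy.1.1, hy.1.2.1⟩, hy.1.2.2⟩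
    · exact fun y hy => e1 k y hy.1 hy.2.1
    · exact (c'.smooth_trans l₀ l).mono fun y hy => ⟨h₂ hy.1.1, hy.1.2.1.2, hy.2.2⟩
    · exact fun y hy => e3 k l y hy.1 hy.2.1 hy.2.2
  · rintro k l y ⟨hy, hk, hl⟩
    rw [G.tgt_mul _ _ (e3 k l y hy hk hl), G.tgt_mul _ _ (e1 k y hy hk),
      c.tgt_trans k k₀ y ⟨h₁ hy.1, hk, hy.2.1.1⟩]
  · rintro k l y ⟨hy, hk, hl⟩
    rw [G.src_mul _ _ (e3 k l y hy hk hl), c'.src_trans l₀ l y ⟨h₂ hy.1, hy.2.1.2, hl⟩]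
  · intro k k' l y hy hk hk' hl
    have e4 : G.src (c.trans k k' y) = G.tgt (c.trans k' k₀ y) := by
      rw [c.src_trans k k' y ⟨h₁ hy.1, hk, hk'⟩, c.tgt_trans k' k₀ y ⟨h₁ hy.1, hk', hy.2.1.1⟩]
    have e5 : G.src (c.trans k k' y) = G.tgt (G.mul (c.trans k' k₀ y) (v y)) := by
      rw [e4, G.tgt_mul _ _ (e1 k' y hy hk')]
    rw [← G.mul_assoc _ _ _ e5 (e3 k' l y hy hk' hl), ← G.mul_assoc _ _ _ e4 (e1 k' y hy hk'),
      c.mul_trans k k' k₀ y (h₁ hy.1) hk hk' hy.2.1.1]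
  · intro k l l' y hy hk hl hl'
    have e4 : G.src (c'.trans l₀ l y) = G.tgt (c'.trans l l' y) := by
      rw [c'.src_trans l₀ l y ⟨h₂ hy.1, hy.2.1.2, hl⟩, c'.tgt_trans l l' y ⟨h₂ hy.1, hl, hl'⟩]
    rw [G.mul_assoc _ _ _ (e3 k l y hy hk hl) e4, c'.mul_trans l₀ l l' y (h₂ hy.1) hy.2.1.2 hl hl']

/-- Scalars commute with the product, so the ratio found in one pair of charts is the ratio in all
of them. -/
theorem IsIso.exists_ratio {c : LiftCocycle G S₁ u} {c' : LiftCocycle G S₂ u}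
    {q q' : c.ι → c'.ι → V → P} (h₁ : S ⊆ S₁) (h₂ : S ⊆ S₂) (h : IsIso c c' S q)
    (h' : IsIso c c' S q') : ∃ z : V → Circle, ContMDiffOn 𝓘(ℝ, V) (𝓡 1) ∞ z S ∧
      ∀ k l, ∀ x ∈ S ∩ (c.U k ∩ c'.U l), z x • q k l x = q' k l x := by
  have key : ∀ x, ∃ z : Circle, ∀ k l, x ∈ S ∩ (c.U k ∩ c'.U l) → z • q k l x = q' k l x := by
    intro x
    by_cases hx : x ∈ S
    · obtain ⟨k₀, hk₀⟩ := c.cover x (h₁ hx)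
      obtain ⟨l₀, hl₀⟩ := c'.cover x (h₂ hx)
      have hx₀ : x ∈ S ∩ (c.U k₀ ∩ c'.U l₀) := ⟨hx, hk₀, hl₀⟩
      obtain ⟨z, hz⟩ := G.exists_smul_eq (p := q k₀ l₀ x) (q := q' k₀ l₀ x)
        (by rw [h.tgt _ _ x hx₀, h'.tgt _ _ x hx₀]) (by rw [h.src _ _ x hx₀, h'.src _ _ x hx₀])
      refine ⟨z, fun k l hkl => ?_⟩
      have e1 : G.src (c.trans k k₀ x) = G.tgt (q k₀ l₀ x) := by
        rw [c.src_trans k k₀ x ⟨h₁ hx, hkl.2.1, hk₀⟩, h.tgt _ _ x hx₀]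
      have e2 : G.src (q k l₀ x) = G.tgt (c'.trans l₀ l x) := by
        rw [c'.tgt_trans l₀ l x ⟨h₂ hx, hl₀, hkl.2.2⟩, h.src k l₀ x ⟨hx, hkl.2.1, hl₀⟩]
      rw [← h.right k l₀ l x hx hkl.2.1 hl₀ hkl.2.2, ← h'.right k l₀ l x hx hkl.2.1 hl₀ hkl.2.2,
        ← G.smul_mul _ _ _ e2, ← h.left k k₀ l₀ x hx hkl.2.1 hk₀ hl₀,
        ← h'.left k k₀ l₀ x hx hkl.2.1 hk₀ hl₀, ← G.mul_smul _ _ _ e1, hz]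
    · exact ⟨1, fun k l hkl => absurd hkl.1 hx⟩
  choose z hz using key
  refine ⟨z, contMDiffOn_of_locally_contMDiffOn fun x hx => ?_, fun k l x => hz x k l⟩
  obtain ⟨k, hk⟩ := c.cover x (h₁ hx)
  obtain ⟨l, hl⟩ := c'.cover x (h₂ hx)
  obtain ⟨w, hw, hwq⟩ := G.exists_ratio (h.smooth k l) (h'.smooth k l)
    (fun y hy => by rw [h.tgt k l y hy, h'.tgt k l y hy])
    (fun y hy => by rw [h.src k l y hy, h'.src k l y hy])
  exact ⟨c.U k ∩ c'.U l, (c.isOpen_U k).inter (c'.isOpen_U l), ⟨hk, hl⟩,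
    hw.congr fun y hy => G.smul_left_inj (p := q k l y) (by rw [hz y k l hy, hwq y hy])⟩

theorem IsIso.union {c : LiftCocycle G S₁ u} {c' : LiftCocycle G S₂ u}
    {q q' : c.ι → c'.ι → V → P} {O O' : Set V} (hO : IsOpen O) (hO' : IsOpen O')
    (hS : S ⊆ O ∪ O') (h : IsIso c c' (S ∩ O) q) (h' : IsIso c c' (S ∩ O') q')
    (heq : ∀ k l, ∀ x ∈ S ∩ (c.U k ∩ c'.U l), x ∈ O → x ∈ O' → q k l x = q' k l x) :
    ∃ q'', IsIso c c' S q'' := by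
  classical
  refine ⟨fun k l x => if x ∈ O then q k l x else q' k l x, ?_⟩
  have e : ∀ k l, ∀ x ∈ S ∩ (c.U k ∩ c'.U l), x ∈ O' →
      (if x ∈ O then q k l x else q' k l x) = q' k l x := fun k l x hx hxO' => by
    split_ifs with hxO
    · exact heq k l x hx hxO hxO'
    · rfl
  have hS' : ∀ x ∈ S, x ∉ O → x ∈ O' := fun x hx hxO => (hS hx).resolve_left hxO
  constructor
  · refine fun k l => contMDiffOn_of_locally_contMDiffOn fun x hx => ?_
    rcases hS hx.1 with hxO | hxO
    · exact ⟨O, hO, hxO, ((h.smooth k l).mono fun y hy => ⟨⟨hy.1.1, hy.2⟩, hy.1.2⟩).congr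
        fun y hy => if_pos hy.2⟩
    · exact ⟨O', hO', hxO, ((h'.smooth k l).mono fun y hy => ⟨⟨hy.1.1, hy.2⟩, hy.1.2⟩).congr
        fun y hy => e k l y hy.1 hy.2⟩
  · intro k l x hx
    split_ifs with hxO
    · exact h.tgt k l x ⟨⟨hx.1, hxO⟩, hx.2⟩
    · exact h'.tgt k l x ⟨⟨hx.1, hS' x hx.1 hxO⟩, hx.2⟩
  · intro k l x hx
    split_ifs with hxO
    · exact h.src k l x ⟨⟨hx.1, hxO⟩, hx.2⟩
    · exact h'.src k l x ⟨⟨hx.1, hS' x hx.1 hxO⟩, hx.2⟩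
  · intro k k' l x hx
    split_ifs with hxO
    · exact h.left k k' l x ⟨hx, hxO⟩
    · exact h'.left k k' l x ⟨hx, hS' x hx hxO⟩
  · intro k l l' x hx
    split_ifs with hxO
    · exact h.right k l l' x ⟨hx, hxO⟩
    · exact h'.right k l l' x ⟨hx, hS' x hx hxO⟩

end LiftCocycle

/-- A smooth function on a slab of `S` is a difference of smooth functions on two halves of `S`. -/
theorem exists_sub_eq_of_slab {S : Set V} (l : V →L[ℝ] ℝ) {a b : ℝ} (hab : a < b) {θ : V → ℝ}
    (hθ : ContDiffOn ℝ ∞ θ (S ∩ ({x | l x < b} ∩ {x | a < l x}))) :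
    ∃ θ₁ θ₂ : V → ℝ, ContDiffOn ℝ ∞ θ₁ (S ∩ {x | l x < b}) ∧
      ContDiffOn ℝ ∞ θ₂ (S ∩ {x | a < l x}) ∧
      ∀ x, l x < b → a < l x → θ x = θ₁ x - θ₂ x := by
  set ρ : V → ℝ := fun x => Real.smoothTransition (3 * ((l x - a) / (b - a)) - 1) with hρ
  have hba : 0 < b - a := sub_pos.2 hab
  have hρs : ContDiff ℝ ∞ ρ := Real.smoothTransition.contDiff.comp
    ((contDiff_const.mul ((l.contDiff.sub contDiff_const).div_const _)).sub contDiff_const)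
  have hρ0 : ∀ x, l x < a + (b - a) / 3 → ρ x = 0 := fun x hx => by
    refine Real.smoothTransition.zero_of_nonpos ?_
    have : (l x - a) / (b - a) ≤ 1 / 3 := by rw [div_le_iff₀ hba]; linarith
    linarith
  have hρ1 : ∀ x, b - (b - a) / 3 < l x → ρ x = 1 := fun x hx => by
    refine Real.smoothTransition.one_of_one_le ?_
    have : 2 / 3 ≤ (l x - a) / (b - a) := by rw [le_div_iff₀ hba]; linarith
    linarith
  have hb : IsOpen {x | l x < b} := isOpen_lt l.continuous continuous_const
  have ha : IsOpen {x | a < l x} := isOpen_lt continuous_const l.continuous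
  -- The cutoff `ρ` vanishes on the first third of the slab and is `1` on the last. So `ρ θ` extends
  -- by zero below the slab, `(ρ - 1) θ` extends by zero above it, and the difference of the two is
  -- `θ`.
  refine ⟨fun x => if a < l x then ρ x * θ x else 0,
    fun x => if l x < b then (ρ x - 1) * θ x else 0, ?_, ?_, ?_⟩
  · refine contDiffOn_of_locally_contDiffOn fun x hx => ?_
    rcases lt_or_ge a (l x) with h | h
    · refine ⟨_, ha, h, ((hρs.contDiffOn.mul hθ).mono ?_).congr fun y hy => if_pos hy.2⟩
      exact fun y hy => ⟨hy.1.1, hy.1.2, hy.2⟩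
    · refine ⟨_, isOpen_lt l.continuous (continuous_const (y := a + (b - a) / 3)), ?_,
        (contDiffOn_const (c := 0)).congr fun y hy => ?_⟩
      · exact h.trans_lt (by linarith)
      · rw [hρ0 y hy.2]; simp
  · refine contDiffOn_of_locally_contDiffOn fun x hx => ?_
    rcases lt_or_ge (l x) b with h | h
    · refine ⟨_, hb, h, (((hρs.sub contDiff_const).contDiffOn.mul hθ).mono ?_).congr
        fun y hy => if_pos hy.2⟩
      exact fun y hy => ⟨hy.1.1, hy.2, hy.1.2⟩
    · refine ⟨_, isOpen_lt (continuous_const (y := b - (b - a) / 3)) l.continuous, ?_,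
        (contDiffOn_const (c := 0)).congr fun y hy => ?_⟩
      · exact lt_of_lt_of_le (by linarith) h
      · rw [hρ1 y hy.2]; simp
  · intro x h1 h2
    simp only [h1, h2, if_true]
    ring

namespace LiftCocycle

variable {G : BundleGerbe (EQ := EQ) (EY := EY) (EP := EP) Q Y P} {S S₁ S₂ S₃ : Set V} {u : V → Q}

/-- On the convex slab the two isomorphisms differ by `exp (i θ)`. Writing `θ = θ₁ - θ₂` and
correcting the first by `exp (i θ₁)` and the second by `exp (i θ₂)` makes them agree. This is the
vanishing of the first cohomology of smooth circle-valued functions for such a cover. -/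
theorem exists_isIso_glue (c : LiftCocycle G S₁ u) (c' : LiftCocycle G S₂ u)
    (h₁ : S ⊆ S₁) (h₂ : S ⊆ S₂) (hS : Convex ℝ S) (l : V →L[ℝ] ℝ) {a b : ℝ} (hab : a < b)
    (h : ∃ q, IsIso c c' (S ∩ {x | l x < b}) q) (h' : ∃ q, IsIso c c' (S ∩ {x | a < l x}) q) :
    ∃ q, IsIso c c' S q := by
  obtain ⟨q, hq⟩ := h
  obtain ⟨q', hq'⟩ := h'
  have hb : IsOpen {x | l x < b} := isOpen_lt l.continuous continuous_const
  have ha : IsOpen {x | a < l x} := isOpen_lt continuous_const l.continuous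
  have hconv : Convex ℝ (S ∩ ({x | l x < b} ∩ {x | a < l x})) :=
    hS.inter ((convex_halfSpace_lt l.toLinearMap.isLinear b).inter
      (convex_halfSpace_gt l.toLinearMap.isLinear a))
  obtain ⟨z, hz, hzq⟩ := IsIso.exists_ratio (S := S ∩ ({x | l x < b} ∩ {x | a < l x}))
    (fun x hx => h₁ hx.1) (fun x hx => h₂ hx.1)
    (hq.mono fun x hx => ⟨hx.1, hx.2.1⟩) (hq'.mono fun x hx => ⟨hx.1, hx.2.2⟩)
  obtain ⟨θ, hθ, hθz⟩ := exists_log hconv hz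
  obtain ⟨θ₁, θ₂, hθ₁, hθ₂, hθeq⟩ := exists_sub_eq_of_slab l hab hθ
  refine IsIso.union hb ha (fun x _ => ?_)
    (hq.smul (fun x hx => h₁ hx.1) (fun x hx => h₂ hx.1)
      (contMDiff_circleExp.comp_contMDiffOn hθ₁.contMDiffOn))
    (hq'.smul (fun x hx => h₁ hx.1) (fun x hx => h₂ hx.1)
      (contMDiff_circleExp.comp_contMDiffOn hθ₂.contMDiffOn)) fun k m x hx hxb hxa => ?_
  · rcases lt_or_ge (l x) b with h | h
    · exact Or.inl h
    · exact Or.inr (hab.trans_le h)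
  · simp only [Function.comp_apply]
    rw [← hzq k m x ⟨⟨hx.1, hxb, hxa⟩, hx.2⟩, ← hθz x ⟨hx.1, hxb, hxa⟩, smul_smul, ← Circle.exp_add,
      hθeq x hxb hxa]
    congr 2; ring

end LiftCocycle

end

/-! ### Isomorphism and existence of cocycles over intervals and over the disk -/

noncomputable section

/-- In suitable charts a submersion is a projection from a product. The section freezes the
complementary coordinate at its value at `y`. -/
theorem exists_local_section_of_submersion {EY EQ : Type*} [NormedAddCommGroup EY]
    [NormedSpace ℝ EY] [NormedAddCommGroup EQ] [NormedSpace ℝ EQ] {Y Q : Type*}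
    [TopologicalSpace Y] [ChartedSpace EY Y] [TopologicalSpace Q] [ChartedSpace EQ Q]
    [IsManifold 𝓘(ℝ, EY) ∞ Y] [IsManifold 𝓘(ℝ, EQ) ∞ Q]
    {f : Y → Q} (hf : Manifold.IsSubmersion 𝓘(ℝ, EY) 𝓘(ℝ, EQ) ∞ f) (y : Y) :
    ∃ N : Set Q, IsOpen N ∧ f y ∈ N ∧ ∃ s : Q → Y, ContMDiffOn 𝓘(ℝ, EQ) 𝓘(ℝ, EY) ∞ s N ∧
      ∀ x ∈ N, f (s x) = x := by
  obtain ⟨F, _, _, hF⟩ := hf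
  have h := hF y
  set φ := h.domChart
  set ψ := h.codChart
  set e := h.equiv
  have hw : ∀ w ∈ φ.target, ψ (f (φ.symm w)) = (e w).1 := fun w hw => by
    have hw' : w ∈ (φ.extend 𝓘(ℝ, EY)).target := by simpa using hw
    simpa using h.writtenInCharts hw'
  set v := (e (φ y)).2
  have hc : ContMDiffOn 𝓘(ℝ, EQ) 𝓘(ℝ, EY) ∞ (fun x => e.symm (ψ x, v)) ψ.source := by
    have h1 := contMDiffOn_of_mem_maximalAtlas h.codChart_mem_maximalAtlas
    have h2 : ContDiff ℝ ∞ (fun w : EQ => e.symm (w, v)) :=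
      e.symm.contDiff.comp (contDiff_id.prodMk contDiff_const)
    exact h2.contMDiff.comp_contMDiffOn h1
  have hy : e.symm (ψ (f y), v) = φ y := by
    have h1 := hw (φ y) (φ.map_source h.mem_domChart_source)
    rw [φ.left_inv h.mem_domChart_source] at h1
    rw [h1, ContinuousLinearEquiv.symm_apply_eq]
  refine ⟨ψ.source ∩ (fun x => e.symm (ψ x, v)) ⁻¹' φ.target,
    hc.continuousOn.isOpen_inter_preimage ψ.open_source φ.open_target,
    ⟨h.mem_codChart_source, ?_⟩, fun x => φ.symm (e.symm (ψ x, v)), ?_, ?_⟩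
  · rw [mem_preimage, hy]
    exact φ.map_source h.mem_domChart_source
  · exact (contMDiffOn_symm_of_mem_maximalAtlas h.domChart_mem_maximalAtlas).comp
      (hc.mono inter_subset_left) fun x hx => hx.2
  · rintro x ⟨hx, hx'⟩
    refine ψ.injOn (h.mapsto_domChart_source_codChart_source (φ.map_target hx')) hx ?_
    rw [hw _ hx', e.apply_symm_apply]

variable {EQ EY EP : Type*}
  [NormedAddCommGroup EQ] [NormedSpace ℝ EQ] [NormedAddCommGroup EY] [NormedSpace ℝ EY]
  [NormedAddCommGroup EP] [NormedSpace ℝ EP]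
  {Q Y P : Type*} [TopologicalSpace Q] [ChartedSpace EQ Q]
  [TopologicalSpace Y] [ChartedSpace EY Y] [IsManifold 𝓘(ℝ, EY) ∞ Y]
  [TopologicalSpace P] [ChartedSpace EP P] [IsManifold 𝓘(ℝ, EP) ∞ P] [MulAction Circle P]
  {V : Type*} [NormedAddCommGroup V] [NormedSpace ℝ V]

namespace LiftCocycle

variable {G : BundleGerbe (EQ := EQ) (EY := EY) (EP := EP) Q Y P} {S S₁ S₂ S₃ : Set V} {u : V → Q}

theorem exists_isIso_Ioo {S₁ S₂ : Set ℝ} {u : ℝ → Q} (c : LiftCocycle G S₁ u)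
    (c' : LiftCocycle G S₂ u) (h₁ : S₁ = univ) (h₂ : S₂ = univ) (a b : ℝ) :
    ∃ q, IsIso c c' (Ioo a b) q := by
  refine interval_induction (p := fun a b => ∃ q, IsIso c c' (Ioo a b) q)
    (fun a b a' b' ha hb ⟨q, hq⟩ => ⟨q, hq.mono (Ioo_subset_Ioo ha hb)⟩)
    (fun a a' b' b a₀ b₀ ha hab hb ha₀ hb₀ ⟨q, hq⟩ ⟨q', hq'⟩ => ?_) (fun x => ?_) a b
  · obtain ⟨q, hq⟩ := exists_isIso_glue c c' (by simp [h₁]) (by simp [h₂]) (convex_Ioo a b)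
      (ContinuousLinearMap.id ℝ ℝ) hab ⟨q, hq.mono fun x hx => ⟨hx.1.1, hx.2⟩⟩
      ⟨q', hq'.mono fun x hx => ⟨hx.2, hx.1.2⟩⟩
    exact ⟨q, hq.mono (Ioo_subset_Ioo ha₀.le hb₀.le)⟩
  · obtain ⟨N, hN, hxN, q, hq⟩ := exists_isIso_nhds c c' (S := univ) (by simp [h₁]) (by simp [h₂])
      (mem_univ x)
    obtain ⟨ε, hε, hs⟩ := Metric.isOpen_iff.1 hN x hxN
    exact ⟨ε, hε, q, hq.mono fun y hy => ⟨mem_univ _, hs (by rwa [Real.ball_eq_Ioo])⟩⟩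

/-- Two cocycles on overlapping parts of a set, isomorphic on the overlap, glue to a cocycle. -/
theorem exists_glue {O O' : Set V} (hO : IsOpen O) (hO' : IsOpen O') (hS : S ⊆ O ∪ O')
    (c : LiftCocycle G (S ∩ O) u) (c' : LiftCocycle G (S ∩ O') u)
    (h : ∃ q, IsIso c c' (S ∩ (O ∩ O')) q) : Nonempty (LiftCocycle G S u) := by
  obtain ⟨q, hq⟩ := h
  have src_q : ∀ k l, ∀ x ∈ S, x ∈ O → x ∈ O' → x ∈ c.U k → x ∈ c'.U l →
      G.src (q k l x) = c'.lift l x := fun k l x h1 h2 h3 h4 h5 => hq.src k l x ⟨⟨h1, h2, h3⟩, h4, h5⟩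
  have tgt_q : ∀ k l, ∀ x ∈ S, x ∈ O → x ∈ O' → x ∈ c.U k → x ∈ c'.U l →
      G.tgt (q k l x) = c.lift k x := fun k l x h1 h2 h3 h4 h5 => hq.tgt k l x ⟨⟨h1, h2, h3⟩, h4, h5⟩
  refine ⟨{
    ι := c.ι ⊕ c'.ι
    U := Sum.elim (fun k => c.U k ∩ O) (fun l => c'.U l ∩ O')
    isOpen_U := ?_
    cover := ?_
    lift := Sum.elim c.lift c'.lift
    smooth_lift := ?_
    proj_lift := ?_
    trans := fun k l => match k, l with
      | .inl k, .inl l => c.trans k l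
      | .inl k, .inr l => q k l
      | .inr k, .inl l => fun x => G.inv (q l k x)
      | .inr k, .inr l => c'.trans k l
    smooth_trans := ?_
    tgt_trans := ?_
    src_trans := ?_
    mul_trans := ?_ }⟩
  · rintro (k | k)
    · exact (c.isOpen_U k).inter hO
    · exact (c'.isOpen_U k).inter hO'
  · intro x hx
    rcases hS hx with hxO | hxO
    · obtain ⟨k, hk⟩ := c.cover x ⟨hx, hxO⟩
      exact ⟨Sum.inl k, hk, hxO⟩
    · obtain ⟨k, hk⟩ := c'.cover x ⟨hx, hxO⟩
      exact ⟨Sum.inr k, hk, hxO⟩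
  · rintro (k | k)
    · exact (c.smooth_lift k).mono fun x hx => ⟨⟨hx.1, hx.2.2⟩, hx.2.1⟩
    · exact (c'.smooth_lift k).mono fun x hx => ⟨⟨hx.1, hx.2.2⟩, hx.2.1⟩
  · rintro (k | k) x hx
    · exact c.proj_lift k x ⟨⟨hx.1, hx.2.2⟩, hx.2.1⟩
    · exact c'.proj_lift k x ⟨⟨hx.1, hx.2.2⟩, hx.2.1⟩
  · rintro (k | k) (l | l)
    · exact (c.smooth_trans k l).mono fun x hx => ⟨⟨hx.1, hx.2.1.2⟩, hx.2.1.1, hx.2.2.1⟩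
    · exact (hq.smooth k l).mono fun x hx => ⟨⟨hx.1, hx.2.1.2, hx.2.2.2⟩, hx.2.1.1, hx.2.2.1⟩
    · exact G.contMDiffOn_inv ((hq.smooth l k).mono
        fun x hx => ⟨⟨hx.1, hx.2.2.2, hx.2.1.2⟩, hx.2.2.1, hx.2.1.1⟩)
    · exact (c'.smooth_trans k l).mono fun x hx => ⟨⟨hx.1, hx.2.1.2⟩, hx.2.1.1, hx.2.2.1⟩
  · rintro (k | k) (l | l) x ⟨hx, ⟨hk, hkO⟩, hl, hlO⟩
    · exact c.tgt_trans k l x ⟨⟨hx, hkO⟩, hk, hl⟩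
    · exact tgt_q k l x hx hkO hlO hk hl
    · exact (G.tgt_inv _).trans (src_q l k x hx hlO hkO hl hk)
    · exact c'.tgt_trans k l x ⟨⟨hx, hkO⟩, hk, hl⟩
  · rintro (k | k) (l | l) x ⟨hx, ⟨hk, hkO⟩, hl, hlO⟩
    · exact c.src_trans k l x ⟨⟨hx, hkO⟩, hk, hl⟩
    · exact src_q k l x hx hkO hlO hk hl
    · exact (G.src_inv _).trans (tgt_q l k x hx hlO hkO hl hk)
    · exact c'.src_trans k l x ⟨⟨hx, hkO⟩, hk, hl⟩
  -- Of the eight cases, those without inverses are the cocycle identities and the two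
  -- compatibilities of `q`. The others follow from these by cancelling a factor `q`.
  · rintro (k | k) (l | l) (m | m) x hx ⟨hk, hkO⟩ ⟨hl, hlO⟩ ⟨hm, hmO⟩
    · exact c.mul_trans k l m x ⟨hx, hkO⟩ hk hl hm
    · exact hq.left k l m x ⟨hx, hkO, hmO⟩ hk hl hm
    · have e := hq.left k m l x ⟨hx, hkO, hlO⟩ hk hm hl
      change G.mul (q k l x) (G.inv (q m l x)) = c.trans k m x
      rw [← e]
      exact G.mul_inv_cancel_right (by
        rw [c.src_trans k m x ⟨⟨hx, hkO⟩, hk, hm⟩, tgt_q m l x hx hkO hlO hm hl])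
    · exact hq.right k l m x ⟨hx, hkO, hlO⟩ hk hl hm
    · have e := hq.left l m k x ⟨hx, hlO, hkO⟩ hl hm hk
      change G.mul (G.inv (q l k x)) (c.trans l m x) = G.inv (q m k x)
      have h1 : G.src (c.trans l m x) = G.tgt (q m k x) := by
        rw [c.src_trans l m x ⟨⟨hx, hlO⟩, hl, hm⟩, tgt_q m k x hx hlO hkO hm hk]
      have h2 : G.src (G.inv (q l k x)) = G.tgt (c.trans l m x) := by
        rw [G.src_inv, c.tgt_trans l m x ⟨⟨hx, hlO⟩, hl, hm⟩, tgt_q l k x hx hlO hkO hl hk]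
      refine G.mul_right_cancel (q := q m k x) (by rw [G.src_mul _ _ h2, h1]) (by simp) ?_ ?_
      · rw [G.tgt_mul _ _ h2, G.tgt_inv, G.tgt_inv, src_q l k x hx hlO hkO hl hk,
          src_q m k x hx hlO hkO hm hk]
      · rw [G.mul_assoc _ _ _ h2 h1, e, G.inv_mul, G.inv_mul, src_q l k x hx hlO hkO hl hk,
          src_q m k x hx hlO hkO hm hk]
    · have e := hq.right l k m x ⟨hx, hlO, hkO⟩ hl hk hm
      change G.mul (G.inv (q l k x)) (q l m x) = c'.trans k m x
      rw [← e]
      exact G.inv_mul_cancel_left (by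
        rw [c'.tgt_trans k m x ⟨⟨hx, hkO⟩, hk, hm⟩, src_q l k x hx hlO hkO hl hk])
    · have e := hq.right m k l x ⟨hx, hmO, hkO⟩ hm hk hl
      change G.mul (c'.trans k l x) (G.inv (q m l x)) = G.inv (q m k x)
      have h1 : G.src (q m k x) = G.tgt (c'.trans k l x) := by
        rw [c'.tgt_trans k l x ⟨⟨hx, hkO⟩, hk, hl⟩, src_q m k x hx hmO hkO hm hk]
      have h2 : G.src (c'.trans k l x) = G.tgt (G.inv (q m l x)) := by
        rw [G.tgt_inv, c'.src_trans k l x ⟨⟨hx, hkO⟩, hk, hl⟩, src_q m l x hx hmO hkO hm hl]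
      refine G.mul_left_cancel (p := q m k x) (by rw [h1, G.tgt_mul _ _ h2]) (by simp) ?_ ?_
      · rw [G.src_mul _ _ h2, G.src_inv, G.src_inv, tgt_q m l x hx hmO hkO hm hl,
          tgt_q m k x hx hmO hkO hm hk]
      · rw [← G.mul_assoc _ _ _ h1 h2, e, G.mul_inv, G.mul_inv, tgt_q m l x hx hmO hkO hm hl,
          tgt_q m k x hx hmO hkO hm hk]
    · exact c'.mul_trans k l m x ⟨hx, hkO⟩ hk hl hm

/-- Two cocycles for the same map are isomorphic on every compact convex set. -/
theorem exists_isIso_of_isCompact {S₁ S₂ K : Set ℂ} {u : ℂ → Q} (c : LiftCocycle G S₁ u)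
    (c' : LiftCocycle G S₂ u) (h₁ : K ⊆ S₁) (h₂ : K ⊆ S₂) (hK : IsCompact K) (hKc : Convex ℝ K)
    [Nonempty P] : ∃ q, IsIso c c' K q := by
  obtain ⟨a, ha⟩ := hK.isBounded.subset_closedBall 0
  have key := rect_induction (p := fun Z => ∃ q, IsIso c c' (K ∩ Z) q)
    (fun Z Z' hZ ⟨q, hq⟩ => ⟨q, hq.mono (inter_subset_inter_right _ hZ)⟩)
    (fun Z Z₀ l a b hZ hZc hZ₀ hZ₀c hcpt hsub hab ⟨q, hq⟩ ⟨q', hq'⟩ => ?_) (fun x => ?_)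
    (-a - 1) (a + 1) (-a - 1) (a + 1)
  · obtain ⟨q, hq⟩ := key
    refine ⟨q, hq.mono fun z hz => ⟨hz, ?_⟩⟩
    have hn : ‖z‖ ≤ a := by simpa using ha hz
    have h1 := abs_le.1 ((Complex.abs_re_le_norm z).trans hn)
    have h2 := abs_le.1 ((Complex.abs_im_le_norm z).trans hn)
    exact ⟨⟨by linarith, by linarith⟩, by linarith, by linarith⟩
  · obtain ⟨q, hq⟩ := exists_isIso_glue c c' (S := K ∩ Z) (inter_subset_left.trans h₁)
      (inter_subset_left.trans h₂) (hKc.inter hZc) l hab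
      ⟨q, hq.mono (by rw [inter_assoc])⟩ ⟨q', hq'.mono (by rw [inter_assoc])⟩
    exact ⟨q, hq.mono (inter_subset_inter_right _ (subset_closure.trans hsub))⟩
  · by_cases hx : x ∈ K
    · obtain ⟨N, hN, hxN, q, hq⟩ := exists_isIso_nhds c c' h₁ h₂ hx
      exact ⟨N, hN.mem_nhds hxN, q, hq⟩
    -- A point off `K` has the neighbourhood `Kᶜ`, over which nothing is required. Some element of
    -- `P` is needed only as a dummy value.
    · have he : K ∩ Kᶜ = ∅ := inter_compl_self K
      refine ⟨Kᶜ, hK.isClosed.isOpen_compl.mem_nhds hx, fun _ _ _ => Classical.arbitrary P, ?_⟩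
      rw [he]
      constructor <;> simp

/-- The restriction of a cocycle. -/
def restrict (c : LiftCocycle G S₁ u) (h : S ⊆ S₁) : LiftCocycle G S u where
  ι := c.ι
  U := c.U
  isOpen_U := c.isOpen_U
  cover x hx := c.cover x (h hx)
  lift := c.lift
  smooth_lift k := (c.smooth_lift k).mono (inter_subset_inter_left _ h)
  proj_lift k x hx := c.proj_lift k x ⟨h hx.1, hx.2⟩
  trans := c.trans
  smooth_trans k l := (c.smooth_trans k l).mono (inter_subset_inter_left _ h)
  tgt_trans k l x hx := c.tgt_trans k l x ⟨h hx.1, hx.2⟩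
  src_trans k l x hx := c.src_trans k l x ⟨h hx.1, hx.2⟩
  mul_trans k l m x hx := c.mul_trans k l m x (h hx)

/-- The cocycle on the empty set. -/
def empty {u : V → Q} : LiftCocycle G (∅ : Set V) u where
  ι := Empty
  U := Empty.elim
  isOpen_U k := k.elim
  cover _ hx := hx.elim
  lift := Empty.elim
  smooth_lift k := k.elim
  proj_lift k := k.elim
  trans := Empty.elim
  smooth_trans k := k.elim
  tgt_trans k := k.elim
  src_trans k := k.elim
  mul_trans k := k.elim

/-- One lift through a local section of the submersion suffices, with the units as its transition.
-/
theorem exists_nhds [IsManifold 𝓘(ℝ, EQ) ∞ Q] (hu : ContMDiffOn 𝓘(ℝ, V) 𝓘(ℝ, EQ) ∞ u S) {x : V}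
    (hx : x ∈ S) : ∃ N : Set V, IsOpen N ∧ x ∈ N ∧ Nonempty (LiftCocycle G (S ∩ N) u) := by
  obtain ⟨y, hy⟩ := G.surjective (u x)
  obtain ⟨N, hN, hyN, s, hs, hs'⟩ := exists_local_section_of_submersion G.submersion y
  rw [hy] at hyN
  obtain ⟨N', hN', hxN', h⟩ := mem_nhdsWithin.1 ((hu x hx).continuousWithinAt (hN.mem_nhds hyN))
  have hsm : ContMDiffOn 𝓘(ℝ, V) 𝓘(ℝ, EY) ∞ (fun x => s (u x)) (S ∩ N') :=
    hs.comp (hu.mono inter_subset_left) fun y hy => h ⟨hy.2, hy.1⟩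
  exact ⟨N', hN', hxN', ⟨{
    ι := Unit
    U := fun _ => univ
    isOpen_U := fun _ => isOpen_univ
    cover := fun _ _ => ⟨(), trivial⟩
    lift := fun _ x => s (u x)
    smooth_lift := fun _ => hsm.mono inter_subset_left
    proj_lift := fun _ y hy => hs' _ (h ⟨hy.1.2, hy.1.1⟩)
    trans := fun _ _ x => G.unit (s (u x))
    smooth_trans := fun _ _ => G.contMDiffOn_unit (hsm.mono inter_subset_left)
    tgt_trans := fun _ _ _ _ => G.tgt_unit _
    src_trans := fun _ _ _ _ => G.src_unit _
    mul_trans := fun _ _ _ _ _ _ _ _ => G.unit_mul_unit _ }⟩⟩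

/-- By induction over rectangles it is enough to glue cocycles on two overlapping halves. They are
isomorphic on a closed slab of the overlap, which is compact and convex. -/
theorem exists_unitDisk [IsManifold 𝓘(ℝ, EQ) ∞ Q] [Nonempty P] {u : ℂ → Q}
    (hu : ContMDiffOn 𝓘(ℝ, ℂ) 𝓘(ℝ, EQ) ∞ u unitDisk) :
    Nonempty (LiftCocycle G unitDisk u) := by
  have key := rect_induction (p := fun Z => Nonempty (LiftCocycle G (unitDisk ∩ Z) u))
    (fun Z Z' hZ ⟨c⟩ => ⟨c.restrict (inter_subset_inter_right _ hZ)⟩)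
    (fun Z Z₀ l a b hZ hZc hZ₀ hZ₀c hcpt hsub hab ⟨c⟩ ⟨c'⟩ => ?_) (fun x => ?_) (-2) 2 (-2) 2
  · obtain ⟨c⟩ := key
    refine ⟨c.restrict fun z hz => ⟨hz, ?_⟩⟩
    have hn : ‖z‖ ≤ 1 := by simpa using hz
    have h1 := abs_le.1 ((Complex.abs_re_le_norm z).trans hn)
    have h2 := abs_le.1 ((Complex.abs_im_le_norm z).trans hn)
    exact ⟨⟨by linarith, by linarith⟩, by linarith, by linarith⟩
  -- The slab between `a'` and `b'` is closed and still lies strictly inside both halves, while the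
  -- open half-planes bounded by these values still cover.
  · set a' := a + (b - a) / 3 with ha'
    set b' := b - (b - a) / 3 with hb'
    set K := (unitDisk ∩ closure Z₀) ∩ ({x | l x ≤ b'} ∩ {x | a' ≤ l x})
    have hK : IsCompact K := ((isCompact_closedBall 0 1).inter_right isClosed_closure).inter_right
      ((isClosed_le l.continuous continuous_const).inter
        (isClosed_le continuous_const l.continuous))
    have hKc : Convex ℝ K := ((convex_closedBall 0 1).inter hZ₀c.closure).inter
      ((convex_halfSpace_le l.toLinearMap.isLinear b').inter
        (convex_halfSpace_ge l.toLinearMap.isLinear a'))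
    obtain ⟨q, hq⟩ := exists_isIso_of_isCompact c c' (K := K)
      (fun x hx => ⟨hx.1.1, hsub hx.1.2, lt_of_le_of_lt (b := b') hx.2.1 (by linarith)⟩)
      (fun x hx => ⟨hx.1.1, hsub hx.1.2, lt_of_lt_of_le (b := a') (by linarith) hx.2.2⟩) hK hKc
    have h1 : (unitDisk ∩ Z₀) ∩ {x | l x < b'} ⊆ unitDisk ∩ (Z ∩ {x | l x < b}) := fun x hx =>
      ⟨hx.1.1, hsub (subset_closure hx.1.2), lt_trans (b := b') hx.2 (by linarith)⟩
    have h2 : (unitDisk ∩ Z₀) ∩ {x | a' < l x} ⊆ unitDisk ∩ (Z ∩ {x | a < l x}) := fun x hx =>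
      ⟨hx.1.1, hsub (subset_closure hx.1.2), lt_trans (b := a') (by linarith) hx.2⟩
    have hq' := hq.mono (S' := (unitDisk ∩ Z₀) ∩ ({x | l x < b'} ∩ {x | a' < l x}))
      (by
        rintro x ⟨⟨h1, h2⟩, h3, h4⟩
        exact ⟨⟨h1, subset_closure h2⟩, (show l x < b' from h3).le, (show a' < l x from h4).le⟩)
    refine exists_glue (isOpen_lt l.continuous continuous_const)
      (isOpen_lt continuous_const l.continuous) (fun x _ => ?_) (c.restrict h1) (c'.restrict h2)
      ⟨q, hq'.smooth, hq'.tgt, hq'.src, hq'.left, hq'.right⟩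
    rcases lt_or_ge (l x) b' with h | h
    · exact Or.inl h
    · exact Or.inr (lt_of_lt_of_le (by linarith) h)
  · by_cases hx : x ∈ unitDisk
    · obtain ⟨N, hN, hxN, c⟩ := exists_nhds (G := G) hu hx
      exact ⟨N, hN.mem_nhds hxN, c⟩
    · refine ⟨unitDiskᶜ, Metric.isClosed_closedBall.isOpen_compl.mem_nhds hx, ?_⟩
      rw [inter_compl_self]
      exact ⟨empty⟩

end LiftCocycle

end

noncomputable section

variable {EQ EY EP : Type*}
  [NormedAddCommGroup EQ] [NormedSpace ℝ EQ] [NormedAddCommGroup EY] [NormedSpace ℝ EY]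
  [NormedAddCommGroup EP] [NormedSpace ℝ EP]
  {Q Y P : Type*} [TopologicalSpace Q] [ChartedSpace EQ Q]
  [TopologicalSpace Y] [ChartedSpace EY Y] [IsManifold 𝓘(ℝ, EY) ∞ Y]
  [TopologicalSpace P] [ChartedSpace EP P] [IsManifold 𝓘(ℝ, EP) ∞ P] [MulAction Circle P]

/-! ### Connections on cocycles -/

/-- A smooth step function along a linear functional. -/
theorem exists_smooth_step {V : Type*} [NormedAddCommGroup V] [NormedSpace ℝ V] (l : V →L[ℝ] ℝ)
    {a b : ℝ} (hab : a < b) : ∃ (ρ : V → ℝ) (a' b' : ℝ), ContDiff ℝ ∞ ρ ∧ a < a' ∧ a' < b' ∧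
      b' < b ∧ (∀ x, l x < a' → ρ x = 0) ∧ ∀ x, b' < l x → ρ x = 1 := by
  have hba : 0 < b - a := sub_pos.2 hab
  refine ⟨fun x => Real.smoothTransition (3 * ((l x - a) / (b - a)) - 1), a + (b - a) / 3,
    b - (b - a) / 3, ?_, by linarith, by linarith, by linarith, fun x hx => ?_, fun x hx => ?_⟩
  · exact Real.smoothTransition.contDiff.comp
      ((contDiff_const.mul ((l.contDiff.sub contDiff_const).div_const _)).sub contDiff_const)
  · refine Real.smoothTransition.zero_of_nonpos ?_
    have : (l x - a) / (b - a) ≤ 1 / 3 := by rw [div_le_iff₀ hba]; linarith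
    linarith
  · refine Real.smoothTransition.one_of_one_le ?_
    have : 2 / 3 ≤ (l x - a) / (b - a) := by rw [le_div_iff₀ hba]; linarith
    linarith

theorem pullOne_congr {E : Type*} [NormedAddCommGroup E] [NormedSpace ℝ E]
    {X : Type*} [TopologicalSpace X] [ChartedSpace E X]
    (θ : (x : X) → TangentSpace 𝓘(ℝ, E) x →L[ℝ] ℝ) {S : Set ℂ} {u v : ℂ → X} (h : EqOn u v S)
    {x : ℂ} (hx : x ∈ S) : pullOne θ S u x = pullOne θ S v x := by
  have h1 := mfderivWithin_congr (I := 𝓘(ℝ, ℂ)) (I' := 𝓘(ℝ, E)) h (h hx)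
  ext w : 1
  change θ (u x) (mfderivWithin 𝓘(ℝ, ℂ) 𝓘(ℝ, E) u S x w) =
    θ (v x) (mfderivWithin 𝓘(ℝ, ℂ) 𝓘(ℝ, E) v S x w)
  -- All tangent spaces are the model space, but the equality of base points must be eliminated
  -- before the values of the form can be compared.
  have h2 : ∀ y y' : X, y = y' → ∀ e : E, θ y e = θ y' e := by rintro y _ rfl e; rfl
  rw [h1]
  exact h2 _ _ (h hx) _

/-- The three pull-backs are formed within different sets. Derivatives are local, so all may be
computed on the common neighbourhood `W`, where the product rule holds. -/
theorem BundleGerbe.pullOne_of_mul (G : BundleGerbe (EQ := EQ) (EY := EY) (EP := EP) Q Y P)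
    {U₁ U₂ U₃ : Set ℂ} (h₁ : IsOpen U₁) (h₂ : IsOpen U₂) (h₃ : IsOpen U₃) {a b c : ℂ → P}
    (ha : ContMDiffOn 𝓘(ℝ, ℂ) 𝓘(ℝ, EP) ∞ a (unitDisk ∩ U₁))
    (hb : ContMDiffOn 𝓘(ℝ, ℂ) 𝓘(ℝ, EP) ∞ b (unitDisk ∩ U₂))
    (h : ∀ y ∈ unitDisk, y ∈ U₁ → y ∈ U₂ → y ∈ U₃ →
      G.src (a y) = G.tgt (b y) ∧ G.mul (a y) (b y) = c y)
    {x : ℂ} (hx : x ∈ unitDisk) (hx₁ : x ∈ U₁) (hx₂ : x ∈ U₂) (hx₃ : x ∈ U₃) :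
    pullOne G.conn (unitDisk ∩ U₃) c x =
      pullOne G.conn (unitDisk ∩ U₁) a x + pullOne G.conn (unitDisk ∩ U₂) b x := by
  set W := U₁ ∩ U₂ ∩ U₃ with hW
  have hWo : IsOpen W := (h₁.inter h₂).inter h₃
  have hn : W ∈ 𝓝 x := hWo.mem_nhds ⟨⟨hx₁, hx₂⟩, hx₃⟩
  have hS : x ∈ unitDisk ∩ W := ⟨hx, ⟨hx₁, hx₂⟩, hx₃⟩
  have key := G.pullOne_mul hWo (ha.mono fun y hy => ⟨hy.1, hy.2.1.1⟩)
    (hb.mono fun y hy => ⟨hy.1, hy.2.1.2⟩) (fun y hy => (h y hy.1 hy.2.1.1 hy.2.1.2 hy.2.2).1) hS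
  rw [pullOne_congr G.conn (v := c)
    (fun y hy => (h y hy.1 hy.2.1.1 hy.2.1.2 hy.2.2).2) hS] at key
  have e : ∀ U : Set ℂ, W ⊆ U → ∀ v : ℂ → P,
      pullOne G.conn (unitDisk ∩ U) v x = pullOne G.conn (unitDisk ∩ W) v x := fun U h v => by
    rw [← pullOne_congr_nhds _ hn, inter_assoc, inter_eq_self_of_subset_right h]
  rw [e U₃ fun y hy => hy.2, e U₁ fun y hy => hy.1.1, e U₂ fun y hy => hy.1.2]
  exact key

namespace LiftCocycle

variable {G : BundleGerbe (EQ := EQ) (EY := EY) (EP := EP) Q Y P} {u : ℂ → Q}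

/-- Connection forms, divided by `i`, for a cocycle over a part of the disk. -/
structure IsForm (c : LiftCocycle G unitDisk u) (Z : Set ℂ) (a : c.ι → ℂ → ℂ →L[ℝ] ℝ) : Prop where
  smooth : ∀ k, ContDiffOn ℝ ∞ (a k) (unitDisk ∩ Z ∩ c.U k)
  eq : ∀ k l, ∀ x ∈ unitDisk ∩ Z, x ∈ c.U k → x ∈ c.U l →
    pullOne G.conn (unitDisk ∩ (c.U k ∩ c.U l)) (c.trans k l) x = a k x - a l x

theorem IsForm.mono {c : LiftCocycle G unitDisk u} {Z Z' : Set ℂ} {a : c.ι → ℂ → ℂ →L[ℝ] ℝ}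
    (h : IsForm c Z a) (hZ : Z' ⊆ Z) : IsForm c Z' a where
  smooth k := (h.smooth k).mono fun _ hx => ⟨⟨hx.1.1, hZ hx.1.2⟩, hx.2⟩
  eq k l x hx := h.eq k l x ⟨hx.1, hZ hx.2⟩

theorem pullOne_trans (c : LiftCocycle G unitDisk u) {k l m : c.ι} {x : ℂ} (hx : x ∈ unitDisk)
    (hk : x ∈ c.U k) (hl : x ∈ c.U l) (hm : x ∈ c.U m) :
    pullOne G.conn (unitDisk ∩ (c.U k ∩ c.U m)) (c.trans k m) x =
      pullOne G.conn (unitDisk ∩ (c.U k ∩ c.U l)) (c.trans k l) x +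
      pullOne G.conn (unitDisk ∩ (c.U l ∩ c.U m)) (c.trans l m) x :=
  G.pullOne_of_mul ((c.isOpen_U k).inter (c.isOpen_U l)) ((c.isOpen_U l).inter (c.isOpen_U m))
    ((c.isOpen_U k).inter (c.isOpen_U m)) (c.smooth_trans k l) (c.smooth_trans l m)
    (fun y hy h1 h2 h3 => ⟨by rw [c.src_trans k l y ⟨hy, h1⟩, c.tgt_trans l m y ⟨hy, h2⟩],
      c.mul_trans k l m y hy h1.1 h1.2 h2.2⟩) hx ⟨hk, hl⟩ ⟨hl, hm⟩ ⟨hk, hm⟩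

/-- The condition is affine in the forms, so solutions on two halves may be interpolated by a smooth
step. -/
theorem exists_isForm (c : LiftCocycle G unitDisk u) : ∃ a, IsForm c univ a := by
  have key := rect_induction (p := fun Z => ∃ a, IsForm c Z a)
    (fun Z Z' hZ ⟨a, ha⟩ => ⟨a, ha.mono hZ⟩)
    (fun Z Z₀ l a b hZ hZc hZ₀ hZ₀c hcpt hsub hab ⟨f, hf⟩ ⟨g, hg⟩ => ?_) (fun x => ?_) (-2) 2 (-2) 2
  · obtain ⟨a, ha⟩ := key
    have hD : unitDisk ∩ univ ⊆ unitDisk ∩ rect (-2) 2 (-2) 2 := by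
      rintro z ⟨hz, -⟩
      have hn : ‖z‖ ≤ 1 := by simpa using hz
      have h1 := abs_le.1 ((Complex.abs_re_le_norm z).trans hn)
      have h2 := abs_le.1 ((Complex.abs_im_le_norm z).trans hn)
      exact ⟨hz, ⟨by linarith, by linarith⟩, by linarith, by linarith⟩
    exact ⟨a, fun k => (ha.smooth k).mono (inter_subset_inter_left _ hD),
      fun k l x hx => ha.eq k l x (hD hx)⟩
  · obtain ⟨ρ, a', b', hρ, haa, hab', hbb, hρ0, hρ1⟩ := exists_smooth_step l hab
    have hZ' : Z₀ ⊆ Z := subset_closure.trans hsub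
    refine ⟨fun k x => (1 - ρ x) • f k x + ρ x • g k x, fun k => ?_, fun k m x hx hk hm => ?_⟩
    · refine contDiffOn_of_locally_contDiffOn fun x hx => ?_
      rcases lt_or_ge (l x) a' with h | h
      · refine ⟨_, isOpen_lt l.continuous (continuous_const (y := a')), h,
          ((hf.smooth k).mono ?_).congr fun y hy => by rw [hρ0 y hy.2]; simp⟩
        exact fun y hy => ⟨⟨hy.1.1.1, hZ' hy.1.1.2, lt_trans (b := a') hy.2 (by linarith)⟩, hy.1.2⟩
      rcases lt_or_ge b' (l x) with h' | h'
      · refine ⟨_, isOpen_lt (continuous_const (y := b')) l.continuous, h',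
          ((hg.smooth k).mono ?_).congr fun y hy => by rw [hρ1 y hy.2]; simp⟩
        exact fun y hy => ⟨⟨hy.1.1.1, hZ' hy.1.1.2, lt_trans (b := b') (by linarith) hy.2⟩, hy.1.2⟩
      · refine ⟨_, (isOpen_lt l.continuous (continuous_const (y := b))).inter
          (isOpen_lt (continuous_const (y := a)) l.continuous), ⟨lt_of_le_of_lt h' hbb,
            lt_of_lt_of_le haa h⟩, ContDiffOn.add ?_ ?_⟩
        · exact (contDiff_const.sub hρ).contDiffOn.smul ((hf.smooth k).mono
            fun y hy => ⟨⟨hy.1.1.1, hZ' hy.1.1.2, hy.2.1⟩, hy.1.2⟩)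
        · exact hρ.contDiffOn.smul ((hg.smooth k).mono
            fun y hy => ⟨⟨hy.1.1.1, hZ' hy.1.1.2, hy.2.2⟩, hy.1.2⟩)
    · rcases lt_or_ge (l x) a' with h | h
      · rw [hρ0 x h, hf.eq k m x ⟨hx.1, hZ' hx.2, lt_trans (b := a') h (by linarith)⟩ hk hm]
        simp
      rcases lt_or_ge b' (l x) with h' | h'
      · rw [hρ1 x h', hg.eq k m x ⟨hx.1, hZ' hx.2, lt_trans (b := b') (by linarith) h'⟩ hk hm]
        simp
      · have e1 := hf.eq k m x ⟨hx.1, hZ' hx.2, lt_of_le_of_lt h' hbb⟩ hk hm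
        have e2 := hg.eq k m x ⟨hx.1, hZ' hx.2, lt_of_lt_of_le haa h⟩ hk hm
        have e3 : ∀ w : ℂ →L[ℝ] ℝ, w = (1 - ρ x) • w + ρ x • w := fun w => by
          rw [← add_smul]; simp
        rw [e3 (pullOne _ _ _ x)]
        nth_rewrite 1 [e1]
        rw [e2]
        simp only [smul_sub]
        abel
  · by_cases hx : x ∈ unitDisk
    · obtain ⟨k₀, hk₀⟩ := c.cover x hx
      -- The local solution measures every section against a single one: the form of `k` is the
      -- connection pulled back by the transition from `k₀` to `k`.
      refine ⟨c.U k₀, (c.isOpen_U k₀).mem_nhds hk₀,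
        fun k => pullOne G.conn (unitDisk ∩ (c.U k ∩ c.U k₀)) (c.trans k k₀), fun k => ?_,
        fun k l y hy hk hl => ?_⟩
      · exact (contDiffOn_pullOne G.smooth_conn
          (uniqueDiffOn_unitDisk_inter ((c.isOpen_U k).inter (c.isOpen_U k₀)))
          (c.smooth_trans k k₀)).mono fun y hy => ⟨hy.1.1, hy.2, hy.1.2⟩
      · rw [c.pullOne_trans hy.1 hk hl hy.2]; simp
    · refine ⟨unitDiskᶜ, Metric.isClosed_closedBall.isOpen_compl.mem_nhds hx, fun _ _ => 0, ?_⟩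
      constructor <;> simp

end LiftCocycle

end

/-! ### Trivialisations from cocycles, and cocycles from trivialisations -/

noncomputable section

universe u

variable {EQ EY EP : Type*}
  [NormedAddCommGroup EQ] [NormedSpace ℝ EQ] [NormedAddCommGroup EY] [NormedSpace ℝ EY]
  [NormedAddCommGroup EP] [NormedSpace ℝ EP]
  {Q Y : Type*} {P : Type u} [TopologicalSpace Q] [ChartedSpace EQ Q]
  [TopologicalSpace Y] [ChartedSpace EY Y] [IsManifold 𝓘(ℝ, EY) ∞ Y]
  [TopologicalSpace P] [ChartedSpace EP P] [IsManifold 𝓘(ℝ, EP) ∞ P] [MulAction Circle P]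
  {G : BundleGerbe (EQ := EQ) (EY := EY) (EP := EP) Q Y P} {σ : Disk (E := EQ) Q}

namespace LiftCocycle

/-- An index of a chart around a point. -/
def idx {V : Type*} [NormedAddCommGroup V] [NormedSpace ℝ V] {S : Set V} {u : V → Q}
    (c : LiftCocycle G S u) {x : V} (hx : x ∈ S) : c.ι := (c.cover x hx).choose

theorem mem_idx {V : Type*} [NormedAddCommGroup V] [NormedSpace ℝ V] {S : Set V} {u : V → Q}
    (c : LiftCocycle G S u) {x : V} (hx : x ∈ S) : x ∈ c.U (c.idx hx) := (c.cover x hx).choose_spec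

/-- The unit vectors of the line bundle over `σ^* Y` defined by a cocycle. -/
abbrev Total (c : LiftCocycle G unitDisk σ.ext) : Type u :=
  {j : ULift.{u} unitDisk × P // G.src j.2 = c.lift (c.idx j.1.down.2) j.1.down}

open Classical in
/-- The trivialisation defined by a cocycle and connection forms. -/
def trivialisation (c : LiftCocycle G unitDisk σ.ext) {a : c.ι → ℂ → ℂ →L[ℝ] ℝ}
    (ha : IsForm c univ a) : Trivialisation G σ where
  -- The fibre of `J` over `(x, y)` consists of the unit vectors from a chosen lift of `x` to `y`.
  -- The choice of lift need not vary smoothly with `x`, since smoothness is recorded by the local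
  -- sections and their transitions alone.
  J := c.Total
  rot z j := ⟨(j.1.1, z • j.1.2), (G.src_smul _ _).trans j.2⟩
  rot_one j := Subtype.ext (Prod.ext rfl (one_smul _ _))
  rot_rot z w j := Subtype.ext (Prod.ext rfl (smul_smul _ _ _))
  base j := j.1.1.down
  pt j := G.tgt j.1.2
  base_mem j := j.1.1.down.2
  proj_pt j := by
    rw [G.proj_tgt, j.2, c.proj_lift _ _ ⟨j.1.1.down.2, c.mem_idx _⟩]
  nonempty_fibre x hx y hy := by
    obtain ⟨p, hp, hp'⟩ := G.exists_over (y₁ := y) (y₂ := c.lift (c.idx hx) x) (by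
      rw [hy, c.proj_lift _ _ ⟨hx, c.mem_idx _⟩])
    exact ⟨⟨(⟨⟨x, hx⟩⟩, p), hp'⟩, rfl, hp⟩
  base_rot _ _ := rfl
  pt_rot _ _ := G.tgt_smul _ _
  free z j h := G.free z j.1.2 (congrArg (fun j => j.1.2) h)
  transitive := by
    rintro ⟨⟨⟨x⟩, p⟩, hp⟩ ⟨⟨⟨x'⟩, p'⟩, hp'⟩ h h'
    obtain rfl : x = x' := Subtype.ext h
    obtain ⟨z, hz⟩ := G.exists_smul_eq h' (hp.trans hp'.symm)
    exact ⟨z, Subtype.ext (Prod.ext rfl hz)⟩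
  lmul p j := if h : G.src p = G.tgt j.1.2 then ⟨(j.1.1, G.mul p j.1.2),
    (G.src_mul _ _ h).trans j.2⟩ else j
  base_lmul p j h := by rw [dif_pos h]
  pt_lmul p j h := by rw [dif_pos h]; exact G.tgt_mul _ _ h
  lmul_rot p z j h := by
    rw [dif_pos h, dif_pos (h.trans (G.tgt_smul _ _).symm)]
    exact Subtype.ext (Prod.ext rfl (G.mul_smul _ _ _ h))
  smul_lmul z p j h := by
    rw [dif_pos h, dif_pos ((G.src_smul _ _).trans h)]
    exact Subtype.ext (Prod.ext rfl (G.smul_mul _ _ _ h))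
  mul_lmul p q j h h' := by
    rw [dif_pos h', dif_pos ((G.src_mul _ _ h).trans h'),
      dif_pos (h.trans (G.tgt_mul _ _ h').symm)]
    exact Subtype.ext (Prod.ext rfl (G.mul_assoc _ _ _ h h'))
  ι := c.ι
  U := c.U
  isOpen_U := c.isOpen_U
  cover := c.cover
  -- The section is the transition from the chosen lift to the `k`-th lift. Off its domain it takes
  -- a dummy value over the centre.
  sec k x := if h : ∃ hx : x ∈ unitDisk, x ∈ c.U k then
    ⟨(⟨⟨x, h.1⟩⟩, c.trans k (c.idx h.1) x), c.src_trans _ _ x ⟨h.1, h.2, c.mem_idx h.1⟩⟩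
    else ⟨(⟨diskCentre⟩, G.unit (c.lift (c.idx diskCentre.2) diskCentre)), G.src_unit _⟩
  base_sec k x hx := by rw [dif_pos ⟨hx.1, hx.2⟩]
  smooth_sec k := (c.smooth_lift k).congr fun x hx => by
    rw [dif_pos ⟨hx.1, hx.2⟩]
    exact c.tgt_trans _ _ x ⟨hx.1, hx.2, c.mem_idx hx.1⟩
  trans := c.trans
  smooth_trans := c.smooth_trans
  src_trans k l x hx := by
    rw [dif_pos ⟨hx.1, hx.2.2⟩, c.src_trans k l x hx]
    exact (c.tgt_trans _ _ x ⟨hx.1, hx.2.2, c.mem_idx hx.1⟩).symm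
  lmul_trans k l x hx := by
    have h : G.src (c.trans k l x) = G.tgt (c.trans l (c.idx hx.1) x) := by
      rw [c.src_trans k l x hx, c.tgt_trans _ _ x ⟨hx.1, hx.2.2, c.mem_idx hx.1⟩]
    simp only [dif_pos (show ∃ hx : x ∈ unitDisk, x ∈ c.U l from ⟨hx.1, hx.2.2⟩),
      dif_pos (show ∃ hx : x ∈ unitDisk, x ∈ c.U k from ⟨hx.1, hx.2.1⟩)]
    rw [dif_pos h]
    exact Subtype.ext (Prod.ext rfl (c.mul_trans _ _ _ x hx.1 hx.2.1 hx.2.2 (c.mem_idx hx.1)))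
  form := a
  smooth_form k := (ha.smooth k).mono fun x hx => ⟨⟨hx.1, trivial⟩, hx.2⟩
  form_eq k l x hx := ha.eq k l x ⟨hx.1, trivial⟩ hx.2.1 hx.2.2

end LiftCocycle

theorem Disk.contMDiffOn_ext {E X : Type*} [NormedAddCommGroup E] [NormedSpace ℝ E]
    [TopologicalSpace X] [ChartedSpace E X] (σ : Disk (E := E) X) :
    ContMDiffOn 𝓘(ℝ, ℂ) 𝓘(ℝ, E) ∞ σ.ext unitDisk := σ.smooth

theorem nonempty_trivialisation [IsManifold 𝓘(ℝ, EQ) ∞ Q]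
    (G : BundleGerbe (EQ := EQ) (EY := EY) (EP := EP) Q Y P) (σ : Disk (E := EQ) Q) :
    Nonempty (Trivialisation G σ) := by
  -- A point of `Y` exists by surjectivity, and its unit shows that `P` is nonempty.
  obtain ⟨y, -⟩ := G.surjective (σ.ext 0)
  have : Nonempty P := ⟨G.unit y⟩
  obtain ⟨c⟩ := LiftCocycle.exists_unitDisk (G := G) σ.contMDiffOn_ext
  obtain ⟨a, ha⟩ := c.exists_isForm
  exact ⟨c.trivialisation ha⟩

namespace Trivialisation

variable (T : Trivialisation G σ)

/-- With the next lemma, the unit vectors of `R` act simply transitively on the part of `J` over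
each point of the disk. Identities between arrows may therefore be checked after applying them to
one vector of `J`. -/
theorem lmul_cancel {p q : P} {j : T.J} (hp : G.src p = T.pt j) (hq : G.src q = T.pt j)
    (h : T.lmul p j = T.lmul q j) : p = q := by
  obtain ⟨z, rfl⟩ := G.exists_smul_eq (p := p) (q := q)
    (by rw [← T.pt_lmul p j hp, h, T.pt_lmul q j hq]) (hp.trans hq.symm)
  rw [T.smul_lmul _ _ _ hp] at h
  rw [T.free z _ h.symm, one_smul]

theorem exists_lmul_eq {j j' : T.J} (h : T.base j = T.base j') :
    ∃ p, G.src p = T.pt j ∧ T.lmul p j = j' := by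
  obtain ⟨p, hp, hp'⟩ := G.exists_over (y₁ := T.pt j') (y₂ := T.pt j)
    (by rw [T.proj_pt, T.proj_pt, h])
  obtain ⟨z, hz⟩ := T.transitive (T.lmul p j) j' (by rw [T.base_lmul p j hp', h])
    (by rw [T.pt_lmul p j hp', hp])
  exact ⟨z • p, by rw [G.src_smul, hp'], by rw [T.smul_lmul _ _ _ hp', hz]⟩

theorem tgt_trans (k l : T.ι) {x : ℂ} (hx : x ∈ unitDisk ∩ (T.U k ∩ T.U l)) :
    G.tgt (T.trans k l x) = T.pt (T.sec k x) := by
  rw [← T.lmul_trans k l x hx, T.pt_lmul _ _ (T.src_trans k l x hx)]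

/-- The cocycle of the local sections of a trivialisation. -/
def cocycle : LiftCocycle G unitDisk σ.ext where
  ι := T.ι
  U := T.U
  isOpen_U := T.isOpen_U
  cover := T.cover
  lift k x := T.pt (T.sec k x)
  smooth_lift := T.smooth_sec
  proj_lift k x hx := by rw [T.proj_pt, T.base_sec k x hx]
  trans := T.trans
  smooth_trans := T.smooth_trans
  tgt_trans k l x hx := T.tgt_trans k l hx
  src_trans := T.src_trans
  mul_trans k l m x hx hk hl hm := by
    have e1 := T.src_trans k l x ⟨hx, hk, hl⟩
    have e2 := T.src_trans l m x ⟨hx, hl, hm⟩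
    have e3 : G.src (T.trans k l x) = G.tgt (T.trans l m x) := by
      rw [e1, T.tgt_trans l m ⟨hx, hl, hm⟩]
    refine T.lmul_cancel (j := T.sec m x) (by rw [G.src_mul _ _ e3, e2])
      (T.src_trans k m x ⟨hx, hk, hm⟩) ?_
    rw [T.mul_lmul _ _ _ e3 e2, T.lmul_trans l m x ⟨hx, hl, hm⟩, T.lmul_trans k l x ⟨hx, hk, hl⟩,
      T.lmul_trans k m x ⟨hx, hk, hm⟩]

end Trivialisation

end

noncomputable section

universe u

/-! ### The curvature of two trivialisations over a disk -/

theorem curl_congr {S : Set ℂ} {α β : ℂ → ℂ →L[ℝ] ℝ} (h : EqOn α β S) {x : ℂ} (hx : x ∈ S) :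
    curl S α x = curl S β x := by
  rw [curl, curl, fderivWithin_congr h (h hx)]

theorem curl_inter {S N : Set ℂ} {α : ℂ → ℂ →L[ℝ] ℝ} {x : ℂ} (hN : N ∈ 𝓝 x) :
    curl (S ∩ N) α x = curl S α x := by
  rw [curl, curl, fderivWithin_inter hN]

theorem curl_sub {S : Set ℂ} {α β : ℂ → ℂ →L[ℝ] ℝ} {x : ℂ} (hS : UniqueDiffWithinAt ℝ S x)
    (hα : DifferentiableWithinAt ℝ α S x) (hβ : DifferentiableWithinAt ℝ β S x) :
    curl S (fun y => α y - β y) x = curl S α x - curl S β x := by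
  rw [curl, curl, curl, fderivWithin_fun_sub hS hα hβ]
  simp only [sub_apply]
  ring

theorem pullTwo_inter {E X : Type*} [NormedAddCommGroup E] [NormedSpace ℝ E]
    [TopologicalSpace X] [ChartedSpace E X]
    (f : (x : X) → TangentSpace 𝓘(ℝ, E) x →L[ℝ] TangentSpace 𝓘(ℝ, E) x →L[ℝ] ℝ) {S N : Set ℂ}
    {u : ℂ → X} {x : ℂ} (hN : N ∈ 𝓝 x) : pullTwo f (S ∩ N) u x = pullTwo f S u x := by
  rw [pullTwo, pullTwo, mfderivWithin_inter hN]

theorem pullTwo_congr {E X : Type*} [NormedAddCommGroup E] [NormedSpace ℝ E]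
    [TopologicalSpace X] [ChartedSpace E X]
    (f : (x : X) → TangentSpace 𝓘(ℝ, E) x →L[ℝ] TangentSpace 𝓘(ℝ, E) x →L[ℝ] ℝ) {S : Set ℂ}
    {u v : ℂ → X} (h : EqOn u v S) {x : ℂ} (hx : x ∈ S) :
    pullTwo f S u x = pullTwo f S v x := by
  have h1 := mfderivWithin_congr (I := 𝓘(ℝ, ℂ)) (I' := 𝓘(ℝ, E)) h (h hx)
  have h2 : ∀ y y' : X, y = y' → ∀ e e' : E, f y e e' = f y' e e' := by rintro y _ rfl e e'; rfl
  rw [pullTwo, pullTwo, h1]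
  exact h2 _ _ (h hx) _ _

variable {EQ EY EP : Type*}
  [NormedAddCommGroup EQ] [NormedSpace ℝ EQ] [NormedAddCommGroup EY] [NormedSpace ℝ EY]
  [NormedAddCommGroup EP] [NormedSpace ℝ EP]
  {Q Y : Type*} {P : Type u} [TopologicalSpace Q] [ChartedSpace EQ Q]
  [TopologicalSpace Y] [ChartedSpace EY Y] [IsManifold 𝓘(ℝ, EY) ∞ Y]
  [TopologicalSpace P] [ChartedSpace EP P] [IsManifold 𝓘(ℝ, EP) ∞ P] [MulAction Circle P]
  {G : BundleGerbe (EQ := EQ) (EY := EY) (EP := EP) Q Y P} {σ : Disk (E := EQ) Q}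

/-- The curving is compatible with the curvature of the connection up to the boundary. -/
theorem BundleGerbe.curl_pullOne (G : BundleGerbe (EQ := EQ) (EY := EY) (EP := EP) Q Y P)
    {U : Set ℂ} (hU : IsOpen U) {v : ℂ → P}
    (hv : ContMDiffOn 𝓘(ℝ, ℂ) 𝓘(ℝ, EP) ∞ v (unitDisk ∩ U)) :
    EqOn (curl (unitDisk ∩ U) (pullOne G.conn (unitDisk ∩ U) v))
      (fun x => pullTwo G.curving (unitDisk ∩ U) (fun y => G.tgt (v y)) x -
        pullTwo G.curving (unitDisk ∩ U) (fun y => G.src (v y)) x) (unitDisk ∩ U) := by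
  have hd := uniqueDiffOn_unitDisk_inter hU
  refine eqOn_unitDisk_inter hU (continuousOn_curl hd (contDiffOn_pullOne G.smooth_conn hd hv))
    ((contDiffOn_pullTwo G.smooth_curving hd (G.smooth_tgt.comp_contMDiffOn hv)).continuousOn.sub
      (contDiffOn_pullTwo G.smooth_curving hd (G.smooth_src.comp_contMDiffOn hv)).continuousOn)
    fun x hx => ?_
  have hn := mem_interior_iff_mem_nhds.1 hx
  have h := G.curving_eq v x (hv.contMDiffAt hn)
  have e1 : pullOne G.conn (unitDisk ∩ U) v =ᶠ[𝓝 x] pullOne G.conn univ v :=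
    (isOpen_interior.eventually_mem hx).mono fun y hy => by
      rw [pullOne, pullOne, mfderivWithin_of_mem_nhds (mem_interior_iff_mem_nhds.1 hy),
        mfderivWithin_univ]
  have e2 : ∀ w : ℂ → Y, pullTwo G.curving (unitDisk ∩ U) w x = pullTwo G.curving univ w x :=
    fun w => by rw [pullTwo, pullTwo, mfderivWithin_of_mem_nhds hn, mfderivWithin_univ]
  rw [e2, e2]
  refine Eq.trans ?_ h
  rw [curl, curl, fderivWithin_of_mem_nhds hn, fderivWithin_univ, e1.fderiv_eq]

namespace Trivialisation

variable (T T' : Trivialisation G σ)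

/-- The curl of the connection pulled back by the transition is the difference of the two curvings,
and also the difference of the curls of the two forms. This is the descent of `f - F_J` to the disk,
and frees `mu` from its choice of chart. -/
theorem mu_local_eq {k l : T.ι} {x : ℂ} (hx : x ∈ unitDisk) (hk : x ∈ T.U k) (hl : x ∈ T.U l) :
    pullTwo G.curving (unitDisk ∩ T.U k) (fun y => T.pt (T.sec k y)) x
      - curl (unitDisk ∩ T.U k) (T.form k) x =
    pullTwo G.curving (unitDisk ∩ T.U l) (fun y => T.pt (T.sec l y)) x
      - curl (unitDisk ∩ T.U l) (T.form l) x := by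
  have hW : IsOpen (T.U k ∩ T.U l) := (T.isOpen_U k).inter (T.isOpen_U l)
  have hS : x ∈ unitDisk ∩ (T.U k ∩ T.U l) := ⟨hx, hk, hl⟩
  have hd := uniqueDiffOn_unitDisk_inter hW
  have h := G.curl_pullOne hW (T.smooth_trans k l) hS
  rw [curl_congr (T.form_eq k l) hS, curl_sub (hd x hS)
    (((T.smooth_form k).mono fun y hy => ⟨hy.1, hy.2.1⟩).differentiableOn (by simp) x hS)
    (((T.smooth_form l).mono fun y hy => ⟨hy.1, hy.2.2⟩).differentiableOn (by simp) x hS)] at h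
  simp only at h
  rw [pullTwo_congr _ (fun y hy => T.tgt_trans k l hy) hS,
    pullTwo_congr _ (fun y hy => T.src_trans k l y hy) hS] at h
  have e1 : unitDisk ∩ (T.U k ∩ T.U l) = unitDisk ∩ T.U k ∩ T.U l := (inter_assoc _ _ _).symm
  have e2 : unitDisk ∩ (T.U k ∩ T.U l) = unitDisk ∩ T.U l ∩ T.U k := by
    rw [inter_assoc, inter_comm (T.U l)]
  have h1 := (T.isOpen_U k).mem_nhds hk
  have h2 := (T.isOpen_U l).mem_nhds hl
  rw [← curl_inter (S := unitDisk ∩ T.U k) h2, ← curl_inter (S := unitDisk ∩ T.U l) h1,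
    ← pullTwo_inter (S := unitDisk ∩ T.U k) _ h2, ← pullTwo_inter (S := unitDisk ∩ T.U l) _ h1,
    ← e1, ← e2]
  linarith

theorem mu_eq {k : T.ι} {x : ℂ} (hx : x ∈ unitDisk) (hk : x ∈ T.U k) :
    T.mu x = pullTwo G.curving (unitDisk ∩ T.U k) (fun y => T.pt (T.sec k y)) x
      - curl (unitDisk ∩ T.U k) (T.form k) x := by
  rw [mu, dif_pos hx]
  exact T.mu_local_eq hx (T.cover x hx).choose_spec hk

theorem continuousOn_mu : ContinuousOn T.mu unitDisk := by
  refine continuousOn_of_locally_continuousOn fun x hx => ?_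
  obtain ⟨k, hk⟩ := T.cover x hx
  have hd := uniqueDiffOn_unitDisk_inter (T.isOpen_U k)
  refine ⟨T.U k, T.isOpen_U k, hk, ContinuousOn.congr ?_ fun y hy => T.mu_eq hy.1 hy.2⟩
  exact (contDiffOn_pullTwo G.smooth_curving hd (T.smooth_sec k)).continuousOn.sub
    (continuousOn_curl hd (T.smooth_form k))

/-- The difference of the connections of two trivialisations over a disk: an isomorphism between
them, and the one-form by which it fails to preserve the connections. -/
structure Comparison (q : T.ι → T'.ι → ℂ → P) (η : ℂ → ℂ →L[ℝ] ℝ) : Prop where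
  isIso : T.cocycle.IsIso T'.cocycle unitDisk q
  smooth : ContDiffOn ℝ ∞ η unitDisk
  eq : ∀ k l, ∀ x ∈ unitDisk ∩ (T.U k ∩ T'.U l),
    η x = T.form k x - T'.form l x - pullOne G.conn (unitDisk ∩ (T.U k ∩ T'.U l)) (q k l) x

/-- An isomorphism exists because the disk is compact and convex. Its failure to preserve the
connections is one global form: changing a chart adds to the connection pulled back by `q` exactly
what it adds to the chart forms. -/
theorem exists_comparison : ∃ q η, Comparison T T' q η := by
  obtain ⟨y, -⟩ := G.surjective (σ.ext 0)
  have : Nonempty P := ⟨G.unit y⟩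
  obtain ⟨q, hq⟩ := LiftCocycle.exists_isIso_of_isCompact T.cocycle T'.cocycle (K := unitDisk)
    subset_rfl subset_rfl (isCompact_closedBall 0 1) (convex_closedBall 0 1)
  have hsm : ∀ k l, ContMDiffOn 𝓘(ℝ, ℂ) 𝓘(ℝ, EP) ∞ (q k l) (unitDisk ∩ (T.U k ∩ T'.U l)) := hq.smooth
  have hind : ∀ x ∈ unitDisk, ∀ k k' l l', x ∈ T.U k → x ∈ T.U k' → x ∈ T'.U l → x ∈ T'.U l' →
      T.form k x - T'.form l x - pullOne G.conn (unitDisk ∩ (T.U k ∩ T'.U l)) (q k l) x =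
      T.form k' x - T'.form l' x - pullOne G.conn (unitDisk ∩ (T.U k' ∩ T'.U l')) (q k' l') x := by
    intro x hx k k' l l' hk hk' hl hl'
    have e1 := G.pullOne_of_mul ((T.isOpen_U k).inter (T.isOpen_U k'))
      ((T.isOpen_U k').inter (T'.isOpen_U l)) ((T.isOpen_U k).inter (T'.isOpen_U l))
      (T.smooth_trans k k') (hsm k' l) (c := q k l) (fun y hy h1 h2 h3 => ⟨by
        rw [T.src_trans k k' y ⟨hy, h1⟩, hq.tgt k' l y ⟨hy, h2⟩]; rfl,
        hq.left k k' l y hy h1.1 h1.2 h2.2⟩) hx ⟨hk, hk'⟩ ⟨hk', hl⟩ ⟨hk, hl⟩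
    have e2 := G.pullOne_of_mul ((T.isOpen_U k').inter (T'.isOpen_U l))
      ((T'.isOpen_U l).inter (T'.isOpen_U l')) ((T.isOpen_U k').inter (T'.isOpen_U l'))
      (hsm k' l) (T'.smooth_trans l l') (c := q k' l') (fun y hy h1 h2 h3 => ⟨by
        rw [T'.tgt_trans l l' ⟨hy, h2⟩, hq.src k' l y ⟨hy, h1⟩]; rfl,
        hq.right k' l l' y hy h1.1 h2.1 h2.2⟩) hx ⟨hk', hl⟩ ⟨hl, hl'⟩ ⟨hk', hl'⟩
    rw [e1, e2, T.form_eq k k' x ⟨hx, hk, hk'⟩, T'.form_eq l l' x ⟨hx, hl, hl'⟩]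
    abel
  classical
  set η : ℂ → ℂ →L[ℝ] ℝ := fun x => if hx : x ∈ unitDisk then
    T.form (T.cocycle.idx hx) x - T'.form (T'.cocycle.idx hx) x -
      pullOne G.conn (unitDisk ∩ (T.U (T.cocycle.idx hx) ∩ T'.U (T'.cocycle.idx hx)))
        (q (T.cocycle.idx hx) (T'.cocycle.idx hx)) x else 0 with hη
  have heq : ∀ k l, ∀ x ∈ unitDisk ∩ (T.U k ∩ T'.U l),
    η x = T.form k x - T'.form l x -
      pullOne G.conn (unitDisk ∩ (T.U k ∩ T'.U l)) (q k l) x := fun k l x hx => by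
    simp only [hη, dif_pos hx.1]
    exact hind x hx.1 _ _ _ _ (T.cocycle.mem_idx hx.1) hx.2.1 (T'.cocycle.mem_idx hx.1) hx.2.2
  refine ⟨q, η, hq, contDiffOn_of_locally_contDiffOn fun x hx => ?_, heq⟩
  obtain ⟨k, hk⟩ := T.cover x hx
  obtain ⟨l, hl⟩ := T'.cover x hx
  have hW := (T.isOpen_U k).inter (T'.isOpen_U l)
  refine ⟨_, hW, ⟨hk, hl⟩, ContDiffOn.congr ?_ (heq k l)⟩
  exact (((T.smooth_form k).mono fun y hy => ⟨hy.1, hy.2.1⟩).sub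
    ((T'.smooth_form l).mono fun y hy => ⟨hy.1, hy.2.2⟩)).sub
    (contDiffOn_pullOne G.smooth_conn (uniqueDiffOn_unitDisk_inter hW) (hsm k l))

variable {T T'}

/-- Taking the curl of the defining equation of `η`, the pulled-back connection contributes the
difference of the two curvings. Together with the curls of the forms this is the difference of the
two-forms `mu`. -/
theorem Comparison.curl_eq {q : T.ι → T'.ι → ℂ → P} {η : ℂ → ℂ →L[ℝ] ℝ} (h : Comparison T T' q η)
    {x : ℂ} (hx : x ∈ unitDisk) : curl unitDisk η x = T'.mu x - T.mu x := by
  obtain ⟨k, hk⟩ := T.cover x hx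
  obtain ⟨l, hl⟩ := T'.cover x hx
  set W := T.U k ∩ T'.U l with hWdef
  have hW : IsOpen W := (T.isOpen_U k).inter (T'.isOpen_U l)
  have hn : W ∈ 𝓝 x := hW.mem_nhds ⟨hk, hl⟩
  have hS : x ∈ unitDisk ∩ W := ⟨hx, hk, hl⟩
  have hd := uniqueDiffOn_unitDisk_inter hW
  have hsm : ContMDiffOn 𝓘(ℝ, ℂ) 𝓘(ℝ, EP) ∞ (q k l) (unitDisk ∩ W) := h.isIso.smooth k l
  have hf := ((T.smooth_form k).mono (t := unitDisk ∩ W)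
    fun y hy => ⟨hy.1, hy.2.1⟩).differentiableOn (by simp) x hS
  have hf' := ((T'.smooth_form l).mono (t := unitDisk ∩ W)
    fun y hy => ⟨hy.1, hy.2.2⟩).differentiableOn (by simp) x hS
  have hp := (contDiffOn_pullOne G.smooth_conn hd hsm).differentiableOn (by simp) x hS
  have h1 := G.curl_pullOne hW hsm hS
  simp only at h1
  rw [pullTwo_congr _ (S := unitDisk ∩ W) (v := fun y => T.pt (T.sec k y))
      (fun y hy => h.isIso.tgt k l y hy) hS,
    pullTwo_congr _ (S := unitDisk ∩ W) (v := fun y => T'.pt (T'.sec l y))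
      (fun y hy => h.isIso.src k l y hy) hS] at h1
  have e1 : ∀ U : Set ℂ, W ⊆ U → ∀ α, curl (unitDisk ∩ U) α x = curl (unitDisk ∩ W) α x :=
    fun U hU α => by rw [← curl_inter hn, inter_assoc, inter_eq_self_of_subset_right hU]
  have e2 : ∀ U : Set ℂ, W ⊆ U → ∀ v, pullTwo G.curving (unitDisk ∩ U) v x =
      pullTwo G.curving (unitDisk ∩ W) v x :=
    fun U hU v => by rw [← pullTwo_inter _ hn, inter_assoc, inter_eq_self_of_subset_right hU]
  rw [T.mu_eq hx hk, T'.mu_eq hx hl, e1 _ inter_subset_left, e1 _ inter_subset_right,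
    e2 _ inter_subset_left, e2 _ inter_subset_right, ← curl_inter hn, curl_congr (h.eq k l) hS, ← hWdef,
    curl_sub (hd x hS) (hf.fun_sub hf') hp, curl_sub (hd x hS) hf hf', h1]
  ring

theorem Comparison.integral_eq {q : T.ι → T'.ι → ℂ → P} {η : ℂ → ℂ →L[ℝ] ℝ}
    (h : Comparison T T' q η) :
    ∫ t in (0 : ℝ)..1, η (circ t) (circVel t) = T'.integral - T.integral := by
  rw [← integral_curl_unitDisk h.smooth, integral, integral,
    ← MeasureTheory.integral_sub (T'.continuousOn_mu.integrableOn_compact (isCompact_closedBall 0 1))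
      (T.continuousOn_mu.integrableOn_compact (isCompact_closedBall 0 1))]
  exact MeasureTheory.setIntegral_congr_fun measurableSet_closedBall fun x hx => h.curl_eq hx

end Trivialisation

end

/-! ### Isomorphisms of trivialisations along the boundary circle -/

noncomputable section

universe u

theorem circ_mem (t : ℝ) : circ t ∈ unitDisk := circle_mem_unitDisk _

theorem norm_circ (t : ℝ) : ‖circ t‖ = 1 := Circle.norm_coe _

theorem contDiff_circ : ContDiff ℝ ∞ circ := by
  have h : circ = fun t : ℝ => Complex.exp ((2 * Real.pi * t : ℝ) * Complex.I) := funext circ_eq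
  rw [h]
  exact Complex.contDiff_exp.comp
    ((Complex.ofRealCLM.contDiff.comp (contDiff_const.mul contDiff_id)).mul contDiff_const)

theorem contDiff_circVel : ContDiff ℝ ∞ circVel := contDiff_const.mul contDiff_circ

theorem isOpen_circ_preimage {U : Set ℂ} (hU : IsOpen U) : IsOpen (circ ⁻¹' U) :=
  hU.preimage contDiff_circ.continuous

theorem vel_congr {E : Type*} [NormedAddCommGroup E] [NormedSpace ℝ E]
    {X : Type*} [TopologicalSpace X] [ChartedSpace E X] {W : Type*} [NormedAddCommGroup W]
    [NormedSpace ℝ W] (θ : (x : X) → TangentSpace 𝓘(ℝ, E) x →L[ℝ] W) {c c' : ℝ → X} {t : ℝ}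
    (h : c =ᶠ[𝓝 t] c') : θ _ (vel c t) = θ _ (vel c' t) := by
  have h1 := h.mfderiv_eq (I := 𝓘(ℝ, ℝ)) (I' := 𝓘(ℝ, E))
  have h2 : ∀ y y' : X, y = y' → ∀ e : E, θ y e = θ y' e := by rintro y _ rfl e; rfl
  rw [vel, vel, h1]
  exact h2 _ _ h.eq_of_nhds _

variable {EQ EY EP : Type*}
  [NormedAddCommGroup EQ] [NormedSpace ℝ EQ] [NormedAddCommGroup EY] [NormedSpace ℝ EY]
  [NormedAddCommGroup EP] [NormedSpace ℝ EP]
  {Q Y : Type*} {P : Type u} [TopologicalSpace Q] [ChartedSpace EQ Q]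
  [TopologicalSpace Y] [ChartedSpace EY Y] [IsManifold 𝓘(ℝ, EY) ∞ Y]
  [TopologicalSpace P] [ChartedSpace EP P] [IsManifold 𝓘(ℝ, EP) ∞ P] [MulAction Circle P]
  {G : BundleGerbe (EQ := EQ) (EY := EY) (EP := EP) Q Y P}

theorem pullOne_circ (G : BundleGerbe (EQ := EQ) (EY := EY) (EP := EP) Q Y P) {U : Set ℂ}
    (hU : IsOpen U) {v : ℂ → P}
    (hv : ContMDiffOn 𝓘(ℝ, ℂ) 𝓘(ℝ, EP) ∞ v (unitDisk ∩ U)) {t : ℝ} (ht : circ t ∈ U) :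
    pullOne G.conn (unitDisk ∩ U) v (circ t) (circVel t) =
      G.conn _ (vel (fun s => v (circ s)) t) := by
  have h := vel_comp (hasDerivAt_circ t) (S := unitDisk ∩ U) (u := v)
    ((hv _ ⟨circ_mem t, ht⟩).mdifferentiableWithinAt (by simp))
    (((isOpen_circ_preimage hU).eventually_mem ht).mono fun s hs => ⟨circ_mem s, hs⟩)
  rw [h]
  rfl

variable {σ₁ σ₂ σ₃ : Disk (E := EQ) Q}

namespace Trivialisation

/-- The connection form along the boundary circle. -/
def loopForm (T : Trivialisation G σ₁) (k : T.ι) (t : ℝ) : ℝ := T.form k (circ t) (circVel t)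

theorem conn_trans_circ (T : Trivialisation G σ₁) (k l : T.ι) {t : ℝ} (hk : circ t ∈ T.U k)
    (hl : circ t ∈ T.U l) :
    G.conn _ (vel (fun s => T.trans k l (circ s)) t) = T.loopForm k t - T.loopForm l t := by
  rw [← pullOne_circ G ((T.isOpen_U k).inter (T.isOpen_U l)) (T.smooth_trans k l) ⟨hk, hl⟩,
    T.form_eq k l _ ⟨circ_mem t, hk, hl⟩]
  rfl

/-- An isomorphism of trivialisations over the boundary circle, in terms of local sections.  It
preserves the connections up to the one-form `d`. -/
structure LoopIso (T₁ : Trivialisation G σ₁) (T₂ : Trivialisation G σ₂)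
    (q : T₁.ι → T₂.ι → ℝ → P) (d : ℝ → ℝ) : Prop where
  smooth : ∀ k l, ContMDiffOn 𝓘(ℝ, ℝ) 𝓘(ℝ, EP) ∞ (q k l) (circ ⁻¹' (T₁.U k ∩ T₂.U l))
  tgt : ∀ k l t, circ t ∈ T₁.U k → circ t ∈ T₂.U l → G.tgt (q k l t) = T₁.pt (T₁.sec k (circ t))
  src : ∀ k l t, circ t ∈ T₁.U k → circ t ∈ T₂.U l → G.src (q k l t) = T₂.pt (T₂.sec l (circ t))
  left : ∀ k k' l t, circ t ∈ T₁.U k → circ t ∈ T₁.U k' → circ t ∈ T₂.U l →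
    G.mul (T₁.trans k k' (circ t)) (q k' l t) = q k l t
  right : ∀ k l l' t, circ t ∈ T₁.U k → circ t ∈ T₂.U l → circ t ∈ T₂.U l' →
    G.mul (q k l t) (T₂.trans l l' (circ t)) = q k l' t
  form_eq : ∀ k l t, circ t ∈ T₁.U k → circ t ∈ T₂.U l →
    G.conn _ (vel (q k l) t) = T₁.loopForm k t - T₂.loopForm l t - d t
  periodic : ∀ k l t, circ t ∈ T₁.U k → circ t ∈ T₂.U l → q k l (t + 1) = q k l t

theorem Comparison.loopIso {T T' : Trivialisation G σ₁} {q : T.ι → T'.ι → ℂ → P}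
    {η : ℂ → ℂ →L[ℝ] ℝ} (h : Comparison T T' q η) :
    LoopIso T T' (fun k l t => q k l (circ t)) (fun t => η (circ t) (circVel t)) where
  smooth k l := (h.isIso.smooth k l).comp contDiff_circ.contMDiff.contMDiffOn
    fun t ht => ⟨circ_mem t, ht⟩
  tgt k l t hk hl := h.isIso.tgt k l _ ⟨circ_mem t, hk, hl⟩
  src k l t hk hl := h.isIso.src k l _ ⟨circ_mem t, hk, hl⟩
  left k k' l t := h.isIso.left k k' l _ (circ_mem t)
  right k l l' t := h.isIso.right k l l' _ (circ_mem t)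
  form_eq k l t hk hl := by
    rw [← pullOne_circ G ((T.isOpen_U k).inter (T'.isOpen_U l)) (h.isIso.smooth k l) ⟨hk, hl⟩,
      h.eq k l _ ⟨circ_mem t, hk, hl⟩]
    simp [loopForm]
  periodic k l t _ _ := by rw [circ_add_one]

end Trivialisation

/-- The local unit vectors are determined by the global map because the action on `J` is free. So
the equivariance of the map gives the compatibilities, and the vectors depend on the point of the
circle only, hence are periodic. -/
theorem BoundaryIso.loopIso {T₁ : Trivialisation G σ₁} {T₂ : Trivialisation G σ₂}
    (β : BoundaryIso T₁ T₂) : T₁.LoopIso T₂ β.trans 0 := by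
  have hb : ∀ k t, circ t ∈ T₁.U k → ‖T₁.base (T₁.sec k (circ t))‖ = 1 := fun k t hk => by
    rw [T₁.base_sec k _ ⟨circ_mem t, hk⟩, norm_circ]
  have tgt : ∀ k l t, circ t ∈ T₁.U k → circ t ∈ T₂.U l →
      G.tgt (β.trans k l t) = T₁.pt (T₁.sec k (circ t)) := fun k l t hk hl => by
    rw [← T₂.pt_lmul _ _ (β.src_trans k l t ⟨hk, hl⟩), β.lmul_trans k l t ⟨hk, hl⟩,
      β.pt_eq _ (hb k t hk)]
  refine ⟨β.smooth_trans, tgt, fun k l t hk hl => β.src_trans k l t ⟨hk, hl⟩, ?_, ?_, ?_, ?_⟩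
  · intro k k' l t hk hk' hl
    have e1 : G.src (T₁.trans k k' (circ t)) = G.tgt (β.trans k' l t) := by
      rw [T₁.src_trans k k' _ ⟨circ_mem t, hk, hk'⟩, tgt k' l t hk' hl]
    have e2 := β.src_trans k' l t ⟨hk', hl⟩
    refine T₂.lmul_cancel (j := T₂.sec l (circ t)) ((G.src_mul _ _ e1).trans e2)
      (β.src_trans k l t ⟨hk, hl⟩) ?_
    rw [T₂.mul_lmul _ _ _ e1 e2, β.lmul_trans k' l t ⟨hk', hl⟩, β.lmul_trans k l t ⟨hk, hl⟩,
      ← β.lmul_eq _ _ (hb k' t hk') (T₁.src_trans k k' _ ⟨circ_mem t, hk, hk'⟩),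
      T₁.lmul_trans k k' _ ⟨circ_mem t, hk, hk'⟩]
  · intro k l l' t hk hl hl'
    have e1 : G.src (β.trans k l t) = G.tgt (T₂.trans l l' (circ t)) := by
      rw [T₂.tgt_trans l l' ⟨circ_mem t, hl, hl'⟩, β.src_trans k l t ⟨hk, hl⟩]
    have e2 := T₂.src_trans l l' _ ⟨circ_mem t, hl, hl'⟩
    refine T₂.lmul_cancel (j := T₂.sec l' (circ t)) ((G.src_mul _ _ e1).trans e2)
      (β.src_trans k l' t ⟨hk, hl'⟩) ?_
    rw [T₂.mul_lmul _ _ _ e1 e2, T₂.lmul_trans l l' _ ⟨circ_mem t, hl, hl'⟩,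
      β.lmul_trans k l t ⟨hk, hl⟩, β.lmul_trans k l' t ⟨hk, hl'⟩]
  · intro k l t hk hl
    rw [β.form_eq k l t ⟨hk, hl⟩]
    simp [Trivialisation.loopForm]
  · intro k l t hk hl
    have h1 : circ (t + 1) ∈ T₁.U k ∩ T₂.U l := by rw [circ_add_one]; exact ⟨hk, hl⟩
    have e1 := β.src_trans k l (t + 1) h1
    have e2 := β.lmul_trans k l (t + 1) h1
    rw [circ_add_one] at e1 e2
    exact T₂.lmul_cancel e1 (β.src_trans k l t ⟨hk, hl⟩)
      (e2.trans (β.lmul_trans k l t ⟨hk, hl⟩).symm)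

namespace Trivialisation

variable {T₁ : Trivialisation G σ₁} {T₂ : Trivialisation G σ₂} {T₃ : Trivialisation G σ₃}

theorem LoopIso.contMDiffAt {q : T₁.ι → T₂.ι → ℝ → P} {d : ℝ → ℝ} (h : T₁.LoopIso T₂ q d)
    {k : T₁.ι} {l : T₂.ι} {t : ℝ} (hk : circ t ∈ T₁.U k) (hl : circ t ∈ T₂.U l) :
    ContMDiffAt 𝓘(ℝ, ℝ) 𝓘(ℝ, EP) ∞ (q k l) t :=
  (h.smooth k l).contMDiffAt
    ((isOpen_circ_preimage ((T₁.isOpen_U k).inter (T₂.isOpen_U l))).mem_nhds ⟨hk, hl⟩)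

/-- The product through a middle chart does not depend on that chart, since the transition between
two of them is absorbed on either side. Additivity of the connection under the product adds the
defects. -/
theorem LoopIso.comp {q : T₁.ι → T₂.ι → ℝ → P} {d : ℝ → ℝ} (h : T₁.LoopIso T₂ q d)
    {q' : T₂.ι → T₃.ι → ℝ → P} {d' : ℝ → ℝ} (h' : T₂.LoopIso T₃ q' d') :
    ∃ q'', T₁.LoopIso T₃ q'' (fun t => d t + d' t) := by
  have st : ∀ k l m t, circ t ∈ T₁.U k → circ t ∈ T₂.U l → circ t ∈ T₃.U m →
      G.src (q k l t) = G.tgt (q' l m t) := fun k l m t hk hl hm => by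
    rw [h.src k l t hk hl, h'.tgt l m t hl hm]
  have ind : ∀ k l l' m t, circ t ∈ T₁.U k → circ t ∈ T₂.U l → circ t ∈ T₂.U l' →
      circ t ∈ T₃.U m → G.mul (q k l t) (q' l m t) = G.mul (q k l' t) (q' l' m t) :=
    fun k l l' m t hk hl hl' hm => by
      rw [← h.right k l l' t hk hl hl', G.mul_assoc, h'.left l l' m t hl hl' hm]
      · rw [h.src k l t hk hl, T₂.tgt_trans l l' ⟨circ_mem t, hl, hl'⟩]
      · rw [h'.tgt l' m t hl' hm, T₂.src_trans l l' _ ⟨circ_mem t, hl, hl'⟩]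
  -- The chosen middle chart may jump with `t`. For smoothness and derivatives it is frozen near
  -- each parameter by `heq`.
  set i : ℝ → T₂.ι := fun t => T₂.cocycle.idx (circ_mem t)
  have hi : ∀ t, circ t ∈ T₂.U (i t) := fun t => T₂.cocycle.mem_idx (circ_mem t)
  set r : T₁.ι → T₃.ι → ℝ → P := fun k m t => G.mul (q k (i t) t) (q' (i t) m t) with hr
  have heq : ∀ k l m t, circ t ∈ T₁.U k → circ t ∈ T₂.U l → circ t ∈ T₃.U m →
      r k m t = G.mul (q k l t) (q' l m t) := fun k l m t hk hl hm =>
    ind k (i t) l m t hk (hi t) hl hm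
  have hop : ∀ k l m, IsOpen (circ ⁻¹' (T₁.U k ∩ (T₂.U l ∩ T₃.U m))) := fun k l m =>
    isOpen_circ_preimage ((T₁.isOpen_U k).inter ((T₂.isOpen_U l).inter (T₃.isOpen_U m)))
  refine ⟨r, fun k m => ?_, fun k m t hk hm => ?_, fun k m t hk hm => ?_, fun k k' m t hk hk' hm => ?_,
    fun k m m' t hk hm hm' => ?_, fun k m t hk hm => ?_, fun k m t hk hm => ?_⟩
  · refine contMDiffOn_of_locally_contMDiffOn fun t ht => ?_
    refine ⟨_, hop k (i t) m, ⟨ht.1, hi t, ht.2⟩, ContMDiffOn.congr ?_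
      fun s hs => heq k (i t) m s hs.2.1 hs.2.2.1 hs.2.2.2⟩
    exact G.contMDiffOn_mul ((h.smooth k (i t)).mono fun s hs => ⟨hs.2.1, hs.2.2.1⟩)
      ((h'.smooth (i t) m).mono fun s hs => ⟨hs.2.2.1, hs.2.2.2⟩)
      fun s hs => st k (i t) m s hs.2.1 hs.2.2.1 hs.2.2.2
  · rw [heq k (i t) m t hk (hi t) hm, G.tgt_mul _ _ (st k _ m t hk (hi t) hm), h.tgt k _ t hk (hi t)]
  · rw [heq k (i t) m t hk (hi t) hm, G.src_mul _ _ (st k _ m t hk (hi t) hm), h'.src _ m t (hi t) hm]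
  · rw [heq k (i t) m t hk (hi t) hm, heq k' (i t) m t hk' (hi t) hm, ← G.mul_assoc,
      h.left k k' _ t hk hk' (hi t)]
    · rw [T₁.src_trans k k' _ ⟨circ_mem t, hk, hk'⟩, h.tgt k' _ t hk' (hi t)]
    · exact st k' _ m t hk' (hi t) hm
  · rw [heq k (i t) m t hk (hi t) hm, heq k (i t) m' t hk (hi t) hm', G.mul_assoc,
      h'.right _ m m' t (hi t) hm hm']
    · exact st k _ m t hk (hi t) hm
    · rw [h'.src _ m t (hi t) hm, T₃.tgt_trans m m' ⟨circ_mem t, hm, hm'⟩]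
  · have e : r k m =ᶠ[𝓝 t] fun s => G.mul (q k (i t) s) (q' (i t) m s) :=
      ((hop k (i t) m).eventually_mem ⟨hk, hi t, hm⟩).mono fun s hs =>
        heq k (i t) m s hs.1 hs.2.1 hs.2.2
    rw [vel_congr G.conn e, G.conn_mul _ _ t (h.contMDiffAt hk (hi t)) (h'.contMDiffAt (hi t) hm)
      (((hop k (i t) m).eventually_mem ⟨hk, hi t, hm⟩).mono fun s hs => st k (i t) m s hs.1 hs.2.1 hs.2.2),
      h.form_eq k _ t hk (hi t), h'.form_eq _ m t (hi t) hm]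
    ring
  · rw [heq k (i t) m t hk (hi t) hm, heq k (i t) m (t + 1) (by rwa [circ_add_one])
      (by rw [circ_add_one]; exact hi t) (by rwa [circ_add_one]), h.periodic k _ t hk (hi t),
      h'.periodic _ m t (hi t) hm]

/-- The cocycle along the boundary circle. -/
def loopCocycle (T : Trivialisation G σ₁) (γ : ℝ → Q) (hγ : ∀ t, σ₁.ext (circ t) = γ t) :
    LiftCocycle G (univ : Set ℝ) γ where
  ι := T.ι
  U k := circ ⁻¹' T.U k
  isOpen_U k := isOpen_circ_preimage (T.isOpen_U k)
  cover t _ := T.cover _ (circ_mem t)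
  lift k t := T.pt (T.sec k (circ t))
  smooth_lift k := (T.smooth_sec k).comp contDiff_circ.contMDiff.contMDiffOn
    fun t ht => ⟨circ_mem t, ht.2⟩
  proj_lift k t ht := by rw [T.proj_pt, T.base_sec k _ ⟨circ_mem t, ht.2⟩, hγ]
  trans k l t := T.trans k l (circ t)
  smooth_trans k l := (T.smooth_trans k l).comp contDiff_circ.contMDiff.contMDiffOn
    fun t ht => ⟨circ_mem t, ht.2⟩
  tgt_trans k l t ht := T.tgt_trans k l ⟨circ_mem t, ht.2⟩
  src_trans k l t ht := T.src_trans k l _ ⟨circ_mem t, ht.2⟩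
  mul_trans k l m t _ := T.cocycle.mul_trans k l m _ (circ_mem t)

theorem LoopIso.isIso {q : T₁.ι → T₂.ι → ℝ → P} {d : ℝ → ℝ} (h : T₁.LoopIso T₂ q d) {γ : ℝ → Q}
    (h₁ : ∀ t, σ₁.ext (circ t) = γ t) (h₂ : ∀ t, σ₂.ext (circ t) = γ t) :
    (T₁.loopCocycle γ h₁).IsIso (T₂.loopCocycle γ h₂) univ q where
  smooth k l := (h.smooth k l).mono fun _ ht => ht.2
  tgt k l t ht := h.tgt k l t ht.2.1 ht.2.2
  src k l t ht := h.src k l t ht.2.1 ht.2.2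
  left k k' l t _ := h.left k k' l t
  right k l l' t _ := h.right k l l' t

/-- On the line the two isomorphisms differ by `exp (i θ)`, and `d - d'` is the derivative of `θ`.
Both are periodic, so the values of `θ` at `0` and `1` have the same exponential. -/
theorem LoopIso.exp_integral_eq {q q' : T₁.ι → T₂.ι → ℝ → P} {d d' : ℝ → ℝ}
    (h : T₁.LoopIso T₂ q d) (h' : T₁.LoopIso T₂ q' d')
    (hσ : ∀ t, σ₁.ext (circ t) = σ₂.ext (circ t)) :
    Circle.exp (∫ t in (0 : ℝ)..1, (d t - d' t)) = 1 := by
  obtain ⟨z, hz, hzq⟩ := LiftCocycle.IsIso.exists_ratio subset_rfl subset_rfl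
    (h.isIso hσ fun _ => rfl) (h'.isIso hσ fun _ => rfl)
  obtain ⟨θ, hθ, hθz⟩ := exists_log convex_univ hz
  rw [contDiffOn_univ] at hθ
  have hzq' : ∀ k l t, circ t ∈ T₁.U k → circ t ∈ T₂.U l →
      Circle.exp (θ t) • q k l t = q' k l t := fun k l t hk hl => by
    rw [hθz t trivial]; exact hzq k l t ⟨trivial, hk, hl⟩
  have hd : ∀ t, d t - d' t = deriv θ t := fun t => by
    obtain ⟨k, hk⟩ := T₁.cover _ (circ_mem t)
    obtain ⟨l, hl⟩ := T₂.cover _ (circ_mem t)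
    have e : (fun s => Circle.exp (θ s) • q k l s) =ᶠ[𝓝 t] q' k l :=
      ((isOpen_circ_preimage ((T₁.isOpen_U k).inter (T₂.isOpen_U l))).eventually_mem
        ⟨hk, hl⟩).mono fun s hs => hzq' k l s hs.1 hs.2
    have e1 := G.conn_smul (q k l) θ t (h.contMDiffAt hk hl) hθ.contDiffAt
    rw [vel_congr G.conn e, h.form_eq k l t hk hl, h'.form_eq k l t hk hl] at e1
    linarith
  simp only [hd]
  rw [intervalIntegral.integral_deriv_eq_sub (fun t _ => hθ.differentiable (by simp) t)
    ((hθ.continuous_deriv (by simp)).intervalIntegrable _ _), Circle.exp_sub]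
  obtain ⟨k, hk⟩ := T₁.cover _ (circ_mem 0)
  obtain ⟨l, hl⟩ := T₂.cover _ (circ_mem 0)
  have hk' : circ 1 ∈ T₁.U k := by rw [← zero_add (1 : ℝ), circ_add_one]; exact hk
  have hl' : circ 1 ∈ T₂.U l := by rw [← zero_add (1 : ℝ), circ_add_one]; exact hl
  have e2 := h.periodic k l 0 hk hl
  have e3 := h'.periodic k l 0 hk hl
  rw [zero_add] at e2 e3
  have : Circle.exp (θ 1) = Circle.exp (θ 0) := by
    refine G.smul_left_inj (p := q k l 0) ?_
    rw [hzq' k l 0 hk hl, ← e3, ← hzq' k l 1 hk' hl', e2]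
  rw [this, div_self']

end Trivialisation

end

/-! ### Independence of the sphere holonomy, and isomorphisms from local data -/

noncomputable section

universe u

variable {EQ EY EP : Type*}
  [NormedAddCommGroup EQ] [NormedSpace ℝ EQ] [NormedAddCommGroup EY] [NormedSpace ℝ EY]
  [NormedAddCommGroup EP] [NormedSpace ℝ EP]
  {Q Y : Type*} {P : Type u} [TopologicalSpace Q] [ChartedSpace EQ Q]
  [TopologicalSpace Y] [ChartedSpace EY Y] [IsManifold 𝓘(ℝ, EY) ∞ Y]
  [TopologicalSpace P] [ChartedSpace EP P] [IsManifold 𝓘(ℝ, EP) ∞ P] [MulAction Circle P]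
  {G : BundleGerbe (EQ := EQ) (EY := EY) (EP := EP) Q Y P} {σ₁ σ₂ σ₃ : Disk (E := EQ) Q}

namespace Trivialisation

variable {T₁ T₁' : Trivialisation G σ₁} {T₂ T₂' : Trivialisation G σ₂}

/-- There are two routes from `T₁` to `T₂'`, through `T₁'` and through `T₂`. Their defects are the
comparison forms of the first and of the second disk, so these have boundary integrals equal modulo
`2π`. Stokes' theorem turns them into differences of integrals of `mu`. -/
theorem LoopIso.exp_integral_sub_eq {q : T₁.ι → T₂.ι → ℝ → P} {q' : T₁'.ι → T₂'.ι → ℝ → P}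
    (h : T₁.LoopIso T₂ q 0) (h' : T₁'.LoopIso T₂' q' 0)
    (hσ : ∀ t, σ₁.ext (circ t) = σ₂.ext (circ t)) :
    Complex.exp (Complex.I * (T₁.integral - T₂.integral)) =
      Complex.exp (Complex.I * (T₁'.integral - T₂'.integral)) := by
  obtain ⟨q₁, η₁, h₁⟩ := exists_comparison T₁ T₁'
  obtain ⟨q₂, η₂, h₂⟩ := exists_comparison T₂ T₂'
  obtain ⟨r, hr⟩ := h₁.loopIso.comp h'
  obtain ⟨r', hr'⟩ := h.comp h₂.loopIso
  have key := hr.exp_integral_eq hr' hσ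
  have hc : ∀ {η : ℂ → ℂ →L[ℝ] ℝ}, ContDiffOn ℝ ∞ η unitDisk →
      Continuous fun t => η (circ t) (circVel t) := fun {η} hη =>
    (hη.continuousOn.comp_continuous contDiff_circ.continuous circ_mem).clm_apply
      contDiff_circVel.continuous
  simp only [Pi.zero_apply, add_zero, zero_add] at key
  rw [intervalIntegral.integral_sub ((hc h₁.smooth).intervalIntegrable _ _)
    ((hc h₂.smooth).intervalIntegrable _ _), h₁.integral_eq, h₂.integral_eq] at key
  have key' := congrArg (fun z : Circle => (z : ℂ)) key
  simp only [Circle.coe_exp, Circle.coe_one] at key'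
  rw [← mul_one (Complex.exp (Complex.I * (T₁.integral - T₂.integral))), ← key', ← Complex.exp_add]
  congr 1
  push_cast
  ring

/-- Not an axiom: some `p` fixes `j`, and the unit is absorbed into `p`. -/
theorem lmul_unit (T : Trivialisation G σ₁) (j : T.J) : T.lmul (G.unit (T.pt j)) j = j := by
  obtain ⟨p, hp, hpj⟩ := T.exists_lmul_eq (rfl : T.base j = T.base j)
  have ht : G.tgt p = T.pt j := by rw [← T.pt_lmul p j hp, hpj]
  have h := T.mul_lmul (G.unit (T.pt j)) p j (by rw [G.src_unit, ht]) hp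
  rwa [G.unit_mul ht, hpj, eq_comm] at h

end Trivialisation

theorem circ_eq_circ {s t : ℝ} (h : circ s = circ t) : ∃ n : ℤ, s = t + n := by
  obtain ⟨n, hn⟩ := Circle.exp_eq_exp.1 (Circle.ext h)
  exact ⟨n, by
    have : 2 * Real.pi * (s - (t + n)) = 0 := by linarith
    have hp := Real.pi_pos
    have := (mul_eq_zero.1 this).resolve_left (by positivity)
    linarith⟩

theorem circ_add_int (t : ℝ) (n : ℤ) : circ (t + n) = circ t := by
  have h : Function.Periodic circ 1 := circ_add_one
  simpa using h.int_mul n t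

theorem exists_circ_eq {z : ℂ} (hz : ‖z‖ = 1) : ∃ t, circ t = z := by
  refine ⟨z.arg / (2 * Real.pi), ?_⟩
  have : 2 * Real.pi * (z.arg / (2 * Real.pi)) = z.arg := by
    have := Real.pi_pos
    field_simp
  rw [circ_eq, this]
  simpa [hz] using Complex.norm_mul_exp_arg_mul_I z

namespace Trivialisation

variable {T₁ : Trivialisation G σ₁} {T₂ : Trivialisation G σ₂} {T₃ : Trivialisation G σ₃}

theorem LoopIso.eq_of_circ_eq {q : T₁.ι → T₂.ι → ℝ → P} {d : ℝ → ℝ} (h : T₁.LoopIso T₂ q d)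
    {k : T₁.ι} {l : T₂.ι} {s t : ℝ} (hk : circ t ∈ T₁.U k) (hl : circ t ∈ T₂.U l)
    (hst : circ s = circ t) : q k l s = q k l t := by
  obtain ⟨n, rfl⟩ := circ_eq_circ hst
  clear hst
  induction n using Int.induction_on with
  | zero => simp
  | succ i ih =>
    rw [← ih]
    push_cast
    rw [← add_assoc]
    exact h.periodic k l _ (by rw [← Int.cast_natCast, circ_add_int]; exact hk)
      (by rw [← Int.cast_natCast, circ_add_int]; exact hl)
  | pred i ih =>
    rw [← ih, ← h.periodic k l _ (by rw [circ_add_int]; exact hk) (by rw [circ_add_int]; exact hl)]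
    congr 1
    push_cast
    ring

/-- Every vector of the first bundle over the circle is an arrow `p` applied to a local section. It
is sent to the product of `p` with the local unit vector, applied to a local section of the second
bundle. -/
theorem LoopIso.nonempty_boundaryIso {q : T₁.ι → T₂.ι → ℝ → P} (h : T₁.LoopIso T₂ q 0) :
    Nonempty (BoundaryIso T₁ T₂) := by
  have st : ∀ k l t p, circ t ∈ T₁.U k → circ t ∈ T₂.U l → G.src p = T₁.pt (T₁.sec k (circ t)) →
      G.src p = G.tgt (q k l t) := fun k l t p hk hl hp => by rw [hp, h.tgt k l t hk hl]
  have st' : ∀ k l t p, circ t ∈ T₁.U k → circ t ∈ T₂.U l → G.src p = T₁.pt (T₁.sec k (circ t)) →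
      G.src (G.mul p (q k l t)) = T₂.pt (T₂.sec l (circ t)) := fun k l t p hk hl hp => by
    rw [G.src_mul _ _ (st k l t p hk hl hp), h.src k l t hk hl]
  -- Independence of all choices, including the parameter `t` of the point of the circle, where
  -- periodicity enters.
  have uniq : ∀ k l t p k' l' t' p', circ t ∈ T₁.U k → circ t ∈ T₂.U l →
      G.src p = T₁.pt (T₁.sec k (circ t)) → circ t' = circ t → circ t ∈ T₁.U k' → circ t ∈ T₂.U l' →
      G.src p' = T₁.pt (T₁.sec k' (circ t')) →
      T₁.lmul p (T₁.sec k (circ t)) = T₁.lmul p' (T₁.sec k' (circ t')) →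
      T₂.lmul (G.mul p' (q k' l' t')) (T₂.sec l' (circ t')) =
        T₂.lmul (G.mul p (q k l t)) (T₂.sec l (circ t)) := by
    intro k l t p k' l' t' p' hk hl hp htt hk' hl' hp' hj
    rw [h.eq_of_circ_eq hk' hl' htt]
    rw [htt] at hp' hj ⊢
    have hm := circ_mem t
    have e1 : G.src p = G.tgt (T₁.trans k k' (circ t)) := by rw [hp, T₁.tgt_trans k k' ⟨hm, hk, hk'⟩]
    have e2 := T₁.src_trans k k' _ ⟨hm, hk, hk'⟩
    have e3 : p' = G.mul p (T₁.trans k k' (circ t)) := by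
      refine T₁.lmul_cancel hp' ((G.src_mul _ _ e1).trans e2) ?_
      rw [T₁.mul_lmul _ _ _ e1 e2, T₁.lmul_trans k k' _ ⟨hm, hk, hk'⟩, hj]
    rw [e3, G.mul_assoc _ _ _ e1 (by rw [e2, h.tgt k' l' t hk' hl']), h.left k k' l' t hk hk' hl',
      ← h.right k l l' t hk hl hl', ← T₂.lmul_trans l l' _ ⟨hm, hl, hl'⟩]
    have e4 : G.src (q k l t) = G.tgt (T₂.trans l l' (circ t)) := by
      rw [h.src k l t hk hl, T₂.tgt_trans l l' ⟨hm, hl, hl'⟩]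
    rw [← G.mul_assoc _ _ _ (st k l t p hk hl hp) e4, T₂.mul_lmul]
    · rw [G.src_mul _ _ (st k l t p hk hl hp), e4]
    · exact T₂.src_trans l l' _ ⟨hm, hl, hl'⟩
  have ex : ∀ j, ‖T₁.base j‖ = 1 → ∃ k l t p, circ t = T₁.base j ∧ circ t ∈ T₁.U k ∧
      circ t ∈ T₂.U l ∧ G.src p = T₁.pt (T₁.sec k (circ t)) ∧ T₁.lmul p (T₁.sec k (circ t)) = j := by
    intro j hj
    obtain ⟨t, ht⟩ := exists_circ_eq hj
    obtain ⟨k, hk⟩ := T₁.cover _ (circ_mem t)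
    obtain ⟨l, hl⟩ := T₂.cover _ (circ_mem t)
    obtain ⟨p, hp, hpj⟩ := T₁.exists_lmul_eq (j := T₁.sec k (circ t)) (j' := j)
      (by rw [T₁.base_sec k _ ⟨circ_mem t, hk⟩, ht])
    exact ⟨k, l, t, p, ht, hk, hl, hp, hpj⟩
  have hdef : ∀ j, ∃ j', ‖T₁.base j‖ = 1 → ∀ k l t p, circ t ∈ T₁.U k → circ t ∈ T₂.U l →
      G.src p = T₁.pt (T₁.sec k (circ t)) → T₁.lmul p (T₁.sec k (circ t)) = j →
      T₂.lmul (G.mul p (q k l t)) (T₂.sec l (circ t)) = j' := by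
    intro j
    by_cases hj : ‖T₁.base j‖ = 1
    · obtain ⟨k, l, t, p, ht, hk, hl, hp, hpj⟩ := ex j hj
      refine ⟨T₂.lmul (G.mul p (q k l t)) (T₂.sec l (circ t)),
        fun _ k' l' t' p' hk' hl' hp' hpj' => ?_⟩
      have htt : circ t' = circ t := by
        rw [ht, ← hpj', T₁.base_lmul _ _ hp', T₁.base_sec _ _ ⟨circ_mem t', hk'⟩]
      exact uniq k l t p k' l' t' p' hk hl hp htt (htt ▸ hk') (htt ▸ hl') hp' (hpj.trans hpj'.symm)
    · obtain ⟨l, -⟩ := T₂.cover _ (circ_mem 0)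
      exact ⟨T₂.sec l 0, fun h => absurd h hj⟩
  choose f hf using hdef
  refine ⟨{
    toFun := f
    base_eq := fun j hj => ?_
    pt_eq := fun j hj => ?_
    rot_eq := fun z j hj => ?_
    lmul_eq := fun p' j hj hp' => ?_
    trans := q
    smooth_trans := h.smooth
    src_trans := fun k l t ht => h.src k l t ht.1 ht.2
    lmul_trans := fun k l t ht => ?_
    form_eq := fun k l t ht => by simpa [loopForm] using h.form_eq k l t ht.1 ht.2 }⟩
  · obtain ⟨k, l, t, p, ht, hk, hl, hp, hpj⟩ := ex j hj
    rw [← hf j hj k l t p hk hl hp hpj, T₂.base_lmul _ _ (st' k l t p hk hl hp),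
      T₂.base_sec l _ ⟨circ_mem t, hl⟩, ht]
  · obtain ⟨k, l, t, p, ht, hk, hl, hp, hpj⟩ := ex j hj
    rw [← hf j hj k l t p hk hl hp hpj, T₂.pt_lmul _ _ (st' k l t p hk hl hp),
      G.tgt_mul _ _ (st k l t p hk hl hp), ← hpj, T₁.pt_lmul _ _ hp]
  · obtain ⟨k, l, t, p, ht, hk, hl, hp, hpj⟩ := ex j hj
    rw [← hf j hj k l t p hk hl hp hpj, ← hf (T₁.rot z j) (by rwa [T₁.base_rot]) k l t (z • p) hk hl
      (by rw [G.src_smul, hp]) (by rw [T₁.smul_lmul _ _ _ hp, hpj]),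
      G.smul_mul _ _ _ (st k l t p hk hl hp), T₂.smul_lmul _ _ _ (st' k l t p hk hl hp)]
  · obtain ⟨k, l, t, p, ht, hk, hl, hp, hpj⟩ := ex j hj
    have e : G.src p' = G.tgt p := by rw [hp', ← hpj, T₁.pt_lmul _ _ hp]
    rw [← hf j hj k l t p hk hl hp hpj, ← hf (T₁.lmul p' j) (by rwa [T₁.base_lmul _ _ hp']) k l t
      (G.mul p' p) hk hl (by rw [G.src_mul _ _ e, hp]) (by rw [T₁.mul_lmul _ _ _ e hp, hpj]),
      G.mul_assoc _ _ _ e (st k l t p hk hl hp), T₂.mul_lmul _ _ _ _ (st' k l t p hk hl hp)]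
    rw [G.tgt_mul _ _ (st k l t p hk hl hp), e]
  · have hj : ‖T₁.base (T₁.sec k (circ t))‖ = 1 := by
      rw [T₁.base_sec k _ ⟨circ_mem t, ht.1⟩, norm_circ]
    rw [← hf _ hj k l t _ ht.1 ht.2 (G.src_unit _) (T₁.lmul_unit _),
      G.unit_mul (h.tgt k l t ht.1 ht.2)]

end Trivialisation

end

/-! ### Parallel isomorphisms over an interval -/

noncomputable section

universe u

/-- A smooth function on an open interval has a smooth antiderivative. -/
theorem exists_antideriv {d : ℝ → ℝ} {a b : ℝ} (hd : ContDiffOn ℝ ∞ d (Ioo a b)) :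
    ∃ δ : ℝ → ℝ, ContDiffOn ℝ ∞ δ (Ioo a b) ∧ ∀ t ∈ Ioo a b, HasDerivAt δ (d t) t := by
  have key : ∀ t ∈ Ioo a b, HasDerivAt (fun t => ∫ s in (a + b) / 2..t, d s) (d t) t := by
    intro t ht
    have hm : (a + b) / 2 ∈ Ioo a b := ⟨by linarith [ht.1, ht.2], by linarith [ht.1, ht.2]⟩
    have hsub : uIcc ((a + b) / 2) t ⊆ Ioo a b := OrdConnected.uIcc_subset ordConnected_Ioo hm ht
    exact intervalIntegral.integral_hasDerivAt_right
      ((hd.continuousOn.mono hsub).intervalIntegrable)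
      (hd.continuousOn.stronglyMeasurableAtFilter isOpen_Ioo t ht)
      (hd.continuousOn.continuousAt (isOpen_Ioo.mem_nhds ht))
  refine ⟨_, ?_, key⟩
  rw [contDiffOn_infty_iff_deriv_of_isOpen isOpen_Ioo]
  exact ⟨fun t ht => (key t ht).differentiableAt.differentiableWithinAt,
    hd.congr fun t ht => (key t ht).deriv⟩

variable {EQ EY EP : Type*}
  [NormedAddCommGroup EQ] [NormedSpace ℝ EQ] [NormedAddCommGroup EY] [NormedSpace ℝ EY]
  [NormedAddCommGroup EP] [NormedSpace ℝ EP]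
  {Q Y : Type*} {P : Type u} [TopologicalSpace Q] [ChartedSpace EQ Q]
  [TopologicalSpace Y] [ChartedSpace EY Y] [IsManifold 𝓘(ℝ, EY) ∞ Y]
  [TopologicalSpace P] [ChartedSpace EP P] [IsManifold 𝓘(ℝ, EP) ∞ P] [MulAction Circle P]
  {G : BundleGerbe (EQ := EQ) (EY := EY) (EP := EP) Q Y P} {σ₁ σ₂ σ₃ : Disk (E := EQ) Q}

theorem BundleGerbe.contDiffOn_conn_vel (G : BundleGerbe (EQ := EQ) (EY := EY) (EP := EP) Q Y P)
    {S : Set ℝ} (hS : IsOpen S) {c : ℝ → P} (hc : ContMDiffOn 𝓘(ℝ, ℝ) 𝓘(ℝ, EP) ∞ c S) :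
    ContDiffOn ℝ ∞ (fun t => G.conn _ (vel c t)) S :=
  (contDiffOn_oneForm_comp G.smooth_conn hS.uniqueDiffOn hc 1).congr fun t ht => by
    rw [mfderivWithin_of_mem_nhds (hS.mem_nhds ht)]; rfl

/-- The velocity of a shifted curve. -/
theorem vel_add_const {E : Type*} [NormedAddCommGroup E] [NormedSpace ℝ E]
    {X : Type*} [TopologicalSpace X] [ChartedSpace E X] {c : ℝ → X} {t a : ℝ}
    (hc : ContMDiffAt 𝓘(ℝ, ℝ) 𝓘(ℝ, E) ∞ c (t + a)) :
    vel (E := E) (fun s => c (s + a)) t = vel (E := E) c (t + a) := by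
  rw [vel_comp (c := fun s => s + a) ((hasDerivAt_id t).add_const a) (S := univ)
    (hc.mdifferentiableAt (by simp)).mdifferentiableWithinAt (by simp), mfderivWithin_univ]
  rfl

namespace Trivialisation

variable {T₁ : Trivialisation G σ₁} {T₂ : Trivialisation G σ₂}

theorem contDiffOn_loopForm (T : Trivialisation G σ₁) (k : T.ι) :
    ContDiffOn ℝ ∞ (T.loopForm k) (circ ⁻¹' T.U k) :=
  ((T.smooth_form k).comp contDiff_circ.contDiffOn fun t ht => ⟨circ_mem t, ht⟩).clm_apply
    contDiff_circVel.contDiffOn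

theorem loopForm_eq_of_circ_eq (T : Trivialisation G σ₁) (k : T.ι) {s t : ℝ}
    (h : circ s = circ t) : T.loopForm k s = T.loopForm k t := by
  rw [loopForm, loopForm, circVel, circVel, h]

theorem contMDiffAt_trans_circ (T : Trivialisation G σ₁) {k l : T.ι} {t : ℝ} (hk : circ t ∈ T.U k)
    (hl : circ t ∈ T.U l) :
    ContMDiffAt 𝓘(ℝ, ℝ) 𝓘(ℝ, EP) ∞ (fun s => T.trans k l (circ s)) t :=
  ((T.smooth_trans k l).comp contDiff_circ.contMDiff.contMDiffOn
    (s := circ ⁻¹' (T.U k ∩ T.U l)) fun s hs => ⟨circ_mem s, hs⟩).contMDiffAt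
    ((isOpen_circ_preimage ((T.isOpen_U k).inter (T.isOpen_U l))).mem_nhds ⟨hk, hl⟩)

/-- A parallel isomorphism over an interval, for lifts of the boundary loops. -/
theorem exists_parallel_isIso {γ : ℝ → Q} (h₁ : ∀ t, σ₁.ext (circ t) = γ t)
    (h₂ : ∀ t, σ₂.ext (circ t) = γ t) (a b : ℝ) :
    ∃ q, (T₁.loopCocycle γ h₁).IsIso (T₂.loopCocycle γ h₂) (Ioo a b) q ∧
      ∀ k l, ∀ t ∈ Ioo a b, circ t ∈ T₁.U k → circ t ∈ T₂.U l →
        G.conn _ (vel (q k l) t) = T₁.loopForm k t - T₂.loopForm l t := by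
  obtain ⟨q, hq⟩ : ∃ q : T₁.ι → T₂.ι → ℝ → P,
      (T₁.loopCocycle γ h₁).IsIso (T₂.loopCocycle γ h₂) (Ioo a b) q :=
    LiftCocycle.exists_isIso_Ioo (T₁.loopCocycle γ h₁) (T₂.loopCocycle γ h₂) rfl rfl a b
  have hop : ∀ k l, IsOpen (Ioo a b ∩ circ ⁻¹' (T₁.U k ∩ T₂.U l)) := fun k l =>
    isOpen_Ioo.inter (isOpen_circ_preimage ((T₁.isOpen_U k).inter (T₂.isOpen_U l)))
  have hsm : ∀ k l, ContMDiffOn 𝓘(ℝ, ℝ) 𝓘(ℝ, EP) ∞ (q k l)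
      (Ioo a b ∩ circ ⁻¹' (T₁.U k ∩ T₂.U l)) := hq.smooth
  have hat : ∀ k l, ∀ t ∈ Ioo a b, circ t ∈ T₁.U k → circ t ∈ T₂.U l →
      ContMDiffAt 𝓘(ℝ, ℝ) 𝓘(ℝ, EP) ∞ (q k l) t := fun k l t ht hk hl =>
    (hsm k l).contMDiffAt ((hop k l).mem_nhds ⟨ht, hk, hl⟩)
  -- The defect of `q` is one function on the interval, independent of the charts.
  have hind : ∀ k k' l l', ∀ t ∈ Ioo a b, circ t ∈ T₁.U k → circ t ∈ T₁.U k' → circ t ∈ T₂.U l →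
      circ t ∈ T₂.U l' →
      T₁.loopForm k t - T₂.loopForm l t - G.conn _ (vel (q k l) t) =
      T₁.loopForm k' t - T₂.loopForm l' t - G.conn _ (vel (q k' l') t) := by
    intro k k' l l' t ht hk hk' hl hl'
    have hev : ∀ᶠ s in 𝓝 t, s ∈ Ioo a b ∧ circ s ∈ T₁.U k ∧ circ s ∈ T₁.U k' ∧ circ s ∈ T₂.U l ∧
        circ s ∈ T₂.U l' := by
      filter_upwards [(hop k l).eventually_mem ⟨ht, hk, hl⟩,
        (hop k' l').eventually_mem ⟨ht, hk', hl'⟩] with s hs hs'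
      exact ⟨hs.1, hs.2.1, hs'.2.1, hs.2.2, hs'.2.2⟩
    have e1 : q k l =ᶠ[𝓝 t] fun s => G.mul (T₁.trans k k' (circ s)) (q k' l s) :=
      hev.mono fun s hs => (hq.left k k' l s hs.1 hs.2.1 hs.2.2.1 hs.2.2.2.1).symm
    have e2 : q k' l' =ᶠ[𝓝 t] fun s => G.mul (q k' l s) (T₂.trans l l' (circ s)) :=
      hev.mono fun s hs => (hq.right k' l l' s hs.1 hs.2.2.1 hs.2.2.2.1 hs.2.2.2.2).symm
    rw [vel_congr G.conn e1, vel_congr G.conn e2,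
      G.conn_mul (fun s => T₁.trans k k' (circ s)) (q k' l) t (T₁.contMDiffAt_trans_circ hk hk')
        (hat k' l t ht hk' hl) (hev.mono fun s hs => ?_),
      G.conn_mul (q k' l) (fun s => T₂.trans l l' (circ s)) t (hat k' l t ht hk' hl)
        (T₂.contMDiffAt_trans_circ hl hl') (hev.mono fun s hs => ?_),
      T₁.conn_trans_circ k k' hk hk', T₂.conn_trans_circ l l' hl hl']
    · ring
    · rw [T₂.tgt_trans l l' ⟨circ_mem s, hs.2.2.2.1, hs.2.2.2.2⟩]
      exact hq.src k' l s ⟨hs.1, hs.2.2.1, hs.2.2.2.1⟩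
    · rw [T₁.src_trans k k' _ ⟨circ_mem s, hs.2.1, hs.2.2.1⟩]
      exact (hq.tgt k' l s ⟨hs.1, hs.2.2.1, hs.2.2.2.1⟩).symm
  set i : ℝ → T₁.ι := fun t => T₁.cocycle.idx (circ_mem t)
  set j : ℝ → T₂.ι := fun t => T₂.cocycle.idx (circ_mem t)
  have hi : ∀ t, circ t ∈ T₁.U (i t) := fun t => T₁.cocycle.mem_idx (circ_mem t)
  have hj : ∀ t, circ t ∈ T₂.U (j t) := fun t => T₂.cocycle.mem_idx (circ_mem t)
  set d : ℝ → ℝ := fun t =>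
    T₁.loopForm (i t) t - T₂.loopForm (j t) t - G.conn _ (vel (q (i t) (j t)) t) with hd
  have hdeq : ∀ k l, ∀ t ∈ Ioo a b, circ t ∈ T₁.U k → circ t ∈ T₂.U l →
      d t = T₁.loopForm k t - T₂.loopForm l t - G.conn _ (vel (q k l) t) :=
    fun k l t ht hk hl => hind _ _ _ _ t ht (hi t) hk (hj t) hl
  have hds : ContDiffOn ℝ ∞ d (Ioo a b) := by
    refine contDiffOn_of_locally_contDiffOn fun t ht => ⟨_, hop (i t) (j t), ⟨ht, hi t, hj t⟩, ?_⟩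
    refine ContDiffOn.congr ?_ fun s hs => hdeq (i t) (j t) s hs.1 hs.2.2.1 hs.2.2.2
    exact (((T₁.contDiffOn_loopForm _).mono fun s hs => hs.2.2.1).sub
      ((T₂.contDiffOn_loopForm _).mono fun s hs => hs.2.2.2)).sub
      ((G.contDiffOn_conn_vel (hop _ _) (hsm _ _)).mono inter_subset_right)
  -- Multiplying `q` by the exponential of an antiderivative of the defect removes it.
  obtain ⟨δ, hδ, hδ'⟩ := exists_antideriv hds
  refine ⟨_, hq.smul (subset_univ _) (subset_univ _)
    (contMDiff_circleExp.comp_contMDiffOn hδ.contMDiffOn), fun k l t ht hk hl => ?_⟩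
  refine (G.conn_smul (q k l) δ t (hat k l t ht hk hl)
    (hδ.contDiffAt (isOpen_Ioo.mem_nhds ht))).trans ?_
  rw [(hδ' t ht).deriv, hdeq k l t ht hk hl]
  ring

end Trivialisation

end

/-! ### Existence of trivialisations over spheres -/

noncomputable section

universe u

variable {EQ EY EP : Type*}
  [NormedAddCommGroup EQ] [NormedSpace ℝ EQ] [NormedAddCommGroup EY] [NormedSpace ℝ EY]
  [NormedAddCommGroup EP] [NormedSpace ℝ EP]
  {Q Y : Type*} {P : Type u} [TopologicalSpace Q] [ChartedSpace EQ Q]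
  [TopologicalSpace Y] [ChartedSpace EY Y] [IsManifold 𝓘(ℝ, EY) ∞ Y]
  [TopologicalSpace P] [ChartedSpace EP P] [IsManifold 𝓘(ℝ, EP) ∞ P] [MulAction Circle P]
  {G : BundleGerbe (EQ := EQ) (EY := EY) (EP := EP) Q Y P} {σ₁ σ₂ σ₃ : Disk (E := EQ) Q}

namespace Trivialisation

variable {T₁ : Trivialisation G σ₁} {T₂ : Trivialisation G σ₂}

theorem circ_fract (t : ℝ) : circ (Int.fract t) = circ t := by
  conv_rhs => rw [← Int.fract_add_floor t]
  rw [circ_add_int]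

/-- Over the boundary circle there is an isomorphism with constant defect. -/
theorem exists_loopIso_const (T₁ : Trivialisation G σ₁) (T₂ : Trivialisation G σ₂)
    (hσ : ∀ t, σ₁.ext (circ t) = σ₂.ext (circ t)) :
    ∃ q θ, T₁.LoopIso T₂ q (fun _ => θ) := by
  -- The interval is chosen with room for a neighbourhood of a period and its translates by one.
  obtain ⟨q, hq, hqp⟩ : ∃ q : T₁.ι → T₂.ι → ℝ → P, (T₁.loopCocycle _ hσ).IsIso
      (T₂.loopCocycle _ fun _ => rfl) (Ioo (-3) 3) q ∧
      ∀ k l, ∀ t ∈ Ioo (-3 : ℝ) 3, circ t ∈ T₁.U k → circ t ∈ T₂.U l →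
        G.conn _ (vel (q k l) t) = T₁.loopForm k t - T₂.loopForm l t :=
    exists_parallel_isIso hσ (fun _ => rfl) (-3) 3
  have hop : ∀ k l, IsOpen (Ioo (-3) 3 ∩ circ ⁻¹' (T₁.U k ∩ T₂.U l)) := fun k l =>
    isOpen_Ioo.inter (isOpen_circ_preimage ((T₁.isOpen_U k).inter (T₂.isOpen_U l)))
  have hsm : ∀ k l, ContMDiffOn 𝓘(ℝ, ℝ) 𝓘(ℝ, EP) ∞ (q k l)
      (Ioo (-3) 3 ∩ circ ⁻¹' (T₁.U k ∩ T₂.U l)) := hq.smooth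
  have hat : ∀ k l, ∀ t ∈ Ioo (-3 : ℝ) 3, circ t ∈ T₁.U k → circ t ∈ T₂.U l →
      ContMDiffAt 𝓘(ℝ, ℝ) 𝓘(ℝ, EP) ∞ (q k l) t := fun k l t ht hk hl =>
    (hsm k l).contMDiffAt ((hop k l).mem_nhds ⟨ht, hk, hl⟩)
  -- the monodromy is constant
  have hsub : Ioo (-3 : ℝ) 2 ⊆ Ioo (-3) 3 := Ioo_subset_Ioo_right (by norm_num)
  have hshift : ∀ t ∈ Ioo (-3 : ℝ) 2, t + 1 ∈ Ioo (-3 : ℝ) 3 := fun t ht =>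
    ⟨by linarith [ht.1], by linarith [ht.2]⟩
  have hq' : (T₁.loopCocycle _ hσ).IsIso (T₂.loopCocycle _ fun _ => rfl) (Ioo (-3) 2)
      (fun k l t => q k l (t + 1)) := by
    constructor
    · intro k l
      refine (hsm k l).comp (contDiff_id.add contDiff_const).contMDiff.contMDiffOn fun t ht => ?_
      exact ⟨hshift t ht.1, by
        change circ (t + 1) ∈ T₁.U k ∩ T₂.U l; rw [circ_add_one]; exact ht.2⟩
    · intro k l t ht
      have := hq.tgt k l (t + 1) ⟨hshift t ht.1, by
        change circ (t + 1) ∈ T₁.U k ∩ T₂.U l; rw [circ_add_one]; exact ht.2⟩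
      rw [this]; simp only [loopCocycle, circ_add_one]
    · intro k l t ht
      have := hq.src k l (t + 1) ⟨hshift t ht.1, by
        change circ (t + 1) ∈ T₁.U k ∩ T₂.U l; rw [circ_add_one]; exact ht.2⟩
      rw [this]; simp only [loopCocycle, circ_add_one]
    · intro k k' l t ht hk hk' hl
      rw [← hq.left k k' l (t + 1) (hshift t ht) (by simpa [loopCocycle, circ_add_one] using hk)
        (by simpa [loopCocycle, circ_add_one] using hk') (by simpa [loopCocycle, circ_add_one] using hl)]
      simp only [loopCocycle, circ_add_one]
    · intro k l l' t ht hk hl hl'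
      rw [← hq.right k l l' (t + 1) (hshift t ht) (by simpa [loopCocycle, circ_add_one] using hk)
        (by simpa [loopCocycle, circ_add_one] using hl) (by simpa [loopCocycle, circ_add_one] using hl')]
      simp only [loopCocycle, circ_add_one]
  obtain ⟨z, hz, hzq⟩ := LiftCocycle.IsIso.exists_ratio (subset_univ _) (subset_univ _)
    (hq.mono hsub) hq'
  obtain ⟨φ, hφ, hφz⟩ := exists_log (convex_Ioo _ _) hz
  have hφq : ∀ k l, ∀ t ∈ Ioo (-3 : ℝ) 2, circ t ∈ T₁.U k → circ t ∈ T₂.U l →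
      Circle.exp (φ t) • q k l t = q k l (t + 1) := fun k l t ht hk hl => by
    rw [hφz t ht]; exact hzq k l t ⟨ht, hk, hl⟩
  -- Translating the parallel family by one period gives another parallel family, so the phase
  -- between them is constant.
  have hφ' : EqOn (deriv φ) 0 (Ioo (-3) 2) := fun t ht => by
    obtain ⟨k, hk⟩ := T₁.cover _ (circ_mem t)
    obtain ⟨l, hl⟩ := T₂.cover _ (circ_mem t)
    have hk1 : circ (t + 1) ∈ T₁.U k := by rwa [circ_add_one]
    have hl1 : circ (t + 1) ∈ T₂.U l := by rwa [circ_add_one]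
    have e : (fun s => Circle.exp (φ s) • q k l s) =ᶠ[𝓝 t] fun s => q k l (s + 1) := by
      filter_upwards [isOpen_Ioo.eventually_mem ht, (hop k l).eventually_mem ⟨hsub ht, hk, hl⟩]
        with s hs hs'
      exact hφq k l s hs hs'.2.1 hs'.2.2
    have e1 := G.conn_smul (q k l) φ t (hat k l t (hsub ht) hk hl)
      (hφ.contDiffAt (isOpen_Ioo.mem_nhds ht))
    rw [vel_congr G.conn e, vel_add_const (hat k l _ (hshift t ht) hk1 hl1),
      hqp k l _ (hshift t ht) hk1 hl1, hqp k l t (hsub ht) hk hl,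
      T₁.loopForm_eq_of_circ_eq k (circ_add_one t), T₂.loopForm_eq_of_circ_eq l (circ_add_one t)] at e1
    simpa using e1
  obtain ⟨θ, hθ⟩ := isOpen_Ioo.exists_is_const_of_deriv_eq_zero isPreconnected_Ioo
    (hφ.differentiableOn (by simp)) hφ'
  -- periodic rescaling
  set r : T₁.ι → T₂.ι → ℝ → P := fun k l t => Circle.exp (-θ * t) • q k l t with hr
  have hlin : ContDiff ℝ ∞ (fun t : ℝ => -θ * t) := contDiff_const.mul contDiff_id
  have hrat : ∀ k l, ∀ t ∈ Ioo (-3 : ℝ) 3, circ t ∈ T₁.U k → circ t ∈ T₂.U l →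
      ContMDiffAt 𝓘(ℝ, ℝ) 𝓘(ℝ, EP) ∞ (r k l) t := fun k l t ht hk hl =>
    (G.contMDiffOn_smul (contMDiff_circleExp.comp hlin.contMDiff).contMDiffOn (hsm k l)).contMDiffAt
      ((hop k l).mem_nhds ⟨ht, hk, hl⟩)
  have hrp : ∀ k l, ∀ t ∈ Ioo (-3 : ℝ) 3, circ t ∈ T₁.U k → circ t ∈ T₂.U l →
      G.conn _ (vel (r k l) t) = T₁.loopForm k t - T₂.loopForm l t - θ := fun k l t ht hk hl => by
    refine (G.conn_smul (q k l) _ t (hat k l t ht hk hl) hlin.contDiffAt).trans ?_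
    rw [hqp k l t ht hk hl, deriv_const_mul_id']
    ring
  have hr1 : ∀ k l, ∀ t ∈ Ioo (-3 : ℝ) 2, circ t ∈ T₁.U k → circ t ∈ T₂.U l →
      r k l (t + 1) = r k l t := fun k l t ht hk hl => by
    simp only [hr]
    rw [← hφq k l t ht hk hl, hθ t ht, smul_smul, ← Circle.exp_add]
    congr 2; ring
  have hfr : ∀ k l, ∀ t ∈ Ioo (-1 : ℝ) 2, circ t ∈ T₁.U k → circ t ∈ T₂.U l →
      r k l (Int.fract t) = r k l t := fun k l t ht hk hl => by
    rcases lt_or_ge t 0 with h0 | h0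
    · have hf : ⌊t⌋ = -1 := Int.floor_eq_iff.2 ⟨by simpa using ht.1.le, by simpa using h0⟩
      have : Int.fract t = t + 1 := by rw [Int.fract, hf]; push_cast; ring
      rw [this, hr1 k l t ⟨by linarith [ht.1], ht.2⟩ hk hl]
    rcases lt_or_ge t 1 with h1 | h1
    · rw [Int.fract_eq_self.2 ⟨h0, h1⟩]
    · have hf : ⌊t⌋ = 1 := Int.floor_eq_iff.2 ⟨by simpa using h1, by push_cast; linarith [ht.2]⟩
      have h2 : Int.fract t = t - 1 := by rw [Int.fract, hf]; push_cast; ring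
      have h3 : circ (t - 1) = circ t := by rw [← circ_add_one (t - 1), sub_add_cancel]
      have := hr1 k l (t - 1) ⟨by linarith, by linarith [ht.2]⟩ (by rwa [h3]) (by rwa [h3])
      rw [sub_add_cancel] at this
      rw [h2, this]
  have hfm : ∀ t, Int.fract t ∈ Ioo (-3 : ℝ) 3 := fun t =>
    ⟨by linarith [Int.fract_nonneg t], by linarith [Int.fract_lt_one t]⟩
  have hrIso : (T₁.loopCocycle _ hσ).IsIso (T₂.loopCocycle _ fun _ => rfl) (Ioo (-3) 3) r :=
    hq.smul (subset_univ _) (subset_univ _)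
      (contMDiff_circleExp.comp hlin.contMDiff).contMDiffOn
  -- The fractional part jumps at integers, but by periodicity of `r` the composite is locally a
  -- translate of `r` by a fixed integer, hence smooth.
  have hloc : ∀ k l t, circ t ∈ T₁.U k → circ t ∈ T₂.U l →
      (fun s => r k l (Int.fract s)) =ᶠ[𝓝 t] fun s => r k l (s + (-⌊t⌋ : ℝ)) := by
    intro k l t hk hl
    have h1 : ∀ᶠ s in 𝓝 t, s + (-⌊t⌋ : ℝ) ∈ Ioo (-1 : ℝ) 2 :=
      (continuousAt_id.add continuousAt_const).eventually_mem (isOpen_Ioo.mem_nhds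
        ⟨show (-1 : ℝ) < t + (-⌊t⌋ : ℝ) by linarith [Int.floor_le t],
          show t + (-⌊t⌋ : ℝ) < 2 by linarith [Int.lt_floor_add_one t]⟩)
    filter_upwards [h1, (isOpen_circ_preimage ((T₁.isOpen_U k).inter (T₂.isOpen_U l))).eventually_mem
      ⟨hk, hl⟩] with s hs hs'
    have h2 : circ (s + (-⌊t⌋ : ℝ)) = circ s := by
      rw [← Int.cast_neg, circ_add_int]
    rw [← hfr k l _ hs (by rw [h2]; exact hs'.1) (by rw [h2]; exact hs'.2), ← Int.cast_neg,
      Int.fract_add_intCast]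
  have hfl : ∀ t : ℝ, t + (-⌊t⌋ : ℝ) = Int.fract t := fun t => by rw [Int.fract, sub_eq_add_neg]
  refine ⟨fun k l t => r k l (Int.fract t), θ, fun k l t ht => ?_, fun k l t hk hl => ?_,
    fun k l t hk hl => ?_, fun k k' l t hk hk' hl => ?_, fun k l l' t hk hl hl' => ?_,
    fun k l t hk hl => ?_, fun k l t hk hl => ?_⟩
  · refine (ContMDiffAt.congr_of_eventuallyEq ?_ (hloc k l t ht.1 ht.2)).contMDiffWithinAt
    have hsh : ContDiff ℝ ∞ (fun s : ℝ => s + (-⌊t⌋ : ℝ)) := contDiff_id.add contDiff_const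
    refine ContMDiffAt.comp t (g := r k l) ?_ hsh.contMDiff.contMDiffAt
    rw [hfl]
    exact hrat k l _ (hfm t) (by rw [circ_fract]; exact ht.1) (by rw [circ_fract]; exact ht.2)
  · have := hrIso.tgt k l _ ⟨hfm t, by
      change circ (Int.fract t) ∈ T₁.U k ∩ T₂.U l; rw [circ_fract]; exact ⟨hk, hl⟩⟩
    rw [this]; simp only [loopCocycle, circ_fract]
  · have := hrIso.src k l _ ⟨hfm t, by
      change circ (Int.fract t) ∈ T₁.U k ∩ T₂.U l; rw [circ_fract]; exact ⟨hk, hl⟩⟩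
    rw [this]; simp only [loopCocycle, circ_fract]
  · rw [← hrIso.left k k' l _ (hfm t) (by simpa [loopCocycle, circ_fract] using hk)
      (by simpa [loopCocycle, circ_fract] using hk') (by simpa [loopCocycle, circ_fract] using hl)]
    simp only [loopCocycle, circ_fract]
  · rw [← hrIso.right k l l' _ (hfm t) (by simpa [loopCocycle, circ_fract] using hk)
      (by simpa [loopCocycle, circ_fract] using hl) (by simpa [loopCocycle, circ_fract] using hl')]
    simp only [loopCocycle, circ_fract]
  · have hk' : circ (t + (-⌊t⌋ : ℝ)) ∈ T₁.U k := by rwa [hfl, circ_fract]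
    have hl' : circ (t + (-⌊t⌋ : ℝ)) ∈ T₂.U l := by rwa [hfl, circ_fract]
    have hm : t + (-⌊t⌋ : ℝ) ∈ Ioo (-3 : ℝ) 3 := by rw [hfl]; exact hfm t
    have hc : circ (t + (-⌊t⌋ : ℝ)) = circ t := by rw [hfl, circ_fract]
    rw [vel_congr G.conn (hloc k l t hk hl), vel_add_const (hrat k l _ hm hk' hl'),
      hrp k l _ hm hk' hl', T₁.loopForm_eq_of_circ_eq k hc, T₂.loopForm_eq_of_circ_eq l hc]
  · rw [Int.fract_add_one]

/-- Changing the connection of a trivialisation by a one-form. -/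
def subForm (T : Trivialisation G σ₁) (κ : ℂ → ℂ →L[ℝ] ℝ) (hκ : ContDiff ℝ ∞ κ) :
    Trivialisation G σ₁ :=
  { T with
    form := fun k x => T.form k x - κ x
    smooth_form := fun k => (T.smooth_form k).sub hκ.contDiffOn
    form_eq := fun k l x hx => by rw [T.form_eq k l x hx, sub_sub_sub_cancel_right] }

/-- A one-form on the plane with constant value `θ` along the boundary circle. -/
theorem exists_form_circ (θ : ℝ) : ∃ κ : ℂ → ℂ →L[ℝ] ℝ, ContDiff ℝ ∞ κ ∧
    ∀ t, κ (circ t) (circVel t) = θ := by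
  -- The form is `θ / 2π` times the imaginary part of `conj x dx`. On the unit circle the latter is
  -- the angular form, and unlike that form it is smooth at the origin.
  refine ⟨fun x => (θ / (2 * Real.pi)) • Complex.imCLM.comp
    ((ContinuousLinearMap.mul ℝ ℂ) (Complex.conjCLE x)), ?_, fun t => ?_⟩
  · have h : ContDiff ℝ ∞ fun x : ℂ => (ContinuousLinearMap.mul ℝ ℂ) (Complex.conjCLE x) :=
      (ContinuousLinearMap.mul ℝ ℂ).contDiff.comp Complex.conjCLE.contDiff
    exact ((contDiff_const (c := Complex.imCLM)).clm_comp h).const_smul (θ / (2 * Real.pi))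
  · have h1 : (starRingEnd ℂ) (circ t) * circ t = 1 := by
      rw [mul_comm, Complex.mul_conj, Complex.normSq_eq_norm_sq, norm_circ]; simp
    have h2 : (starRingEnd ℂ) (circ t) * circVel t = ((2 * Real.pi : ℝ) : ℂ) * Complex.I := by
      rw [circVel]
      calc _ = 2 * Real.pi * Complex.I * ((starRingEnd ℂ) (circ t) * circ t) := by ring
        _ = _ := by rw [h1]; push_cast; ring
    have hp := Real.pi_pos
    simp [h2]

/-- The constant defect is absorbed by subtracting from the connection of `T₁` a form with the same
value along the circle. `T₂` is untouched, which allows a chain of adapted trivialisations to be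
built. -/
theorem exists_boundaryIso (T₁ : Trivialisation G σ₁) (T₂ : Trivialisation G σ₂)
    (hσ : ∀ t, σ₁.ext (circ t) = σ₂.ext (circ t)) :
    ∃ T₁' : Trivialisation G σ₁, Nonempty (BoundaryIso T₁' T₂) := by
  obtain ⟨q, θ, h⟩ := exists_loopIso_const T₁ T₂ hσ
  obtain ⟨κ, hκ, hκθ⟩ := exists_form_circ θ
  refine ⟨T₁.subForm κ hκ, LoopIso.nonempty_boundaryIso (q := q) ⟨h.smooth, h.tgt, h.src, h.left,
    h.right, fun k l t hk hl => ?_, h.periodic⟩⟩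
  rw [h.form_eq k l t hk hl]
  simp [loopForm, subForm, hκθ]
  ring

end Trivialisation

end

/-! ### The sphere holonomy as a cocycle on disks -/

noncomputable section

universe u

variable {EQ EY EP : Type*}
  [NormedAddCommGroup EQ] [NormedSpace ℝ EQ] [NormedAddCommGroup EY] [NormedSpace ℝ EY]
  [NormedAddCommGroup EP] [NormedSpace ℝ EP]
  {Q Y : Type*} {P : Type u} [TopologicalSpace Q] [ChartedSpace EQ Q]
  [TopologicalSpace Y] [ChartedSpace EY Y] [IsManifold 𝓘(ℝ, EY) ∞ Y]
  [TopologicalSpace P] [ChartedSpace EP P] [IsManifold 𝓘(ℝ, EP) ∞ P] [MulAction Circle P]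
  {G : BundleGerbe (EQ := EQ) (EY := EY) (EP := EP) Q Y P} {σ₁ σ₂ σ₃ : Disk (E := EQ) Q}

theorem Disk.ext_circ_eq {E X : Type*} [NormedAddCommGroup E] [NormedSpace ℝ E]
    [TopologicalSpace X] [ChartedSpace E X] {σ₁ σ₂ : Disk (E := E) X}
    (h : σ₁.boundary = σ₂.boundary) (t : ℝ) : σ₁.ext (circ t) = σ₂.ext (circ t) :=
  DFunLike.congr_fun h (Circle.exp (2 * Real.pi * t))

namespace BundleGerbe

/-- The given isomorphism shows that the set of admissible values is nonempty, and all its members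
are equal, so the choice in the definition is harmless. -/
theorem sphereHol_eq (hσ : σ₁.boundary = σ₂.boundary) {T₁ : Trivialisation G σ₁}
    {T₂ : Trivialisation G σ₂} {q : T₁.ι → T₂.ι → ℝ → P} (h : T₁.LoopIso T₂ q 0) :
    G.sphereHol σ₁ σ₂ = Complex.exp (Complex.I * (T₁.integral - T₂.integral)) := by
  have key := Classical.epsilon_spec (p := fun v : ℂ => ∃ (T₁ : Trivialisation G σ₁)
    (T₂ : Trivialisation G σ₂), Nonempty (BoundaryIso T₁ T₂) ∧
      v = Complex.exp (Complex.I * (T₁.integral - T₂.integral)))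
    ⟨_, T₁, T₂, h.nonempty_boundaryIso, rfl⟩
  obtain ⟨T₁', T₂', ⟨β⟩, hv⟩ := key
  exact hv.trans (β.loopIso.exp_integral_sub_eq h (Disk.ext_circ_eq hσ))

variable [IsManifold 𝓘(ℝ, EQ) ∞ Q]

theorem exists_boundaryIso (G : BundleGerbe (EQ := EQ) (EY := EY) (EP := EP) Q Y P)
    (hσ : σ₁.boundary = σ₂.boundary) (T₂ : Trivialisation G σ₂) :
    ∃ T₁ : Trivialisation G σ₁, Nonempty (BoundaryIso T₁ T₂) := by
  obtain ⟨T₁⟩ := nonempty_trivialisation G σ₁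
  exact T₁.exists_boundaryIso T₂ (Disk.ext_circ_eq hσ)

/-- Adapt a trivialisation over the second disk to one over the third, and then one over the first
disk to that. The composite computes the right side, and the middle integral cancels in the product.
-/
theorem sphereHol_mul (G : BundleGerbe (EQ := EQ) (EY := EY) (EP := EP) Q Y P)
    (h₁₂ : σ₁.boundary = σ₂.boundary) (h₂₃ : σ₂.boundary = σ₃.boundary) :
    G.sphereHol σ₁ σ₂ * G.sphereHol σ₂ σ₃ = G.sphereHol σ₁ σ₃ := by
  obtain ⟨T₃⟩ := nonempty_trivialisation G σ₃
  obtain ⟨T₂, ⟨β⟩⟩ := G.exists_boundaryIso h₂₃ T₃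
  obtain ⟨T₁, ⟨β'⟩⟩ := G.exists_boundaryIso h₁₂ T₂
  obtain ⟨r, hr⟩ := β'.loopIso.comp β.loopIso
  have hr' : T₁.LoopIso T₃ r 0 := by convert hr using 1; ext t; simp
  rw [sphereHol_eq h₁₂ β'.loopIso, sphereHol_eq h₂₃ β.loopIso, sphereHol_eq (h₁₂.trans h₂₃) hr',
    ← Complex.exp_add]
  congr 1
  ring

theorem sphereHol_ne_zero (G : BundleGerbe (EQ := EQ) (EY := EY) (EP := EP) Q Y P)
    (hσ : σ₁.boundary = σ₂.boundary) : G.sphereHol σ₁ σ₂ ≠ 0 := by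
  obtain ⟨T₂⟩ := nonempty_trivialisation G σ₂
  obtain ⟨T₁, ⟨β⟩⟩ := G.exists_boundaryIso hσ T₂
  rw [sphereHol_eq hσ β.loopIso]
  exact Complex.exp_ne_zero _

theorem sphereHol_self (G : BundleGerbe (EQ := EQ) (EY := EY) (EP := EP) Q Y P)
    (σ : Disk (E := EQ) Q) : G.sphereHol σ σ = 1 :=
  mul_right_cancel₀ (G.sphereHol_ne_zero (σ₁ := σ) (σ₂ := σ) rfl) <| by
    rw [one_mul, G.sphereHol_mul rfl rfl]

end BundleGerbe

/-! ### The line bundle on loop space -/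

namespace TransgressionBundle

variable {E X : Type*} [NormedAddCommGroup E] [NormedSpace ℝ E] [TopologicalSpace X]
  [ChartedSpace E X] {h : Disk (E := E) X → Disk (E := E) X → ℂ}

/-- The cocycle identity makes the relation already an equivalence relation, so passing to the
quotient adds no further identifications. -/
theorem rel_of_mk_eq (hself : ∀ σ, h σ σ = 1)
    (hmul : ∀ σ₁ σ₂ σ₃ : Disk (E := E) X, σ₁.boundary = σ₂.boundary → σ₂.boundary = σ₃.boundary →
      h σ₁ σ₂ * h σ₂ σ₃ = h σ₁ σ₃)
    {a b : Disk (E := E) X × ℂ} (hab : (Quot.mk _ a : TransgressionBundle h) = Quot.mk _ b) :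
    TransgressionRel h a b := by
  have h' := Quot.eqvGen_exact hab
  induction h' with
  | rel x y hxy => exact hxy
  | refl x => exact ⟨rfl, by rw [hself, one_mul]⟩
  | symm x y _ ih =>
    have ih := ih (Quot.eqvGen_sound (by assumption))
    refine ⟨ih.1.symm, ?_⟩
    rw [ih.2, ← mul_assoc, hmul _ _ _ ih.1.symm ih.1, hself, one_mul]
  | trans x y z _ _ ih ih' =>
    have ih := ih (Quot.eqvGen_sound (by assumption))
    have ih' := ih' (Quot.eqvGen_sound (by assumption))
    exact ⟨ih.1.trans ih'.1, by rw [ih.2, ih'.2, ← mul_assoc, hmul _ _ _ ih.1 ih'.1]⟩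

theorem bijOn_mk (hself : ∀ σ, h σ σ = 1)
    (hmul : ∀ σ₁ σ₂ σ₃ : Disk (E := E) X, σ₁.boundary = σ₂.boundary → σ₂.boundary = σ₃.boundary →
      h σ₁ σ₂ * h σ₂ σ₃ = h σ₁ σ₃) (σ : Disk (E := E) X) :
    BijOn (mk h σ) univ (proj ⁻¹' {σ.boundary}) := by
  refine ⟨fun z _ => rfl, fun z _ w _ hzw => ?_, fun x hx => ?_⟩
  · have := (rel_of_mk_eq hself hmul hzw).2
    simpa [hself] using this
  · obtain ⟨⟨σ', z⟩, rfl⟩ := Quot.exists_rep x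
    have hb : σ'.boundary = σ.boundary := hx
    exact ⟨h σ σ' * z, trivial, Quot.sound ⟨hb.symm, rfl⟩⟩

theorem existsUnique_section {s : Disk (E := E) X → ℂ} (hs : TransformsAsSection h s) :
    ∃! f : BoundingLoop (E := E) X → TransgressionBundle (E := E) (X := X) h,
      (∀ γ, (f γ).proj = γ.1) ∧ ∀ σ : Disk (E := E) X, f ⟨σ.boundary, σ, rfl⟩ = mk h σ (s σ) := by
  have key : ∀ σ σ' : Disk (E := E) X, σ.boundary = σ'.boundary →
      mk h σ (s σ) = mk h σ' (s σ') := fun σ σ' hb => Quot.sound ⟨hb, hs σ σ' hb⟩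
  refine ⟨fun γ => mk h γ.2.choose (s γ.2.choose), ⟨fun γ => γ.2.choose_spec, fun σ => ?_⟩, ?_⟩
  · exact key _ _ (Exists.choose_spec (⟨σ, rfl⟩ : ∃ σ' : Disk (E := E) X, σ'.boundary = σ.boundary))
  · rintro f ⟨-, hf⟩
    ext ⟨γ, hγ⟩
    obtain ⟨σ, rfl⟩ := hγ
    rw [hf σ]
    exact (key _ _ (Exists.choose_spec
      (⟨σ, rfl⟩ : ∃ σ' : Disk (E := E) X, σ'.boundary = σ.boundary))).symm

end TransgressionBundle

end

noncomputable section

/-! ### Linear differential equations in the general linear group -/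

section LinearODE

variable {n : ℕ} {V : Type*} [NormedAddCommGroup V] [NormedSpace ℝ V]

theorem contMDiffOn_units {S : Set V} {g : V → (EndC n)ˣ}
    (hg : ContDiffOn ℝ ∞ (fun x => (g x : EndC n)) S) :
    ContMDiffOn 𝓘(ℝ, V) 𝓘(ℝ, EndC n) ∞ g S := by
  have h := (contMDiffOn_isOpenEmbedding_symm (I := 𝓘(ℝ, EndC n)) (n := ∞)
    (Units.isOpenEmbedding_val (R := EndC n))).comp hg.contMDiffOn fun x _ => mem_range_self (g x)
  refine h.congr fun x _ => ?_
  exact ((Units.isOpenEmbedding_val (R := EndC n)).toOpenPartialHomeomorph_left_inv _).symm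

theorem contDiffOn_val {S : Set V} {g : V → (EndC n)ˣ}
    (hg : ContMDiffOn 𝓘(ℝ, V) 𝓘(ℝ, EndC n) ∞ g S) :
    ContDiffOn ℝ ∞ (fun x => (g x : EndC n)) S :=
  (Units.contMDiff_val.comp_contMDiffOn hg).contDiffOn

/-- Bootstrap: the equation expresses the derivative through `g`, so each order of smoothness yields
the next. -/
theorem contDiffOn_of_hasDerivAt_mul {S : Set ℝ} (hS : IsOpen S) {M g : ℝ → EndC n}
    (hM : ContDiffOn ℝ ∞ M S) (hg : ∀ t ∈ S, HasDerivAt g (M t * g t) t) :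
    ContDiffOn ℝ ∞ g S := by
  rw [contDiffOn_infty]
  intro m
  induction m with
  | zero => exact contDiffOn_zero.2 fun t ht => (hg t ht).continuousAt.continuousWithinAt
  | succ m ih =>
    have := (contDiffOn_succ_iff_deriv_of_isOpen (n := (m : WithTop ℕ∞)) (f := g) hS).2
      ⟨fun t ht => (hg t ht).differentiableAt.differentiableWithinAt, by simp,
        ((hM.of_le (by exact_mod_cast le_top)).mul ih).congr fun t ht => (hg t ht).deriv⟩
    exact_mod_cast this

/-- The equation is made autonomous by adding time as a coordinate and is solved with initial value
`1`. Invertibility is an open condition, so it persists for a short time. -/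
theorem exists_linear_ode {S : Set ℝ} (hS : IsOpen S) {M : ℝ → EndC n} (hM : ContDiffOn ℝ ∞ M S)
    {t₀ : ℝ} (ht₀ : t₀ ∈ S) : ∃ ε > 0, Ioo (t₀ - ε) (t₀ + ε) ⊆ S ∧ ∃ g : ℝ → (EndC n)ˣ,
      ContMDiffOn 𝓘(ℝ, ℝ) 𝓘(ℝ, EndC n) ∞ g (Ioo (t₀ - ε) (t₀ + ε)) ∧
      ∀ t ∈ Ioo (t₀ - ε) (t₀ + ε), HasDerivAt (fun s => (g s : EndC n)) (M t * g t) t := by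
  set v : ℝ × EndC n → ℝ × EndC n := fun x => (1, M x.1 * x.2) with hv
  have hMat : ContDiffAt ℝ 1 M t₀ := (hM.contDiffAt (hS.mem_nhds ht₀)).of_le (by simp)
  have hvc : ContDiffAt ℝ 1 v (t₀, 1) :=
    contDiffAt_const.prodMk ((ContDiffAt.comp (t₀, (1 : EndC n)) hMat contDiffAt_fst).mul
      contDiffAt_snd)
  obtain ⟨α, hα, ε, hε, hα'⟩ :=
    hvc.exists_forall_mem_closedBall_exists_eq_forall_mem_Ioo_hasDerivAt₀ t₀
  have h1 : ∀ t ∈ Ioo (t₀ - ε) (t₀ + ε), HasDerivAt (fun s => (α s).1) 1 t := fun t ht =>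
    (hα' t ht).fst
  have h2 : ∀ t ∈ Ioo (t₀ - ε) (t₀ + ε), HasDerivAt (fun s => (α s).2) (M (α t).1 * (α t).2) t :=
    fun t ht => (hα' t ht).snd
  have h3 : ∀ t ∈ Ioo (t₀ - ε) (t₀ + ε), (α t).1 = t := fun t ht => by
    have hm : t₀ ∈ Ioo (t₀ - ε) (t₀ + ε) := ⟨by linarith, by linarith⟩
    exact isOpen_Ioo.eqOn_of_deriv_eq (f := fun s => (α s).1) (g := id) isPreconnected_Ioo
      (fun s hs => (h1 s hs).differentiableAt.differentiableWithinAt) differentiableOn_id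
      (fun s hs => by rw [(h1 s hs).deriv, deriv_id]) hm (by simp [hα]) ht
  have hcont : ContinuousAt (fun s => (α s).2) t₀ := (h2 t₀ ⟨by linarith, by linarith⟩).continuousAt
  have hunit : ∀ᶠ t in 𝓝 t₀, IsUnit (α t).2 := hcont.eventually (by
    simp only [hα]; exact Units.isOpen.mem_nhds isUnit_one)
  obtain ⟨ε', hε', hsub⟩ := Metric.mem_nhds_iff.1
    (Filter.inter_mem (Filter.inter_mem hunit (hS.mem_nhds ht₀))
      (isOpen_Ioo.mem_nhds (show t₀ ∈ Ioo (t₀ - ε) (t₀ + ε) from ⟨by linarith, by linarith⟩)))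
  rw [Real.ball_eq_Ioo] at hsub
  classical
  set g : ℝ → (EndC n)ˣ := fun t => if h : IsUnit (α t).2 then h.unit else 1 with hg
  have hgv : ∀ t ∈ Ioo (t₀ - ε') (t₀ + ε'), (g t : EndC n) = (α t).2 := fun t ht => by
    have : IsUnit (α t).2 := (hsub ht).1.1
    simp only [hg]
    rw [dif_pos this]
    rfl
  have hgd : ∀ t ∈ Ioo (t₀ - ε') (t₀ + ε'),
      HasDerivAt (fun s => (g s : EndC n)) (M t * g t) t := fun t ht => by
    have := h2 t (hsub ht).2
    rw [h3 t (hsub ht).2, ← hgv t ht] at this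
    exact this.congr_of_eventuallyEq ((isOpen_Ioo.eventually_mem ht).mono hgv)
  exact ⟨ε', hε', fun t ht => (hsub ht).1.2, g, contMDiffOn_units
    (contDiffOn_of_hasDerivAt_mul isOpen_Ioo (hM.mono fun t ht => (hsub ht).1.2) hgd), hgd⟩

end LinearODE

/-- Smoothness of a form with values in matrices along a curve. -/
theorem contDiffOn_endC_form_vel {n : ℕ} {E X : Type*} [NormedAddCommGroup E] [NormedSpace ℝ E]
    [TopologicalSpace X] [ChartedSpace E X] [IsManifold 𝓘(ℝ, E) ∞ X]
    {θ : (x : X) → TangentSpace 𝓘(ℝ, E) x →L[ℝ] EndC n}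
    (hθ : ∀ l : EndC n →L[ℝ] ℝ, ContMDiff 𝓘(ℝ, E) (𝓘(ℝ, E).prod 𝓘(ℝ, E →L[ℝ] ℝ)) ∞
      (fun f => Bundle.TotalSpace.mk' (E →L[ℝ] ℝ) f (l.comp (θ f))))
    {S : Set ℝ} (hS : IsOpen S) {c : ℝ → X} (hc : ContMDiffOn 𝓘(ℝ, ℝ) 𝓘(ℝ, E) ∞ c S) :
    ContDiffOn ℝ ∞ (fun t => θ _ (vel c t)) S := by
  have h1 : ∀ l : EndC n →L[ℝ] ℝ, ContDiffOn ℝ ∞ (fun t => l (θ _ (vel c t))) S := fun l =>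
    (contDiffOn_oneForm_comp (hθ l) hS.uniqueDiffOn hc 1).congr fun t ht => by
      rw [mfderivWithin_of_mem_nhds (hS.mem_nhds ht)]; rfl
  set b := Module.finBasis ℝ (EndC n)
  have h2 : (fun t => θ _ (vel c t)) =
      fun t => ∑ i, (LinearMap.toContinuousLinearMap (b.coord i)) (θ _ (vel c t)) • b i := by
    ext1 t
    exact (b.sum_repr (θ _ (vel c t))).symm
  rw [h2]
  exact ContDiffOn.sum fun i _ => (h1 _).smul contDiffOn_const

end

noncomputable section

universe u

variable {EQ EY EF EP : Type*}
  [NormedAddCommGroup EQ] [NormedSpace ℝ EQ] [NormedAddCommGroup EY] [NormedSpace ℝ EY]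
  [NormedAddCommGroup EP] [NormedSpace ℝ EP] [NormedAddCommGroup EF] [NormedSpace ℝ EF]
  {Q Y : Type*} {P : Type u} [TopologicalSpace Q] [ChartedSpace EQ Q]
  [TopologicalSpace Y] [ChartedSpace EY Y] [IsManifold 𝓘(ℝ, EY) ∞ Y]
  [TopologicalSpace P] [ChartedSpace EP P] [IsManifold 𝓘(ℝ, EP) ∞ P] [MulAction Circle P]
  {G : BundleGerbe (EQ := EQ) (EY := EY) (EP := EP) Q Y P} {σ₁ σ₂ σ₃ : Disk (E := EQ) Q}
  {n : ℕ} {F : Type*} [TopologicalSpace F] [ChartedSpace EF F] [IsManifold 𝓘(ℝ, EF) ∞ F]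


/-! ### Families of frames along the boundary circle -/

namespace GerbeModule

theorem rmul_cancel (A : GerbeModule (EF := EF) G n F) {f : F} {g h : (EndC n)ˣ}
    (e : A.rmul f g = A.rmul f h) : g = h := by
  have := A.free f (g * h⁻¹) (by rw [← A.rmul_rmul, e, A.rmul_rmul, mul_inv_cancel, A.rmul_one])
  exact mul_inv_eq_one.1 this

theorem exists_ratio (A : GerbeModule (EF := EF) G n F) {V : Type*} [NormedAddCommGroup V]
    [NormedSpace ℝ V] {S : Set V} {f f' : V → F}
    (hf : ContMDiffOn 𝓘(ℝ, V) 𝓘(ℝ, EF) ∞ f S) (hf' : ContMDiffOn 𝓘(ℝ, V) 𝓘(ℝ, EF) ∞ f' S)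
    (h : ∀ x ∈ S, A.base (f x) = A.base (f' x)) :
    ∃ g : V → (EndC n)ˣ, ContMDiffOn 𝓘(ℝ, V) 𝓘(ℝ, EndC n) ∞ g S ∧
      ∀ x ∈ S, A.rmul (f x) (g x) = f' x := by
  have key : ∀ x ∈ S, ∃ N, IsOpen N ∧ x ∈ N ∧ ∃ g : V → (EndC n)ˣ,
      ContMDiffOn 𝓘(ℝ, V) 𝓘(ℝ, EndC n) ∞ g (S ∩ N) ∧
      ∀ y ∈ S ∩ N, A.rmul (f y) (g y) = f' y := by
    intro x hx
    obtain ⟨U, hU, e, c, -, hc, -, hce⟩ := A.locallyTrivial (A.base (f x))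
    have hb := A.smooth_base.comp_contMDiffOn hf
    obtain ⟨N, hN, hxN, hNU⟩ := mem_nhdsWithin.1 ((hb x hx).continuousWithinAt hU)
    have hfU : ∀ y ∈ S ∩ N, A.base (f y) ∈ U := fun y hy => hNU ⟨hy.2, hy.1⟩
    have hfU' : ∀ y ∈ S ∩ N, A.base (f' y) ∈ U := fun y hy => by rw [← h y hy.1]; exact hfU y hy
    refine ⟨N, hN, hxN, fun y => (c (f y))⁻¹ * c (f' y), ?_, fun y hy => ?_⟩
    · exact (hc.comp (hf.mono inter_subset_left) hfU).inv.mul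
        (hc.comp (hf'.mono inter_subset_left) hfU')
    · have h1 := hce (f y) (hfU y hy)
      have h2 := hce (f' y) (hfU' y hy)
      rw [← h y hy.1] at h2
      conv_lhs => rw [← h1]
      rw [A.rmul_rmul, mul_inv_cancel_left, h2]
  have hex : ∀ x, ∃ g : (EndC n)ˣ, x ∈ S → A.rmul (f x) g = f' x := fun x => by
    by_cases hx : x ∈ S
    · obtain ⟨N, -, hxN, g, -, hg⟩ := key x hx
      exact ⟨g x, fun _ => hg x ⟨hx, hxN⟩⟩
    · exact ⟨1, fun h => absurd h hx⟩
  choose g hg using hex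
  refine ⟨g, contMDiffOn_of_locally_contMDiffOn fun x hx => ?_, fun x hx => hg x hx⟩
  obtain ⟨N, hN, hxN, g', hgs, hg'⟩ := key x hx
  exact ⟨N, hN, hxN, hgs.congr fun y hy => A.rmul_cancel ((hg y hy.1).trans (hg' y hy).symm)⟩

theorem contMDiffOn_rmul (A : GerbeModule (EF := EF) G n F) {V : Type*} [NormedAddCommGroup V]
    [NormedSpace ℝ V] {S : Set V} {f : V → F} {g : V → (EndC n)ˣ}
    (hf : ContMDiffOn 𝓘(ℝ, V) 𝓘(ℝ, EF) ∞ f S)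
    (hg : ContMDiffOn 𝓘(ℝ, V) 𝓘(ℝ, EndC n) ∞ g S) :
    ContMDiffOn 𝓘(ℝ, V) 𝓘(ℝ, EF) ∞ (fun x => A.rmul (f x) (g x)) S :=
  A.smooth_rmul.comp_contMDiffOn (hf.prodMk hg)

theorem contMDiffOn_lmul (A : GerbeModule (EF := EF) G n F) {V : Type*} [NormedAddCommGroup V]
    [NormedSpace ℝ V] {S : Set V} {p : V → P} {f : V → F}
    (hp : ContMDiffOn 𝓘(ℝ, V) 𝓘(ℝ, EP) ∞ p S) (hf : ContMDiffOn 𝓘(ℝ, V) 𝓘(ℝ, EF) ∞ f S)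
    (h : ∀ x ∈ S, G.src (p x) = A.base (f x)) :
    ContMDiffOn 𝓘(ℝ, V) 𝓘(ℝ, EF) ∞ (fun x => A.lmul (p x) (f x)) S :=
  A.smooth_lmul.comp (hp.prodMk hf) h

end GerbeModule

namespace Trivialisation

/-- Families of frames of `E` over the local lifts of the boundary loop, i.e. families of frames of
the bundle on the disk to which `E ⊗ J^*` descends. -/
structure IsFrames (T : Trivialisation G σ₁) (A : GerbeModule (EF := EF) G n F) (S : Set ℝ)
    (f : T.ι → ℝ → F) : Prop where
  smooth : ∀ k, ContMDiffOn 𝓘(ℝ, ℝ) 𝓘(ℝ, EF) ∞ (f k) (S ∩ circ ⁻¹' T.U k)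
  base : ∀ k, ∀ t ∈ S, circ t ∈ T.U k → A.base (f k t) = T.pt (T.sec k (circ t))
  lmul : ∀ k l, ∀ t ∈ S, circ t ∈ T.U k → circ t ∈ T.U l →
    A.lmul (T.trans k l (circ t)) (f l t) = f k t

/-- The family of frames is parallel at `t`. -/
def ParallelAt (T : Trivialisation G σ₁) (A : GerbeModule (EF := EF) G n F)
    (f : T.ι → ℝ → F) (t : ℝ) : Prop :=
  ∀ k, circ t ∈ T.U k →
    A.conn _ (vel (f k) t) = (Complex.I * (T.loopForm k t : ℝ)) • (1 : EndC n)

variable {T : Trivialisation G σ₁} {A : GerbeModule (EF := EF) G n F}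

theorem IsFrames.mono {S S' : Set ℝ} {f : T.ι → ℝ → F} (h : T.IsFrames A S f) (hS : S' ⊆ S) :
    T.IsFrames A S' f where
  smooth k := (h.smooth k).mono (inter_subset_inter_left _ hS)
  base k t ht := h.base k t (hS ht)
  lmul k l t ht := h.lmul k l t (hS ht)

theorem IsFrames.contMDiffAt {S : Set ℝ} {f : T.ι → ℝ → F} (h : T.IsFrames A S f) {t : ℝ}
    (hS : S ∈ 𝓝 t) {k : T.ι} (hk : circ t ∈ T.U k) : ContMDiffAt 𝓘(ℝ, ℝ) 𝓘(ℝ, EF) ∞ (f k) t :=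
  (h.smooth k).contMDiffAt
    (Filter.inter_mem hS ((isOpen_circ_preimage (T.isOpen_U k)).mem_nhds hk))

theorem IsFrames.rmul_const {S : Set ℝ} {f : T.ι → ℝ → F} (h : T.IsFrames A S f)
    (g : (EndC n)ˣ) : T.IsFrames A S (fun k t => A.rmul (f k t) g) where
  smooth k := A.contMDiffOn_rmul (h.smooth k) contMDiffOn_const
  base k t ht hk := by rw [A.base_rmul, h.base k t ht hk]
  lmul k l t ht hk hl := by
    rw [A.lmul_rmul, h.lmul k l t ht hk hl]
    rw [T.src_trans k l _ ⟨circ_mem t, hk, hl⟩, h.base l t ht hl]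

/-- The prescribed value of the connection is a scalar matrix, so conjugation by a constant leaves
it unchanged. -/
theorem ParallelAt.rmul_const {S : Set ℝ} {f : T.ι → ℝ → F} (h : T.IsFrames A S f) {t : ℝ}
    (hS : S ∈ 𝓝 t) (hp : T.ParallelAt A f t) (g : (EndC n)ˣ) :
    T.ParallelAt A (fun k t => A.rmul (f k t) g) t := fun k hk => by
  rw [A.conn_rmul (f k) (fun _ => g) t (h.contMDiffAt hS hk) contMDiffAt_const, hp k hk]
  simp only [mul_smul_comm, mul_one, smul_mul_assoc, Units.inv_mul, deriv_const, mul_zero, add_zero]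

theorem ParallelAt.congr {f f' : T.ι → ℝ → F} {t : ℝ} (h : T.ParallelAt A f t)
    (hf : ∀ k, circ t ∈ T.U k → f' k =ᶠ[𝓝 t] f k) : T.ParallelAt A f' t := fun k hk => by
  rw [vel_congr A.conn (hf k hk), h k hk]

/-- The left action of `R` commutes with the right action of matrices, so the ratio is the same in
every chart. -/
theorem IsFrames.exists_ratio {S : Set ℝ} {f f' : T.ι → ℝ → F} (h : T.IsFrames A S f)
    (h' : T.IsFrames A S f') : ∃ g : ℝ → (EndC n)ˣ, ContMDiffOn 𝓘(ℝ, ℝ) 𝓘(ℝ, EndC n) ∞ g S ∧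
      ∀ k, ∀ t ∈ S, circ t ∈ T.U k → A.rmul (f k t) (g t) = f' k t := by
  choose r hr hrf using fun k => A.exists_ratio (h.smooth k) (h'.smooth k)
    fun t ht => by rw [h.base k t ht.1 ht.2, h'.base k t ht.1 ht.2]
  have ind : ∀ k l, ∀ t ∈ S, circ t ∈ T.U k → circ t ∈ T.U l → r k t = r l t :=
    fun k l t ht hk hl => by
      refine A.rmul_cancel (f := f k t) ?_
      rw [hrf k t ⟨ht, hk⟩, ← h.lmul k l t ht hk hl, ← h'.lmul k l t ht hk hl, ← A.lmul_rmul,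
        hrf l t ⟨ht, hl⟩]
      rw [T.src_trans k l _ ⟨circ_mem t, hk, hl⟩, h.base l t ht hl]
  set i : ℝ → T.ι := fun t => T.cocycle.idx (circ_mem t)
  have hi : ∀ t, circ t ∈ T.U (i t) := fun t => T.cocycle.mem_idx (circ_mem t)
  refine ⟨fun t => r (i t) t, contMDiffOn_of_locally_contMDiffOn fun t ht => ?_,
    fun k t ht hk => ?_⟩
  · exact ⟨_, isOpen_circ_preimage (T.isOpen_U (i t)), hi t, (hr (i t)).congr
      fun s hs => ind _ _ s hs.1 (hi s) hs.2⟩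
  · simp only
    rw [ind (i t) k t ht (hi t) hk, hrf k t ⟨ht, hk⟩]

/-- Two parallel families of frames differ by a constant matrix. -/
theorem IsFrames.exists_const_ratio {S S' : Set ℝ} {f f' : T.ι → ℝ → F} (h : T.IsFrames A S f)
    (h' : T.IsFrames A S f') (hS' : IsOpen S') (hconn : IsPreconnected S') (hsub : S' ⊆ S)
    (hcl : S ⊆ closure S') (hp : ∀ t ∈ S', T.ParallelAt A f t)
    (hp' : ∀ t ∈ S', T.ParallelAt A f' t) :
    ∃ g : (EndC n)ˣ, ∀ k, ∀ t ∈ S, circ t ∈ T.U k → A.rmul (f k t) g = f' k t := by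
  obtain ⟨g, hg, hgf⟩ := h.exists_ratio h'
  rcases S.eq_empty_or_nonempty with rfl | ⟨t₀, ht₀⟩
  · exact ⟨1, fun k t ht => ht.elim⟩
  have hgd := contDiffOn_val hg
  have hder : EqOn (deriv fun s => (g s : EndC n)) 0 S' := fun t ht => by
    obtain ⟨k, hk⟩ := T.cover _ (circ_mem t)
    have hn : S ∈ 𝓝 t := Filter.mem_of_superset (hS'.mem_nhds ht) hsub
    have e : (fun s => A.rmul (f k s) (g s)) =ᶠ[𝓝 t] f' k := by
      filter_upwards [hn, (isOpen_circ_preimage (T.isOpen_U k)).mem_nhds hk] with s hs hs'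
      exact hgf k s hs hs'
    -- The connection takes the same scalar value on both families, so the gauge term `g⁻¹ g'`
    -- vanishes.
    have e1 := A.conn_rmul (f k) g t (h.contMDiffAt hn hk) (hg.contMDiffAt hn)
    rw [vel_congr A.conn e, hp t ht k hk, hp' t ht k hk] at e1
    simp only [mul_smul_comm, mul_one, smul_mul_assoc, Units.inv_mul] at e1
    have e2 := left_eq_add.1 e1
    exact (Units.mul_right_eq_zero _).1 e2
  obtain ⟨c, hc⟩ := hS'.exists_is_const_of_deriv_eq_zero hconn
    ((hgd.mono hsub).differentiableOn (by simp)) hder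
  -- Parallelism is known on the open set `S'` only. Continuity extends the constancy to `S`, for
  -- instance to the endpoints of a closed interval.
  have hc' : EqOn (fun s => (g s : EndC n)) (fun _ => c) S :=
    EqOn.of_subset_closure hc hgd.continuousOn continuousOn_const hsub hcl
  refine ⟨g t₀, fun k t ht hk => ?_⟩
  rw [← hgf k t ht hk]
  congr 1
  exact Units.ext ((hc' ht₀).trans (hc' ht).symm)

end Trivialisation

end

/-! ### Existence of parallel frames -/

noncomputable section

universe u

variable {EQ EY EF EP : Type*}
  [NormedAddCommGroup EQ] [NormedSpace ℝ EQ] [NormedAddCommGroup EY] [NormedSpace ℝ EY]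
  [NormedAddCommGroup EP] [NormedSpace ℝ EP] [NormedAddCommGroup EF] [NormedSpace ℝ EF]
  {Q Y : Type*} {P : Type u} [TopologicalSpace Q] [ChartedSpace EQ Q]
  [TopologicalSpace Y] [ChartedSpace EY Y] [IsManifold 𝓘(ℝ, EY) ∞ Y]
  [TopologicalSpace P] [ChartedSpace EP P] [IsManifold 𝓘(ℝ, EP) ∞ P] [MulAction Circle P]
  {G : BundleGerbe (EQ := EQ) (EY := EY) (EP := EP) Q Y P} {σ₁ σ₂ σ₃ : Disk (E := EQ) Q}
  {n : ℕ} {F : Type*} [TopologicalSpace F] [ChartedSpace EF F] [IsManifold 𝓘(ℝ, EF) ∞ F]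

namespace Trivialisation

variable {T : Trivialisation G σ₁}

/-- Parallel frames exist locally. -/
theorem exists_frames_nhds (T : Trivialisation G σ₁) (A : GerbeModule (EF := EF) G n F) (t₀ : ℝ) :
    ∃ ε > 0, ∃ f, T.IsFrames A (Ioo (t₀ - ε) (t₀ + ε)) f ∧
      ∀ t ∈ Ioo (t₀ - ε) (t₀ + ε), T.ParallelAt A f t := by
  obtain ⟨k₀, hk₀⟩ := T.cover _ (circ_mem t₀)
  obtain ⟨U, hU, e, -, he, -, heb, -⟩ := A.locallyTrivial (T.pt (T.sec k₀ (circ t₀)))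
  have hys : ContMDiffOn 𝓘(ℝ, ℝ) 𝓘(ℝ, EY) ∞ (fun t => T.pt (T.sec k₀ (circ t)))
      (circ ⁻¹' T.U k₀) :=
    (T.smooth_sec k₀).comp contDiff_circ.contMDiff.contMDiffOn fun t ht => ⟨circ_mem t, ht⟩
  have hop := isOpen_circ_preimage (T.isOpen_U k₀)
  obtain ⟨N, hNsub, hN, htN⟩ := mem_nhds_iff.1 (Filter.inter_mem (hop.mem_nhds hk₀)
    ((hys.continuousOn.continuousAt (hop.mem_nhds hk₀)) hU))
  set b : ℝ → F := fun t => e (T.pt (T.sec k₀ (circ t))) with hb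
  have hbs : ContMDiffOn 𝓘(ℝ, ℝ) 𝓘(ℝ, EF) ∞ b N :=
    he.comp (hys.mono fun t ht => (hNsub ht).1) fun t ht => (hNsub ht).2
  -- The frame `b g` is parallel exactly when `g' = M g`, where `M` is the prescribed scalar minus
  -- the connection on the velocity of `b`.
  have hM : ContDiffOn ℝ ∞ (fun t => (Complex.I * (T.loopForm k₀ t : ℝ)) • (1 : EndC n) -
      A.conn _ (vel b t)) N := by
    refine ContDiffOn.sub ?_ (contDiffOn_endC_form_vel A.smooth_conn hN hbs)
    have h : ContDiffOn ℝ ∞ (fun t => Complex.I * ((T.loopForm k₀ t : ℝ) : ℂ)) N :=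
      (contDiffOn_const (c := Complex.I)).mul (Complex.ofRealCLM.contDiff.comp_contDiffOn
        ((T.contDiffOn_loopForm k₀).mono fun t ht => (hNsub ht).1))
    exact h.smul (contDiffOn_const (c := (1 : EndC n)))
  obtain ⟨ε, hε, hεN, g, hg, hgd⟩ := exists_linear_ode hN hM htN
  have hbb : ∀ t ∈ N, A.base (b t) = T.pt (T.sec k₀ (circ t)) := fun t ht => heb _ (hNsub ht).2
  have hkN : ∀ t ∈ N, circ t ∈ T.U k₀ := fun t ht => (hNsub ht).1
  set r : ℝ → F := fun t => A.rmul (b t) (g t) with hr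
  have hrs : ContMDiffOn 𝓘(ℝ, ℝ) 𝓘(ℝ, EF) ∞ r (Ioo (t₀ - ε) (t₀ + ε)) :=
    A.contMDiffOn_rmul (hbs.mono hεN) hg
  have hrb : ∀ t ∈ Ioo (t₀ - ε) (t₀ + ε), A.base (r t) = T.pt (T.sec k₀ (circ t)) := fun t ht => by
    rw [hr, A.base_rmul, hbb t (hεN ht)]
  have hrp : ∀ t ∈ Ioo (t₀ - ε) (t₀ + ε),
      A.conn _ (vel r t) = (Complex.I * (T.loopForm k₀ t : ℝ)) • (1 : EndC n) := fun t ht => by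
    rw [hr, A.conn_rmul b g t (hbs.contMDiffAt (hN.mem_nhds (hεN ht)))
      (hg.contMDiffAt (isOpen_Ioo.mem_nhds ht)), (hgd t ht).deriv, sub_mul, mul_sub, ← mul_assoc,
      ← mul_assoc, add_sub_cancel]
    simp only [mul_smul_comm, mul_one, smul_mul_assoc, Units.inv_mul]
  have st : ∀ k, ∀ t ∈ Ioo (t₀ - ε) (t₀ + ε), circ t ∈ T.U k →
      G.src (T.trans k k₀ (circ t)) = A.base (r t) := fun k t ht hk => by
    rw [T.src_trans k k₀ _ ⟨circ_mem t, hk, hkN t (hεN ht)⟩, hrb t ht]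
  -- The frame over one lift determines the others through the transitions. They stay parallel
  -- because the chart forms change by the connection on the transition.
  refine ⟨ε, hε, fun k t => A.lmul (T.trans k k₀ (circ t)) (r t), ⟨fun k => ?_, fun k t ht hk => ?_,
    fun k l t ht hk hl => ?_⟩, fun t ht k hk => ?_⟩
  · refine A.contMDiffOn_lmul ?_ (hrs.mono inter_subset_left) fun t ht => st k t ht.1 ht.2
    exact (T.smooth_trans k k₀).comp contDiff_circ.contMDiff.contMDiffOn
      fun t ht => ⟨circ_mem t, ht.2, hkN t (hεN ht.1)⟩
  · rw [A.base_lmul _ _ (st k t ht hk), T.tgt_trans k k₀ ⟨circ_mem t, hk, hkN t (hεN ht)⟩]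
  · rw [← A.mul_lmul _ _ _ ?_ (st l t ht hl)]
    · congr 1
      exact T.cocycle.mul_trans k l k₀ _ (circ_mem t) hk hl (hkN t (hεN ht))
    · rw [T.src_trans k l _ ⟨circ_mem t, hk, hl⟩, T.tgt_trans l k₀ ⟨circ_mem t, hl, hkN t (hεN ht)⟩]
  · have hn : Ioo (t₀ - ε) (t₀ + ε) ∈ 𝓝 t := isOpen_Ioo.mem_nhds ht
    rw [A.conn_lmul (fun s => T.trans k k₀ (circ s)) r t
      (T.contMDiffAt_trans_circ hk (hkN t (hεN ht))) (hrs.contMDiffAt hn) ?_, hrp t ht,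
      T.conn_trans_circ k k₀ hk (hkN t (hεN ht))]
    · refine (add_smul _ _ _).symm.trans ?_
      congr 1
      push_cast
      ring
    · filter_upwards [hn, (isOpen_circ_preimage (T.isOpen_U k)).mem_nhds hk] with s hs hs'
      exact st k s hs hs'

/-- Parallel frames exist on intervals. -/
theorem exists_frames (T : Trivialisation G σ₁) (A : GerbeModule (EF := EF) G n F) (a b : ℝ) :
    ∃ f, T.IsFrames A (Ioo a b) f ∧ ∀ t ∈ Ioo a b, T.ParallelAt A f t := by
  refine interval_induction
    (p := fun a b => ∃ f, T.IsFrames A (Ioo a b) f ∧ ∀ t ∈ Ioo a b, T.ParallelAt A f t)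
    (fun a b a' b' ha hb ⟨f, hf, hp⟩ => ⟨f, hf.mono (Ioo_subset_Ioo ha hb),
      fun t ht => hp t (Ioo_subset_Ioo ha hb ht)⟩)
    (fun a a' b' b a₀ b₀ ha hab hb ha₀ hb₀ ⟨f, hf, hp⟩ ⟨f', hf', hp'⟩ => ?_)
    (fun x => T.exists_frames_nhds A x) a b
  have hs1 : Ioo a' b' ⊆ Ioo a b' := Ioo_subset_Ioo_left ha
  have hs2 : Ioo a' b' ⊆ Ioo a' b := Ioo_subset_Ioo_right hb
  -- On the overlap the two families differ by a constant matrix. Correcting the right one by it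
  -- makes them agree.
  obtain ⟨g, hg⟩ := (hf'.mono hs2).exists_const_ratio (hf.mono hs1) isOpen_Ioo isPreconnected_Ioo
    subset_rfl subset_closure (fun t ht => hp' t (hs2 ht)) (fun t ht => hp t (hs1 ht))
  set f'' : T.ι → ℝ → F := fun k t => A.rmul (f' k t) g with hf''
  have hF : T.IsFrames A (Ioo a' b) f'' := hf'.rmul_const g
  have hP : ∀ t ∈ Ioo a' b, T.ParallelAt A f'' t := fun t ht =>
    ParallelAt.rmul_const hf' (isOpen_Ioo.mem_nhds ht) (hp' t ht) g
  classical
  have e1 : ∀ k t, t < b' → (if t < b' then f k t else f'' k t) = f k t := fun k t h => if_pos h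
  have e2 : ∀ k t, a' < t → circ t ∈ T.U k → (if t < b' then f k t else f'' k t) = f'' k t :=
    fun k t h hk => by
      split_ifs with h'
      · exact (hg k t ⟨h, h'⟩ hk).symm
      · rfl
  have cover : ∀ t, t < b' ∨ a' < t := fun t => by
    rcases lt_or_ge t b' with h | h
    · exact Or.inl h
    · exact Or.inr (hab.trans_le h)
  refine ⟨fun k t => if t < b' then f k t else f'' k t, ⟨fun k => ?_, fun k t ht hk => ?_,
    fun k l t ht hk hl => ?_⟩, fun t ht => ?_⟩
  · refine contMDiffOn_of_locally_contMDiffOn fun t ht => ?_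
    rcases cover t with h | h
    · exact ⟨Iio b', isOpen_Iio, h, ((hf.smooth k).mono fun s hs =>
        ⟨⟨ha₀.trans hs.1.1.1, hs.2⟩, hs.1.2⟩).congr fun s hs => e1 k s hs.2⟩
    · exact ⟨Ioi a', isOpen_Ioi, h, ((hF.smooth k).mono fun s hs =>
        ⟨⟨hs.2, hs.1.1.2.trans hb₀⟩, hs.1.2⟩).congr fun s hs => e2 k s hs.2 hs.1.2⟩
  · rcases cover t with h | h
    · rw [e1 k t h, hf.base k t ⟨ha₀.trans ht.1, h⟩ hk]
    · rw [e2 k t h hk, hF.base k t ⟨h, ht.2.trans hb₀⟩ hk]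
  · rcases cover t with h | h
    · rw [e1 k t h, e1 l t h, hf.lmul k l t ⟨ha₀.trans ht.1, h⟩ hk hl]
    · rw [e2 k t h hk, e2 l t h hl, hF.lmul k l t ⟨h, ht.2.trans hb₀⟩ hk hl]
  · rcases cover t with h | h
    · exact (hp t ⟨ha₀.trans ht.1, h⟩).congr fun k hk =>
        (isOpen_Iio.eventually_mem h).mono fun s hs => e1 k s hs
    · exact (hP t ⟨h, ht.2.trans hb₀⟩).congr fun k hk => by
        filter_upwards [isOpen_Ioi.mem_nhds h, (isOpen_circ_preimage (T.isOpen_U k)).mem_nhds hk]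
          with s hs hs'
        exact e2 k s hs hs'

end Trivialisation

end

noncomputable section

universe u

variable {EQ EY EF EP : Type*}
  [NormedAddCommGroup EQ] [NormedSpace ℝ EQ] [NormedAddCommGroup EY] [NormedSpace ℝ EY]
  [NormedAddCommGroup EP] [NormedSpace ℝ EP] [NormedAddCommGroup EF] [NormedSpace ℝ EF]
  {Q Y : Type*} {P : Type u} [TopologicalSpace Q] [ChartedSpace EQ Q]
  [TopologicalSpace Y] [ChartedSpace EY Y] [IsManifold 𝓘(ℝ, EY) ∞ Y]
  [TopologicalSpace P] [ChartedSpace EP P] [IsManifold 𝓘(ℝ, EP) ∞ P] [MulAction Circle P]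
  {G : BundleGerbe (EQ := EQ) (EY := EY) (EP := EP) Q Y P} {σ₁ σ₂ σ₃ : Disk (E := EQ) Q}
  {n : ℕ} {F : Type*} [TopologicalSpace F] [ChartedSpace EF F] [IsManifold 𝓘(ℝ, EF) ∞ F]


/-! ### The holonomy of a bundle gerbe module over a trivialisation -/

theorem uniqueDiffOn_Icc_inter_circ {U : Set ℂ} (hU : IsOpen U) :
    UniqueDiffOn ℝ (Icc (0 : ℝ) 1 ∩ circ ⁻¹' U) :=
  (uniqueDiffOn_Icc zero_lt_one).inter (isOpen_circ_preimage hU)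

/-- Relates the derivative within `[0, 1]` in the definition of parallel frames, one-sided at the
ends, to the velocity of a curve differentiable across the ends. -/
theorem mfderivWithin_eq_vel {E : Type*} [NormedAddCommGroup E] [NormedSpace ℝ E]
    {X : Type*} [TopologicalSpace X] [ChartedSpace E X] {W : Type*} [NormedAddCommGroup W]
    [NormedSpace ℝ W] (θ : (x : X) → TangentSpace 𝓘(ℝ, E) x →L[ℝ] W) {c c' : ℝ → X} {S : Set ℝ}
    {t : ℝ} (hS : UniqueDiffWithinAt ℝ S t) (ht : t ∈ S) (h : EqOn c c' S)
    (hc : MDifferentiableAt 𝓘(ℝ, ℝ) 𝓘(ℝ, E) c' t) :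
    θ _ (mfderivWithin 𝓘(ℝ, ℝ) 𝓘(ℝ, E) c S t (1 : ℝ)) = θ _ (vel c' t) := by
  have h1 := mfderivWithin_congr (I := 𝓘(ℝ, ℝ)) (I' := 𝓘(ℝ, E)) h (h ht)
  have h2 : ∀ y y' : X, y = y' → ∀ e : E, θ y e = θ y' e := by rintro y _ rfl e; rfl
  rw [vel, ← mfderivWithin_eq_mfderiv hS.uniqueMDiffWithinAt hc, h1]
  exact h2 _ _ (h ht) _

namespace GerbeModule

theorem exists_rmul_eq (A : GerbeModule (EF := EF) G n F) {f f' : F} (h : A.base f = A.base f') :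
    ∃ g, A.rmul f g = f' := by
  obtain ⟨U, hU, e, c, -, -, -, hce⟩ := A.locallyTrivial (A.base f)
  have h1 := hce f (mem_of_mem_nhds hU)
  have h2 := hce f' (h ▸ mem_of_mem_nhds hU)
  rw [← h] at h2
  have := A.rmul_rmul (e (A.base f)) (c f) ((c f)⁻¹ * c f')
  rw [mul_inv_cancel_left, h2, h1] at this
  exact ⟨_, this⟩

/-- The unit acts on `f` by some matrix, which is idempotent because the unit is, and an idempotent
invertible matrix is `1`. -/
theorem unit_lmul (A : GerbeModule (EF := EF) G n F) (f : F) :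
    A.lmul (G.unit (A.base f)) f = f := by
  have hs : G.src (G.unit (A.base f)) = A.base f := G.src_unit _
  have ht : G.tgt (G.unit (A.base f)) = A.base f := G.tgt_unit _
  obtain ⟨g, hg⟩ := A.exists_rmul_eq (f := f) (f' := A.lmul (G.unit (A.base f)) f)
    (by rw [A.base_lmul _ _ hs, ht])
  have h := A.mul_lmul _ _ f (hs.trans ht.symm) hs
  rw [G.unit_mul ht, ← hg, A.lmul_rmul _ _ _ hs, ← hg, A.rmul_rmul] at h
  have := A.rmul_cancel h
  rw [left_eq_mul.1 this, A.rmul_one] at hg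
  exact hg.symm

end GerbeModule

namespace Trivialisation

variable {T : Trivialisation G σ₁} {A : GerbeModule (EF := EF) G n F}

/-- `f` is a parallel family of frames along the boundary circle, with monodromy `g`. -/
structure IsHol (T : Trivialisation G σ₁) (A : GerbeModule (EF := EF) G n F)
    (f : T.ι → ℝ → F) (g : (EndC n)ˣ) : Prop where
  frames : T.IsFrames A (Ioo (-1) 2) f
  parallel : ∀ t ∈ Ioo (-1 : ℝ) 2, T.ParallelAt A f t
  monodromy : ∀ k, circ 0 ∈ T.U k → f k 1 = A.rmul (f k 0) g

/-- Translating a parallel family by one period gives a parallel family again, since all data depend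
on the point of the circle only. The two differ by a constant matrix, the monodromy. -/
theorem exists_isHol (T : Trivialisation G σ₁) (A : GerbeModule (EF := EF) G n F) :
    ∃ f g, T.IsHol A f g := by
  obtain ⟨f, hf, hp⟩ := T.exists_frames A (-1) 2
  have hsub : Ioo (-1 : ℝ) 1 ⊆ Ioo (-1) 2 := Ioo_subset_Ioo_right (by norm_num)
  have hsh : ∀ t ∈ Ioo (-1 : ℝ) 1, t + 1 ∈ Ioo (-1 : ℝ) 2 := fun t ht =>
    ⟨by linarith [ht.1], by linarith [ht.2]⟩
  have hf' : T.IsFrames A (Ioo (-1) 1) (fun k t => f k (t + 1)) := by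
    refine ⟨fun k => ?_, fun k t ht hk => ?_, fun k l t ht hk hl => ?_⟩
    · refine (hf.smooth k).comp (contDiff_id.add contDiff_const).contMDiff.contMDiffOn fun t ht => ?_
      exact ⟨hsh t ht.1, by change circ (t + 1) ∈ T.U k; rw [circ_add_one]; exact ht.2⟩
    · rw [hf.base k _ (hsh t ht) (by rwa [circ_add_one]), circ_add_one]
    · rw [← hf.lmul k l _ (hsh t ht) (by rwa [circ_add_one]) (by rwa [circ_add_one]), circ_add_one]
  obtain ⟨g, hg⟩ := (hf.mono hsub).exists_const_ratio hf' isOpen_Ioo isPreconnected_Ioo subset_rfl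
    subset_closure (fun t ht => hp t (hsub ht)) fun t ht k hk => by
      have hk' : circ (t + 1) ∈ T.U k := by rwa [circ_add_one]
      rw [vel_add_const (hf.contMDiffAt (isOpen_Ioo.mem_nhds (hsh t ht)) hk'),
        hp _ (hsh t ht) k hk', T.loopForm_eq_of_circ_eq k (circ_add_one t)]
  refine ⟨f, g, hf, hp, fun k hk => ?_⟩
  have := hg k 0 (by constructor <;> norm_num) hk
  rw [this, zero_add]

theorem circ_one : circ 1 = circ 0 := by
  simpa using circ_add_one 0

theorem circ_zero : circ 0 = 1 := by
  simp [circ]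

theorem Icc_subset_Ioo_neg_one_two : Icc (0 : ℝ) 1 ⊆ Ioo (-1) 2 := fun t ht =>
  ⟨by linarith [ht.1], by linarith [ht.2]⟩

/-- Frames given over the local sections extend uniquely and equivariantly to all of `J`: a vector
`p · sec k` is sent to `p · f k`. This turns the local description into descended frames. -/
theorem IsHol.isTrHol {f : T.ι → ℝ → F} {g : (EndC n)ˣ} (h : T.IsHol A f g) :
    IsTrHol T A (LinearMap.trace ℂ (EuclideanSpace ℂ (Fin n)) ((g : EndC n) : _ →ₗ[ℂ] _)) := by
  have hsub := Icc_subset_Ioo_neg_one_two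
  have uniq : ∀ t ∈ Icc (0 : ℝ) 1, ∀ k p k' p', circ t ∈ T.U k →
      G.src p = T.pt (T.sec k (circ t)) → circ t ∈ T.U k' → G.src p' = T.pt (T.sec k' (circ t)) →
      T.lmul p (T.sec k (circ t)) = T.lmul p' (T.sec k' (circ t)) →
      A.lmul p' (f k' t) = A.lmul p (f k t) := by
    intro t ht k p k' p' hk hp hk' hp' hj
    have hm := circ_mem t
    have e1 : G.src p = G.tgt (T.trans k k' (circ t)) := by rw [hp, T.tgt_trans k k' ⟨hm, hk, hk'⟩]
    have e2 := T.src_trans k k' _ ⟨hm, hk, hk'⟩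
    have e3 : p' = G.mul p (T.trans k k' (circ t)) := by
      refine T.lmul_cancel hp' ((G.src_mul _ _ e1).trans e2) ?_
      rw [T.mul_lmul _ _ _ e1 e2, T.lmul_trans k k' _ ⟨hm, hk, hk'⟩, hj]
    rw [e3, A.mul_lmul _ _ _ e1 (e2.trans (h.frames.base k' t (hsub ht) hk').symm),
      h.frames.lmul k k' t (hsub ht) hk hk']
  have ex : ∀ t j, T.base j = circ t → ∃ k p, circ t ∈ T.U k ∧
      G.src p = T.pt (T.sec k (circ t)) ∧ T.lmul p (T.sec k (circ t)) = j := by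
    intro t j hj
    obtain ⟨k, hk⟩ := T.cover _ (circ_mem t)
    obtain ⟨p, hp, hpj⟩ := T.exists_lmul_eq (j := T.sec k (circ t)) (j' := j)
      (by rw [T.base_sec k _ ⟨circ_mem t, hk⟩, hj])
    exact ⟨k, p, hk, hp, hpj⟩
  have hdef : ∀ t j, ∃ f', t ∈ Icc (0 : ℝ) 1 → T.base j = circ t → ∀ k p, circ t ∈ T.U k →
      G.src p = T.pt (T.sec k (circ t)) → T.lmul p (T.sec k (circ t)) = j →
      A.lmul p (f k t) = f' := by
    intro t j
    by_cases hj : t ∈ Icc (0 : ℝ) 1 ∧ T.base j = circ t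
    · obtain ⟨k, p, hk, hp, hpj⟩ := ex t j hj.2
      exact ⟨A.lmul p (f k t), fun _ _ k' p' hk' hp' hpj' =>
        uniq t hj.1 k p k' p' hk hp hk' hp' (hpj.trans hpj'.symm)⟩
    · obtain ⟨k, -⟩ := T.cover _ (circ_mem 0)
      exact ⟨f k 0, fun h1 h2 => absurd ⟨h1, h2⟩ hj⟩
  choose φ hφ using hdef
  have hsec : ∀ k, ∀ t ∈ Icc (0 : ℝ) 1 ∩ circ ⁻¹' T.U k, φ t (T.sec k (circ t)) = f k t := by
    intro k t ht
    have hb := h.frames.base k t (hsub ht.1) ht.2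
    rw [← hφ t _ ht.1 (T.base_sec k _ ⟨circ_mem t, ht.2⟩) k _ ht.2 (G.src_unit _) (T.lmul_unit _),
      ← hb, A.unit_lmul]
  refine ⟨φ, g, ⟨fun t ht j hj => ?_, fun k => ⟨?_, fun t ht => ?_⟩⟩, fun j hj => ?_, rfl⟩
  · obtain ⟨k, p, hk, hp, hpj⟩ := ex t j hj
    have hb := h.frames.base k t (hsub ht) hk
    have e := hφ t j ht hj k p hk hp hpj
    refine ⟨?_, fun z => ?_, fun p' hp' => ?_⟩
    · rw [← e, A.base_lmul _ _ (hp.trans hb.symm), ← hpj, T.pt_lmul _ _ hp]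
    · rw [← e, ← A.smul_lmul _ _ _ (hp.trans hb.symm)]
      exact (hφ t _ ht (by rwa [T.base_rot]) k (z • p) hk (by rw [G.src_smul, hp])
        (by rw [T.smul_lmul _ _ _ hp, hpj])).symm
    · have e1 : G.src p' = G.tgt p := by rw [hp', ← hpj, T.pt_lmul _ _ hp]
      rw [← e, ← A.mul_lmul _ _ _ e1 (hp.trans hb.symm)]
      exact (hφ t _ ht (by rwa [T.base_lmul _ _ hp']) k (G.mul p' p) hk
        (by rw [G.src_mul _ _ e1, hp]) (by rw [T.mul_lmul _ _ _ e1 hp, hpj])).symm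
  · exact ((h.frames.smooth k).mono (inter_subset_inter_left _ hsub)).congr (hsec k)
  · have hn : Ioo (-1 : ℝ) 2 ∈ 𝓝 t := isOpen_Ioo.mem_nhds (hsub ht.1)
    rw [mfderivWithin_eq_vel A.conn (uniqueDiffOn_Icc_inter_circ (T.isOpen_U k) t ht) ht (hsec k)
      ((h.frames.contMDiffAt hn ht.2).mdifferentiableAt (by simp)), h.parallel t (hsub ht.1) k ht.2]
    rfl
  · have h0 : T.base j = circ 0 := by rw [hj, circ_zero]
    have h1 : T.base j = circ 1 := by rw [h0, circ_one]
    obtain ⟨k, p, hk, hp, hpj⟩ := ex 0 j h0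
    have hb := h.frames.base k 0 (by constructor <;> norm_num) hk
    rw [← hφ 0 j (by simp) h0 k p hk hp hpj, ← hφ 1 j (by simp) h1 k p (by rwa [circ_one])
      (by rwa [circ_one]) (by rwa [circ_one]), h.monodromy k hk,
      A.lmul_rmul _ _ _ (hp.trans hb.symm)]

/-- Any other parallel family on `[0, 1]` differs by a constant matrix, so its monodromy is
conjugate to `g`. -/
theorem IsHol.eq_trace {f : T.ι → ℝ → F} {g : (EndC n)ˣ} (h : T.IsHol A f g) {τ : ℂ}
    (hτ : IsTrHol T A τ) :
    τ = LinearMap.trace ℂ (EuclideanSpace ℂ (Fin n)) ((g : EndC n) : _ →ₗ[ℂ] _) := by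
  obtain ⟨φ, g', ⟨hφ, hφs⟩, hg', rfl⟩ := hτ
  have hF : T.IsFrames A (Icc 0 1) (fun k t => φ t (T.sec k (circ t))) := by
    refine ⟨fun k => (hφs k).1, fun k t ht hk => ?_, fun k l t ht hk hl => ?_⟩
    · exact (hφ t ht _ (T.base_sec k _ ⟨circ_mem t, hk⟩)).1
    · rw [← (hφ t ht _ (T.base_sec l _ ⟨circ_mem t, hl⟩)).2.2 _
        (T.src_trans k l _ ⟨circ_mem t, hk, hl⟩), T.lmul_trans k l _ ⟨circ_mem t, hk, hl⟩]
  have hP : ∀ t ∈ Ioo (0 : ℝ) 1, T.ParallelAt A (fun k t => φ t (T.sec k (circ t))) t := by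
    intro t ht k hk
    have ht' : t ∈ Icc (0 : ℝ) 1 ∩ circ ⁻¹' T.U k := ⟨Ioo_subset_Icc_self ht, hk⟩
    rw [← mfderivWithin_eq_vel A.conn (uniqueDiffOn_Icc_inter_circ (T.isOpen_U k) t ht') ht'
      (eqOn_refl _ _) ((hF.contMDiffAt (Icc_mem_nhds ht.1 ht.2) hk).mdifferentiableAt (by simp))]
    exact (hφs k).2 t ht'
  obtain ⟨c, hc⟩ := (h.frames.mono Icc_subset_Ioo_neg_one_two).exists_const_ratio hF isOpen_Ioo
    isPreconnected_Ioo Ioo_subset_Icc_self (by rw [closure_Ioo zero_ne_one])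
    (fun t ht => h.parallel t (Icc_subset_Ioo_neg_one_two (Ioo_subset_Icc_self ht))) hP
  obtain ⟨k, hk⟩ := T.cover _ (circ_mem 0)
  have e0 := hc k 0 (by simp) hk
  have e1 := hc k 1 (by simp) (by rwa [circ_one])
  simp only [circ_one] at e1
  rw [hg' _ (by rw [T.base_sec k _ ⟨circ_mem 0, hk⟩, circ_zero]), h.monodromy k hk, ← e0,
    A.rmul_rmul, A.rmul_rmul] at e1
  have e2 : g' = c⁻¹ * (g * c) := by rw [A.rmul_cancel e1, inv_mul_cancel_left]
  have e3 : ((g' : EndC n) : EuclideanSpace ℂ (Fin n) →ₗ[ℂ] EuclideanSpace ℂ (Fin n)) =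
      (((c⁻¹ : (EndC n)ˣ) : EndC n) : EuclideanSpace ℂ (Fin n) →ₗ[ℂ] EuclideanSpace ℂ (Fin n)) *
        (((g : EndC n) : EuclideanSpace ℂ (Fin n) →ₗ[ℂ] EuclideanSpace ℂ (Fin n)) *
          ((c : EndC n) : EuclideanSpace ℂ (Fin n) →ₗ[ℂ] EuclideanSpace ℂ (Fin n))) := by
    rw [e2]; rfl
  have e4 : ((c : EndC n) : EuclideanSpace ℂ (Fin n) →ₗ[ℂ] EuclideanSpace ℂ (Fin n)) *
      (((c⁻¹ : (EndC n)ˣ) : EndC n) : EuclideanSpace ℂ (Fin n) →ₗ[ℂ] EuclideanSpace ℂ (Fin n)) = 1 :=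
    congrArg (fun a : EndC n => (a : EuclideanSpace ℂ (Fin n) →ₗ[ℂ] EuclideanSpace ℂ (Fin n)))
      c.mul_inv
  rw [e3, LinearMap.trace_mul_comm, mul_assoc, e4, mul_one]

variable {T₁ : Trivialisation G σ₁} {T₂ : Trivialisation G σ₂}

/-- Multiplied by `exp (i δ)`, the isomorphism preserves the connections and carries parallel frames
to parallel frames. It is no longer periodic, and its phase over one period is the scalar in the new
monodromy. -/
theorem IsHol.of_loopIso {q : T₁.ι → T₂.ι → ℝ → P} {d δ : ℝ → ℝ} (hq : T₁.LoopIso T₂ q d)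
    (hδ : ContDiffOn ℝ ∞ δ (Ioo (-1) 2)) (hδ' : ∀ t ∈ Ioo (-1 : ℝ) 2, HasDerivAt δ (d t) t)
    {f : T₂.ι → ℝ → F} {g : (EndC n)ˣ} (h : T₂.IsHol A f g) :
    ∃ f', T₁.IsHol A f' (scalarGL n (Circle.exp (δ 1 - δ 0)) * g) := by
  have hsub := Icc_subset_Ioo_neg_one_two
  set i : ℝ → T₂.ι := fun t => T₂.cocycle.idx (circ_mem t)
  have hi : ∀ t, circ t ∈ T₂.U (i t) := fun t => T₂.cocycle.mem_idx (circ_mem t)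
  have sb : ∀ k l, ∀ t ∈ Ioo (-1 : ℝ) 2, circ t ∈ T₁.U k → circ t ∈ T₂.U l →
      G.src (q k l t) = A.base (f l t) := fun k l t ht hk hl => by
    rw [hq.src k l t hk hl, h.frames.base l t ht hl]
  have sb' : ∀ k l, ∀ t ∈ Ioo (-1 : ℝ) 2, circ t ∈ T₁.U k → circ t ∈ T₂.U l →
      G.src (Circle.exp (δ t) • q k l t) = A.base (f l t) := fun k l t ht hk hl => by
    rw [G.src_smul, sb k l t ht hk hl]
  have ind : ∀ k l l', ∀ t ∈ Ioo (-1 : ℝ) 2, circ t ∈ T₁.U k → circ t ∈ T₂.U l →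
      circ t ∈ T₂.U l' → A.lmul (q k l t) (f l t) = A.lmul (q k l' t) (f l' t) :=
    fun k l l' t ht hk hl hl' => by
      have e2 := T₂.src_trans l l' _ ⟨circ_mem t, hl, hl'⟩
      rw [← h.frames.lmul l l' t ht hl hl', ← A.mul_lmul, hq.right k l l' t hk hl hl']
      · rw [hq.src k l t hk hl, T₂.tgt_trans l l' ⟨circ_mem t, hl, hl'⟩]
      · rw [e2, h.frames.base l' t ht hl']
  set f' : T₁.ι → ℝ → F := fun k t => A.lmul (Circle.exp (δ t) • q k (i t) t) (f (i t) t) with hf'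
  have ind' : ∀ k l, ∀ t ∈ Ioo (-1 : ℝ) 2, circ t ∈ T₁.U k → circ t ∈ T₂.U l →
      f' k t = A.lmul (Circle.exp (δ t) • q k l t) (f l t) := fun k l t ht hk hl => by
    rw [hf']
    simp only
    rw [A.smul_lmul _ _ _ (sb k _ t ht hk (hi t)), A.smul_lmul _ _ _ (sb k l t ht hk hl),
      ind k _ l t ht hk (hi t) hl]
  have hqs : ∀ k l, ContMDiffOn 𝓘(ℝ, ℝ) 𝓘(ℝ, EP) ∞ (fun t => Circle.exp (δ t) • q k l t)
      (Ioo (-1) 2 ∩ circ ⁻¹' (T₁.U k ∩ T₂.U l)) := fun k l =>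
    G.contMDiffOn_smul ((contMDiff_circleExp.comp_contMDiffOn hδ.contMDiffOn).mono inter_subset_left)
      ((hq.smooth k l).mono inter_subset_right)
  refine ⟨f', ⟨fun k => ?_, fun k t ht hk => ?_, fun k k' t ht hk hk' => ?_⟩, fun t ht k hk => ?_,
    fun k hk => ?_⟩
  · refine contMDiffOn_of_locally_contMDiffOn fun t ht => ?_
    refine ⟨_, isOpen_circ_preimage (T₂.isOpen_U (i t)), hi t, ContMDiffOn.congr
      (A.contMDiffOn_lmul ((hqs k (i t)).mono fun s hs => ⟨hs.1.1, hs.1.2, hs.2⟩)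
        ((h.frames.smooth (i t)).mono fun s hs => ⟨hs.1.1, hs.2⟩) fun s hs => ?_)
      fun s hs => ind' k (i t) s hs.1.1 hs.1.2 hs.2⟩
    exact sb' k _ s hs.1.1 hs.1.2 hs.2
  · rw [hf', A.base_lmul _ _ (sb' k _ t ht hk (hi t)), G.tgt_smul, hq.tgt k _ t hk (hi t)]
  · have e2 := T₁.src_trans k k' _ ⟨circ_mem t, hk, hk'⟩
    have e1 : G.src (T₁.trans k k' (circ t)) = G.tgt (q k' (i t) t) := by
      rw [e2, hq.tgt k' _ t hk' (hi t)]
    simp only [hf']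
    rw [← A.mul_lmul _ _ _ (by rw [G.tgt_smul, e1]) (sb' k' _ t ht hk' (hi t)),
      G.mul_smul _ _ _ e1, hq.left k k' _ t hk hk' (hi t)]
  · have hn : Ioo (-1 : ℝ) 2 ∈ 𝓝 t := isOpen_Ioo.mem_nhds ht
    set l := i t
    have hl : circ t ∈ T₂.U l := hi t
    have hc : circ ⁻¹' (T₁.U k ∩ T₂.U l) ∈ 𝓝 t :=
      (isOpen_circ_preimage ((T₁.isOpen_U k).inter (T₂.isOpen_U l))).mem_nhds ⟨hk, hl⟩
    have e : f' k =ᶠ[𝓝 t] fun s => A.lmul (Circle.exp (δ s) • q k l s) (f l s) := by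
      filter_upwards [hn, hc] with s hs hs'
      exact ind' k l s hs hs'.1 hs'.2
    rw [vel_congr A.conn e, A.conn_lmul (fun s => Circle.exp (δ s) • q k l s) (f l) t
      ((hqs k l).contMDiffAt (Filter.inter_mem hn hc)) (h.frames.contMDiffAt hn hl) ?_,
      h.parallel t ht l hl, G.conn_smul (q k l) δ t (hq.contMDiffAt hk hl) (hδ.contDiffAt hn),
      hq.form_eq k l t hk hl, (hδ' t ht).deriv]
    · refine (add_smul _ _ _).symm.trans ?_
      congr 1
      push_cast
      ring
    · filter_upwards [hn, hc] with s hs hs'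
      exact sb' k l s hs hs'.1 hs'.2
  · have m0 : (0 : ℝ) ∈ Ioo (-1 : ℝ) 2 := by constructor <;> norm_num
    have m1 : (1 : ℝ) ∈ Ioo (-1 : ℝ) 2 := by constructor <;> norm_num
    set l := i 0
    have hl : circ 0 ∈ T₂.U l := hi 0
    have hk1 : circ 1 ∈ T₁.U k := by rwa [circ_one]
    have hl1 : circ 1 ∈ T₂.U l := by rwa [circ_one]
    have hper : q k l 1 = q k l 0 := hq.eq_of_circ_eq hk hl circ_one
    rw [ind' k l 1 m1 hk1 hl1, ind' k l 0 m0 hk hl, hper, h.monodromy l hl, A.lmul_rmul,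
      A.smul_lmul _ _ _ (sb k l 0 m0 hk hl), A.smul_lmul _ _ _ (sb k l 0 m0 hk hl), A.rmul_rmul,
      A.rmul_rmul]
    · congr 1
      rw [← mul_assoc, scalarGL, scalarGL, scalarGL]
      rw [← map_mul, ← map_mul, ← Circle.exp_add, add_sub_cancel]
    · rw [G.src_smul, sb k l 0 m0 hk hl]

theorem trace_scalarGL_mul (z : Circle) (g : (EndC n)ˣ) :
    LinearMap.trace ℂ (EuclideanSpace ℂ (Fin n)) (((scalarGL n z * g : (EndC n)ˣ) : EndC n) :
      _ →ₗ[ℂ] _) = z * LinearMap.trace ℂ (EuclideanSpace ℂ (Fin n)) ((g : EndC n) : _ →ₗ[ℂ] _) := by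
  have h : (((scalarGL n z * g : (EndC n)ˣ) : EndC n) :
      EuclideanSpace ℂ (Fin n) →ₗ[ℂ] EuclideanSpace ℂ (Fin n)) =
      (z : ℂ) • ((g : EndC n) : EuclideanSpace ℂ (Fin n) →ₗ[ℂ] EuclideanSpace ℂ (Fin n)) := by
    ext1 v
    rfl
  rw [h, map_smul, smul_eq_mul]

/-- Comparison of the holonomies over two trivialisations. -/
theorem LoopIso.trHol_eq {q : T₁.ι → T₂.ι → ℝ → P} {d : ℝ → ℝ} (hq : T₁.LoopIso T₂ q d)
    (hd : ContDiff ℝ ∞ d) {τ₁ τ₂ : ℂ} (h₁ : IsTrHol T₁ A τ₁) (h₂ : IsTrHol T₂ A τ₂) :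
    τ₁ = Complex.exp (Complex.I * (∫ t in (0 : ℝ)..1, d t : ℝ)) * τ₂ := by
  obtain ⟨δ, hδ, hδ'⟩ := exists_antideriv (a := -1) (b := 2) hd.contDiffOn
  obtain ⟨f, g, h⟩ := T₂.exists_isHol A
  obtain ⟨f', h'⟩ := h.of_loopIso hq hδ hδ'
  rw [h'.eq_trace h₁, h.eq_trace h₂, trace_scalarGL_mul, Circle.coe_exp,
    intervalIntegral.integral_eq_sub_of_hasDerivAt (f := δ) (fun t ht => hδ' t ?_)
      (hd.continuous.intervalIntegrable _ _), mul_comm (Complex.I)]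
  rw [uIcc_of_le zero_le_one] at ht
  exact Icc_subset_Ioo_neg_one_two ht

theorem exists_isTrHol (T : Trivialisation G σ₁) (A : GerbeModule (EF := EF) G n F) :
    ∃ τ, IsTrHol T A τ := by
  obtain ⟨f, g, h⟩ := T.exists_isHol A
  exact ⟨_, h.isTrHol⟩

end Trivialisation

open Trivialisation

/-- The holonomies differ by the exponential of the boundary integral of the comparison form. By
Stokes' theorem this compensates the change of the integral of `mu`. -/
theorem trHol_mul_exp_eq {T T' : Trivialisation G σ₁} {A : GerbeModule (EF := EF) G n F} {τ τ' : ℂ}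
    (h : IsTrHol T A τ) (h' : IsTrHol T' A τ') :
    τ * Complex.exp (Complex.I * T.integral) = τ' * Complex.exp (Complex.I * T'.integral) := by
  obtain ⟨q, η, hq⟩ := exists_comparison T T'
  have hd : ContDiff ℝ ∞ fun t => η (circ t) (circVel t) := by
    have h1 : ContDiff ℝ ∞ fun t => η (circ t) := by
      rw [← contDiffOn_univ]
      exact hq.smooth.comp contDiff_circ.contDiffOn fun t _ => circ_mem t
    exact h1.clm_apply contDiff_circVel
  rw [hq.loopIso.trHol_eq hd h h', hq.integral_eq, mul_assoc, mul_comm, mul_assoc, ← Complex.exp_add]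
  congr 2
  push_cast
  ring

theorem sA_eq {T : Trivialisation G σ₁} {A : GerbeModule (EF := EF) G n F} {τ : ℂ}
    (h : IsTrHol T A τ) : sA A σ₁ = τ * Complex.exp (Complex.I * T.integral) := by
  obtain ⟨T', τ', h', e⟩ := Classical.epsilon_spec (p := fun v =>
    ∃ (T : Trivialisation G σ₁) (τ : ℂ), IsTrHol T A τ ∧
      v = τ * Complex.exp (Complex.I * T.integral)) ⟨_, T, τ, h, rfl⟩
  exact Eq.trans e (trHol_mul_exp_eq h' h)

/-- For trivialisations isomorphic over the boundary with connections the two traces coincide, and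
the quotient of the exponentials is the sphere holonomy. -/
theorem transformsAsSection_sA [IsManifold 𝓘(ℝ, EQ) ∞ Q] (A : GerbeModule (EF := EF) G n F) :
    TransformsAsSection G.sphereHol (sA A) := fun σ₁ σ₂ hσ => by
  obtain ⟨T₂⟩ := nonempty_trivialisation G σ₂
  obtain ⟨T₁, ⟨b⟩⟩ := G.exists_boundaryIso hσ T₂
  obtain ⟨τ₁, h₁⟩ := T₁.exists_isTrHol A
  obtain ⟨τ₂, h₂⟩ := T₂.exists_isTrHol A
  have hb := b.loopIso
  rw [G.sphereHol_eq hσ hb, sA_eq h₁, sA_eq h₂, hb.trHol_eq contDiff_const h₁ h₂]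
  simp only [Pi.zero_apply, intervalIntegral.integral_zero, Complex.ofReal_zero, mul_zero,
    Complex.exp_zero, one_mul]
  rw [mul_left_comm, ← Complex.exp_add]
  congr 2
  ring

end

noncomputable section

/-! ### Gluing of chains -/

section Chains

variable {E H : Type*} [NormedAddCommGroup E] [NormedSpace ℝ E]
  [TopologicalSpace H] {I : ModelWithCorners ℝ E H} {X : Type*} [TopologicalSpace X]
  [ChartedSpace H X]
  {E' H' : Type*} [NormedAddCommGroup E'] [NormedSpace ℝ E']
  [TopologicalSpace H'] {I' : ModelWithCorners ℝ E' H'} {X' : Type*} [TopologicalSpace X']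
  [ChartedSpace H' X']

theorem SmoothSimplex.eq_of_toFun {k : ℕ} {s s' : SmoothSimplex I X k}
    (h : ∀ t, s.toFun t = s'.toFun t) : s = s' := by
  obtain ⟨f, _⟩ := s
  obtain ⟨f', _⟩ := s'
  obtain rfl : f = f' := funext h
  rfl

theorem chainBoundary_single {k : ℕ} (s : SmoothSimplex I X (k + 1)) (m : ℤ) :
    chainBoundary (Finsupp.single s m) =
      ∑ i : Fin (k + 2), (m * (-1 : ℤ) ^ (i : ℕ)) • Finsupp.single (s.face i) 1 := by
  simp [chainBoundary, Finsupp.linearCombination_single, Finset.smul_sum, mul_smul]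

theorem chainMap_single {f : X → X'} (hf : ContMDiff I I' ∞ f) {k : ℕ} (s : SmoothSimplex I X k)
    (m : ℤ) : chainMap f hf (Finsupp.single s m) = Finsupp.single (s.map f hf) m :=
  Finsupp.mapDomain_single

theorem chainMap_add {f : X → X'} (hf : ContMDiff I I' ∞ f) {k : ℕ} (c c' : SmoothChain I X k) :
    chainMap f hf (c + c') = chainMap f hf c + chainMap f hf c' :=
  Finsupp.mapDomain_add

theorem chainMap_sum {f : X → X'} (hf : ContMDiff I I' ∞ f) {k : ℕ} {ι : Type*} (s : Finset ι)
    (c : ι → SmoothChain I X k) :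
    chainMap f hf (∑ i ∈ s, c i) = ∑ i ∈ s, chainMap f hf (c i) :=
  Finsupp.mapDomain_finsetSum

theorem chainBoundary_chainMap {f : X → X'} (hf : ContMDiff I I' ∞ f) {k : ℕ}
    (c : SmoothChain I X (k + 1)) :
    chainBoundary (chainMap f hf c) = chainMap f hf (chainBoundary c) := by
  induction c using Finsupp.induction_linear with
  | zero => simp [chainMap]
  | add c c' h h' => rw [chainMap_add, map_add, h, h', map_add, chainMap_add]
  | single s m =>
    rw [chainMap_single, chainBoundary_single, chainBoundary_single, chainMap_sum]
    refine Finset.sum_congr rfl fun i _ => ?_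
    rw [Finsupp.smul_single, Finsupp.smul_single, chainMap_single]
    rfl

end Chains

section Disks

variable {E : Type*} [NormedAddCommGroup E] [NormedSpace ℝ E]
  {X : Type*} [TopologicalSpace X] [ChartedSpace E X]

theorem Disk.toFun_congr (σ : Disk (E := E) X) {x y : unitDisk} (h : (x : ℂ) = y) :
    σ.toFun x = σ.toFun y := congrArg _ (Subtype.ext h)

theorem Disk.boundary_apply (σ : Disk (E := E) X) (z : Circle) :
    σ.boundary z = σ.toFun ⟨z, circle_mem_unitDisk z⟩ :=
  extendConst_of_mem (circle_mem_unitDisk z)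

theorem Disk.boundary_map {E' : Type*} [NormedAddCommGroup E'] [NormedSpace ℝ E']
    {X' : Type*} [TopologicalSpace X'] [ChartedSpace E' X'] {f : X → X'}
    (hf : ContMDiff 𝓘(ℝ, E) 𝓘(ℝ, E') ∞ f) (σ : Disk (E := E) X) (z : Circle) :
    (σ.map f hf).boundary z = f (σ.boundary z) := by
  rw [Disk.boundary_apply, Disk.boundary_apply]
  rfl

/-- On this edge the coefficient of the divided difference is one minus its argument, so the product
telescopes to the exponential, also at the endpoint where the divided difference is a derivative. -/
theorem diskChart_faceMap_zero (t : Fin 1 → ℝ) :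
    diskChart (faceMap 0 t) = Circle.exp (2 * Real.pi * t 0) := by
  have h0 : faceMap 0 t 0 = 1 - t 0 := by simp [faceMap, bary]
  have h1 : faceMap 0 t 1 = t 0 := by
    simp only [faceMap, bary, Fin.insertNth_zero']
    rfl
  have h := sub_smul_dslope (fun z => Complex.exp (2 * Real.pi * Complex.I * z)) 1 (t 0 : ℂ)
  simp only [mul_one, Complex.exp_two_pi_mul_I, smul_eq_mul] at h
  rw [diskChart, h0, h1, Circle.coe_exp]
  push_cast
  rw [show 2 * (Real.pi : ℂ) * t 0 * Complex.I = 2 * Real.pi * Complex.I * t 0 by ring]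
  linear_combination h

theorem diskChart_faceMap_one (t : Fin 1 → ℝ) : diskChart (faceMap 1 t) = 1 := by
  have h0 : faceMap 1 t 0 = 0 := by simp [faceMap, bary]
  simp [diskChart, h0]

theorem diskChart_faceMap_two (t : Fin 1 → ℝ) : diskChart (faceMap 2 t) = 1 := by
  have h1 : faceMap 2 t 1 = 0 := by
    rw [faceMap]
    exact Fin.insertNth_apply_same (α := fun _ => ℝ) (Fin.last 2) 0 (bary t)
  have h := sub_smul_dslope (fun z => Complex.exp (2 * Real.pi * Complex.I * z)) 1 (0 : ℂ)
  simp only [mul_one, Complex.exp_two_pi_mul_I, smul_eq_mul, mul_zero, Complex.exp_zero] at h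
  rw [diskChart, h1, Complex.ofReal_zero]
  linear_combination (faceMap 2 t 0 : ℂ) * h

/-- The boundary of the chain of a disk is its boundary loop. -/
theorem Disk.chainBoundary_chain (σ : Disk (E := E) X) : chainBoundary σ.chain =
    Finsupp.single (circleSimplex.map σ.boundary σ.boundary.contMDiff) 1 := by
  have e0 : σ.simplex.face 0 = circleSimplex.map σ.boundary σ.boundary.contMDiff :=
    SmoothSimplex.eq_of_toFun fun t =>
      (σ.toFun_congr (diskChart_faceMap_zero t)).trans (σ.boundary_apply _).symm
  -- The other two edges are the same constant simplex and enter the boundary with opposite signs.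
  have e1 : σ.simplex.face 1 = σ.simplex.face 2 := SmoothSimplex.eq_of_toFun fun t =>
    σ.toFun_congr ((diskChart_faceMap_one t).trans (diskChart_faceMap_two t).symm)
  rw [Disk.chain, chainBoundary_single, Fin.sum_univ_three, e0, e1]
  simp

variable [IsManifold 𝓘(ℝ, E) ∞ X]

theorem DiffCharacter.eval_ne_zero (ξ : DiffCharacter (E := E) X) (z : SmoothChain 𝓘(ℝ, E) X 2) :
    ξ.eval z ≠ 0 := by
  rw [DiffCharacter.eval]
  split_ifs
  · exact Circle.coe_ne_zero _
  · exact one_ne_zero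

theorem DiffCharacter.eval_add (ξ : DiffCharacter (E := E) X) {z w : SmoothChain 𝓘(ℝ, E) X 2}
    (hz : chainBoundary z = 0) (hw : chainBoundary w = 0) :
    ξ.eval (z + w) = ξ.eval z * ξ.eval w := by
  have hzw : chainBoundary (z + w) = 0 := by rw [map_add, hz, hw, add_zero]
  rw [DiffCharacter.eval, DiffCharacter.eval, DiffCharacter.eval, dif_pos hz, dif_pos hw,
    dif_pos hzw, ← Circle.coe_mul, ← toMul_add, ← map_add]
  rfl

variable {S : Type*} [TopologicalSpace S] [ChartedSpace (EuclideanHalfSpace 2) S]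

/-- The glued cycle of the first disk is the sphere plus the glued cycle of the second. Both
summands must be seen to be cycles, as `eval` is additive only there. -/
theorem DiffCharacter.gluedHol_eq (ξ : DiffCharacter (E := E) X) (Λ : WorldSheet S)
    {σ₁ σ₂ : Disk (E := E) X} {ν : ContMDiffMap (𝓡∂ 2) 𝓘(ℝ, E) S X ∞}
    (h₁ : ∀ z, σ₁.boundary z = ν (Λ.bdry z)) (h₂ : ∀ z, σ₂.boundary z = ν (Λ.bdry z)) :
    ξ.gluedHol Λ σ₁ ν = ξ.sphereHol σ₁ σ₂ * ξ.gluedHol Λ σ₂ ν := by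
  have hν : ∀ {σ : Disk (E := E) X}, (∀ z, σ.boundary z = ν (Λ.bdry z)) →
      chainBoundary σ.chain = chainBoundary (chainMap ν ν.contMDiff Λ.fund) := fun {σ} h => by
    rw [chainBoundary_chainMap, Λ.boundary_fund, chainMap_single, σ.chainBoundary_chain]
    congr 1
    exact SmoothSimplex.eq_of_toFun fun t => h _
  rw [DiffCharacter.gluedHol, DiffCharacter.gluedHol, DiffCharacter.sphereHol, ← ξ.eval_add,
    sub_add_sub_cancel]
  · rw [map_sub, hν h₁, hν h₂, sub_self]
  · rw [map_sub, hν h₂, sub_self]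

end Disks

end

/-! ### The theorem, and the cancellation of factors in the world-sheet action -/

theorem mainTheorem3
    -- the manifold `Q`, the gerbe `(R, Y)` with its circle bundle `P`, the module with frame bundle `F`
    {EQ EY EP EF : Type*}
    [NormedAddCommGroup EQ] [NormedSpace ℝ EQ] [FiniteDimensional ℝ EQ]
    [NormedAddCommGroup EY] [NormedSpace ℝ EY] [FiniteDimensional ℝ EY]
    [NormedAddCommGroup EP] [NormedSpace ℝ EP] [FiniteDimensional ℝ EP]
    [NormedAddCommGroup EF] [NormedSpace ℝ EF] [FiniteDimensional ℝ EF]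
    {Q Y P F : Type*}
    [TopologicalSpace Q] [ChartedSpace EQ Q] [IsManifold 𝓘(ℝ, EQ) ∞ Q]
    [T2Space Q] [SecondCountableTopology Q]
    [TopologicalSpace Y] [ChartedSpace EY Y] [IsManifold 𝓘(ℝ, EY) ∞ Y]
    [T2Space Y] [SecondCountableTopology Y]
    [TopologicalSpace P] [ChartedSpace EP P] [IsManifold 𝓘(ℝ, EP) ∞ P] [MulAction Circle P]
    [TopologicalSpace F] [ChartedSpace EF F] [IsManifold 𝓘(ℝ, EF) ∞ F]
    (G : BundleGerbe (EQ := EQ) (EY := EY) (EP := EP) Q Y P) {n : ℕ}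
    (A : GerbeModule (EF := EF) G n F)
    -- the manifold `M` containing `Q`, and the world-sheet
    {EM : Type*} [NormedAddCommGroup EM] [NormedSpace ℝ EM] [FiniteDimensional ℝ EM]
    {M : Type*} [TopologicalSpace M] [ChartedSpace EM M] [IsManifold 𝓘(ℝ, EM) ∞ M]
    [T2Space M] [SecondCountableTopology M]
    (incl : Q → M) (hincl : Manifold.IsSmoothEmbedding 𝓘(ℝ, EQ) 𝓘(ℝ, EM) ∞ incl)
    {S : Type*} [TopologicalSpace S] [ChartedSpace (EuclideanHalfSpace 2) S]
    [IsManifold (𝓡∂ 2) ∞ S] [CompactSpace S] [ConnectedSpace S] [T2Space S]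
    (Λ : WorldSheet S) :
    -- `s_A` is well defined
    (∀ σ : Disk (E := EQ) Q, Nonempty (Trivialisation G σ) ∧
      ∀ T : Trivialisation G σ, (∃ τ, IsTrHol T A τ) ∧
        ∀ τ, IsTrHol T A τ → sA A σ = τ * Complex.exp (Complex.I * T.integral)) ∧
    -- the holonomy over the spheres `σ₁ # σ₂` is well defined
    (∀ σ₁ σ₂ : Disk (E := EQ) Q, σ₁.boundary = σ₂.boundary →
      (∃ (T₁ : Trivialisation G σ₁) (T₂ : Trivialisation G σ₂), Nonempty (BoundaryIso T₁ T₂)) ∧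
      ∀ (T₁ : Trivialisation G σ₁) (T₂ : Trivialisation G σ₂), BoundaryIso T₁ T₂ →
        G.sphereHol σ₁ σ₂ = Complex.exp (Complex.I * (T₁.integral - T₂.integral))) ∧
    -- the transformation rule
    TransformsAsSection G.sphereHol (sA A) ∧
    -- the fibres of the transgression bundle are lines
    (∀ σ : Disk (E := EQ) Q, BijOn (TransgressionBundle.mk G.sphereHol σ) univ
      (TransgressionBundle.proj ⁻¹' {σ.boundary})) ∧
    -- `s_A` defines a section
    (∃! trhol : BoundingLoop (E := EQ) Q → TransgressionBundle (E := EQ) (X := Q) G.sphereHol,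
      (∀ γ, (trhol γ).proj = γ.1) ∧
      ∀ σ : Disk (E := EQ) Q,
        trhol ⟨σ.boundary, σ, rfl⟩ = TransgressionBundle.mk G.sphereHol σ (sA A σ)) ∧
    -- the world-sheet action is a well-defined function
    (∀ (ξ : DiffCharacter (E := EM) M) (α : DiffCharacter (E := EQ) Q)
      (Pf : Disk (E := EQ) Q → BoundaryIn (EM := EM) Λ incl → ℂ) (χ : Disk (E := EQ) Q → ℂ),
      (∀ ν σ₁ σ₂, SameBoundary σ₁ ν → SameBoundary σ₂ ν →
        Pf σ₁ ν = α.sphereHol σ₁ σ₂ * Pf σ₂ ν) →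
      TransformsAsSection (fun σ₁ σ₂ => (α.sphereHol σ₁ σ₂)⁻¹ * (G.sphereHol σ₁ σ₂)⁻¹ *
        ξ.sphereHol (σ₁.map incl hincl.contMDiff) (σ₂.map incl hincl.contMDiff)) χ →
      ∃! W : {ν : BoundaryIn (EM := EM) Λ incl // ∃ σ : Disk (E := EQ) Q, SameBoundary σ ν} → ℂ,
        ∀ ν σ, SameBoundary σ ν.1 →
          W ν = Pf σ ν.1 * sA A σ *
            (ξ.gluedHol Λ (σ.map incl hincl.contMDiff) ν.1.1)⁻¹ * χ σ) := by
  refine ⟨fun σ => ⟨nonempty_trivialisation G σ, fun T => ⟨T.exists_isTrHol A, fun τ h => sA_eq h⟩⟩,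
    fun σ₁ σ₂ hσ => ⟨?_, fun T₁ T₂ b => G.sphereHol_eq hσ b.loopIso⟩, transformsAsSection_sA A,
    TransgressionBundle.bijOn_mk G.sphereHol_self fun _ _ _ => G.sphereHol_mul,
    TransgressionBundle.existsUnique_section (transformsAsSection_sA A), fun ξ α Pf χ hPf hχ => ?_⟩
  · obtain ⟨T₂⟩ := nonempty_trivialisation G σ₂
    obtain ⟨T₁, hb⟩ := G.exists_boundaryIso hσ T₂
    exact ⟨T₁, T₂, hb⟩
  have hf := hincl.contMDiff
  have key : ∀ ν σ₁ σ₂, SameBoundary σ₁ ν → SameBoundary σ₂ ν →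
      Pf σ₁ ν * sA A σ₁ * (ξ.gluedHol Λ (σ₁.map incl hf) ν.1)⁻¹ * χ σ₁ =
        Pf σ₂ ν * sA A σ₂ * (ξ.gluedHol Λ (σ₂.map incl hf) ν.1)⁻¹ * χ σ₂ := by
    intro ν σ₁ σ₂ h₁ h₂
    -- The boundaries agree in `M`, and the inclusion is injective.
    have hσ : σ₁.boundary = σ₂.boundary := by
      ext z
      exact hincl.isEmbedding.injective ((h₁ z).trans (h₂ z).symm)
    have e₁ : α.sphereHol σ₁ σ₂ ≠ 0 := α.eval_ne_zero _
    have e₂ : ξ.sphereHol (σ₁.map incl hf) (σ₂.map incl hf) ≠ 0 := ξ.eval_ne_zero _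
    have e₃ : G.sphereHol σ₁ σ₂ ≠ 0 := G.sphereHol_ne_zero hσ
    have e₄ : ξ.gluedHol Λ (σ₂.map incl hf) ν.1 ≠ 0 := ξ.eval_ne_zero _
    -- The factors are those of `α` from `Pf`, of the gerbe from `sA`, the inverse of that of `ξ`
    -- from the glued surface, and from `χ` the inverse of their product. None of them vanishes.
    rw [hPf ν σ₁ σ₂ h₁ h₂, transformsAsSection_sA A σ₁ σ₂ hσ, hχ σ₁ σ₂ hσ,
      ξ.gluedHol_eq Λ (fun z => (σ₁.boundary_map hf z).trans (h₁ z))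
        fun z => (σ₂.boundary_map hf z).trans (h₂ z)]
    field_simp
  refine ⟨fun ν => Pf ν.2.choose ν.1 * sA A ν.2.choose *
    (ξ.gluedHol Λ (ν.2.choose.map incl hf) ν.1.1)⁻¹ * χ ν.2.choose,
    fun ν σ h => key ν.1 _ σ ν.2.choose_spec h, fun W hW => ?_⟩
  ext ν
  exact hW ν _ ν.2.choose_spec
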